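/- **Theorem (The contracted second Bianchi identity).** Let $n\ge 1$, and put $\epsilon_1=\epsilon_2=1$, $\epsilon_3=-1$. Let $M$ be a smooth manifold of dimension $4n+3$ with a paraquaternionic contact (pqc) structure and a fixed metric $g$ of its conformal class. That is, $M$ carries a codimension three distribution $H$, a neutral metric $g$ of signature $(2n,2n)$ on $H$, and a rank-three bundle $\mathbb{PQ}\subset \mathrm{End}(H)$, such that near every point there are smooth 1-forms $\eta_1,\eta_2,\eta_3$ with $H=\bigcap_s\ker\eta_s$ and local generators $I_1,I_2,I_3$ of $\mathbb{PQ}$ with $$I_1^2=I_2^2=\mathrm{id},\quad I_3^2=-\mathrm{id},\quad I_1I_2=-I_2I_1=I_3,\quad g(I_sX,I_sY)=-\epsilon_s g(X,Y),\quad d\eta_s(X,Y)=-2\epsilon_s g(I_sX,Y)$$ for $X,Y\in H$, where $d\eta(A,B)=A\eta(B)-B\eta(A)-\eta([A,B])$; we call such $(\eta_s,I_s)$ local data. Let $V$ be the vertical distribution: $TM=H\oplus V$, and $V$ is locally generated by smooth Reeb vector fields $\xi_1,\xi_2,\xi_3$, for some local data, with $\eta_s(\xi_t)=\delta_{st}$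 and $(\xi_s\lrcorner d\eta_s)|_H=0$. In dimension seven ($n=1$) it is part of the definition of a pqc structure that such $\xi_s$ exist which satisfy in addition $(\xi_j\lrcorner d\eta_i)|_H=\epsilon_k(\xi_i\lrcorner d\eta_j)|_H$ for cyclic permutations $(i,j,k)$ of $(1,2,3)$. Let $\nabla$ be the canonical pqc connection, i.e. the linear connection on $M$, with torsion $T$, such that 1. $\nabla$ preserves $H$ and $V$, $\nabla g=0$, and $\nabla\sigma$ takes values in $\mathbb{PQ}$ for every section $\sigma$ of $\mathbb{PQ}$; 2. $T(X,Y)=-[X,Y]_V$ for $X,Y\in H$; 3. for $\xi\in V$ the endomorphism $X\mapsto T(\xi,X)_H$ of $H$ lies in $(sp(n,\mathbb R)\oplus sp(1,\mathbb R))^\perp\subset gl(4n)$, where $sp(n,\mathbb R)$ consists of the $g$-skew endomorphisms commuting with $\mathbb{PQ}$, $sp(1,\mathbb R)=\mathbb{PQ}$, and $\langle A,B\rangle=\sum_a g(e_a,e_a)\,g(Ae_a,Be_a)$; 4. the identification $V\to\mathbb{PQ}$, $\xi_s\mapsto I_s$, is parallel. For a $g$-orthonormal basis $e_1,\dots,e_{4n}$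 of $H$ a repeated $e_a$ means the metric contraction, $P(e_a,e_a)=\sum_a g(e_a,e_a)P(e_a,e_a)$. Put $R(A,B)=[\nabla_A,\nabla_B]-\nabla_{[A,B]}$ and, for $X,Y\in H$, $Ric(X,Y)=g(R(e_a,X)Y,e_a)$, $Scal=Ric(e_a,e_a)$. For $\xi\in V$ let $T^0(\xi,X,Y)$ and $T^a(\xi,X,Y)$ be the symmetric and the skew-symmetric part in $X,Y\in H$ of $g(T(\xi,X),Y)$, and put, for any local data $(\eta_s,I_s)$ and the sections $\xi_s$ of $V$ with $\eta_s(\xi_t)=\delta_{st}$, $$\tau(X,Y)=-\sum_{s=1}^3\epsilon_s T^0(\xi_s,I_sX,Y),\qquad \mu(X,Y)=\epsilon_s T^a(\xi_s,I_sX,Y)\quad\text{for any one } s\in\{1,2,3\}$$ (the choices do not matter). Then for every $X\in H$ $$(n-1)(\nabla_{e_a}\tau)(e_a,X)+2(n+2)(\nabla_{e_a}\mu)(e_a,X)-\frac{(n-1)(2n+1)}{8n(n+2)}\,d(Scal)(X)=0.$$ -/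

import Mathlib

open Bundle VectorField
open scoped Manifold ContDiff

noncomputable section

namespace PQC

/-! ### Linear algebra on a finite dimensional space with a pseudo-Euclidean metric -/

section Algebra

variable {W : Type*} [AddCommGroup W] [Module ℝ W] [FiniteDimensional ℝ W]

/-- The metric contraction `P(e_a, e_a) = ∑ a, g(e_a, e_a) P(e_a, e_a)` of a `(0,2)`-tensor `P`,
written with an arbitrary basis `b_a` and its `g`-dual basis `b^a` as `∑ a, P(b_a, b^a)`. It does
not depend on the basis; for a `g`-orthonormal basis see `metricTrace_eq_sum_orthonormal`. -/
def metricTrace (g : LinearMap.BilinForm ℝ W) (hg : g.Nondegenerate) (P : W → W → ℝ) : ℝ :=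
  ∑ a, P (Module.finBasis ℝ W a) (g.dualBasis hg (Module.finBasis ℝ W) a)

/-- In a basis with `g(e_a, e_b) = ± δ_{ab}`, the metric contraction is the signed sum
`∑ a, g(e_a, e_a) P(e_a, e_a)`. -/
theorem metricTrace_eq_sum_orthonormal (g : LinearMap.BilinForm ℝ W) (hg : g.Nondegenerate)
    (hs : g.IsSymm) (P : LinearMap.BilinForm ℝ W) {ι : Type*} [Fintype ι]
    (e : Module.Basis ι ℝ W) (h0 : ∀ a b, a ≠ b → g (e a) (e b) = 0)
    (h1 : ∀ a, g (e a) (e a) = 1 ∨ g (e a) (e a) = -1) :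
    metricTrace g hg (fun u v => P u v) = ∑ a, g (e a) (e a) * P (e a) (e a) := by
  classical
  set b := Module.finBasis ℝ W with hb
  set b' := g.dualBasis hg b with hb'
  have hexp : ∀ v, v = ∑ a, (g (e a) (e a) * g (e a) v) • e a := by
    intro v
    conv_lhs => rw [← e.sum_repr v]
    refine Finset.sum_congr rfl fun a _ => ?_
    have : g (e a) v = e.repr v a * g (e a) (e a) := by
      conv_lhs => rw [← e.sum_repr v]
      rw [map_sum, Finset.sum_eq_single a]
      · simp
      · intro c _ hc
        simp [h0 a c (Ne.symm hc)]
      · simp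
    rw [this]
    rcases h1 a with h | h <;> simp [h]
  have hdual : ∀ v, v = ∑ i, g (b' i) v • b i := by
    intro v
    conv_lhs => rw [← b.sum_repr v]
    refine Finset.sum_congr rfl fun i _ => ?_
    congr 1
    conv_rhs => rw [← b.sum_repr v]
    rw [map_sum, Finset.sum_eq_single i]
    · simp [hb', LinearMap.BilinForm.apply_dualBasis_left]
    · intro c _ hc
      simp [hb', LinearMap.BilinForm.apply_dualBasis_left, hc]
    · simp
  have key : ∀ i, P (b i) (b' i) =
      ∑ a, g (e a) (e a) * (g (b' i) (e a) * P (b i) (e a)) := by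
    intro i
    conv_lhs => rw [hexp (b' i)]
    simp only [map_sum, map_smul, smul_eq_mul]
    refine Finset.sum_congr rfl fun a _ => ?_
    rw [hs.eq (e a) (b' i)]
    ring
  unfold metricTrace
  simp only [← hb, ← hb', key]
  rw [Finset.sum_comm]
  refine Finset.sum_congr rfl fun a _ => ?_
  rw [← Finset.mul_sum]
  congr 1
  conv_rhs => rw [LinearMap.congr_fun (congrArg P (hdual (e a))) (e a)]
  simp

/-- `g` is neutral: on a space of dimension `2m`, it has signature `(m, m)`. -/
def IsNeutral (g : LinearMap.BilinForm ℝ W) (m : ℕ) : Prop :=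
  ∃ P N : Submodule ℝ W, Module.finrank ℝ P = m ∧ Module.finrank ℝ N = m ∧
    Module.finrank ℝ W = 2 * m ∧
    (∀ u ∈ P, u ≠ 0 → 0 < g u u) ∧ (∀ u ∈ N, u ≠ 0 → g u u < 0)

/-- The inner product `⟨A, B⟩ = g(e_a, e_a) g(A e_a, B e_a)` (summed over `a`) of endomorphisms. -/
def endInner (g : LinearMap.BilinForm ℝ W) (hg : g.Nondegenerate) (A B : Module.End ℝ W) : ℝ :=
  metricTrace g hg (fun u v => g (A u) (B v))

/-- `A ∈ (sp(n, ℝ) ⊕ sp(1, ℝ))^⊥ ⊆ gl(4n)`. Here `sp(n, ℝ)` consists of the `g`-skew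
endomorphisms that commute with the paraquaternionic structure `Q`, and `sp(1, ℝ)` is `Q`. -/
def MemSpPerp (g : LinearMap.BilinForm ℝ W) (hg : g.Nondegenerate)
    (Q : Submodule ℝ (Module.End ℝ W)) (A : Module.End ℝ W) : Prop :=
  (∀ B : Module.End ℝ W, (∀ u v, g (B u) v = - g u (B v)) → (∀ J ∈ Q, B * J = J * B) →
    endInner g hg A B = 0) ∧
  ∀ J ∈ Q, endInner g hg A J = 0

end Algebra

/-- The signs `ε₁ = ε₂ = 1`, `ε₃ = -1`; the index set `{1, 2, 3}` is `Fin 3`, so that the cyclic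
permutations `(i, j, k)` of `(1, 2, 3)` are the triples `(i, i + 1, i + 2)`. -/
def eps : Fin 3 → ℝ := ![1, 1, -1]

/-! ### Calculus on a manifold of dimension `4n + 3` -/

/-- The model space of `(4n + 3)`-dimensional manifolds. -/
abbrev Model (n : ℕ) : Type := EuclideanSpace ℝ (Fin (4 * n + 3))

section Manifold

variable {n : ℕ} {M : Type*} [TopologicalSpace M] [ChartedSpace (Model n) M]

/-- The tangent space at `x`. -/
abbrev Tan (n : ℕ) {M : Type*} [TopologicalSpace M] [ChartedSpace (Model n) M] (x : M) : Type :=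
  TangentSpace (𝓡 (4 * n + 3)) x

instance (x : M) : FiniteDimensional ℝ (Tan n x) :=
  inferInstanceAs (FiniteDimensional ℝ (Model n))

/-- A section of a field of subspaces of the tangent spaces, as a vector field. -/
def toField {W : Π x : M, Submodule ℝ (Tan n x)} (Y : Π x, W x) : Π x : M, Tan n x :=
  fun x => (Y x : Tan n x)

/-- The vector field `X` is differentiable at `x`. -/
abbrev DiffAt [IsManifold (𝓡 (4 * n + 3)) ∞ M] (X : Π x : M, Tan n x) (x : M) : Prop :=
  MDifferentiableAt (𝓡 (4 * n + 3)) (𝓡 (4 * n + 3)).tangent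
    (fun y => (⟨y, X y⟩ : TangentBundle (𝓡 (4 * n + 3)) M)) x

/-- The vector field `X` is smooth at `x`. -/
abbrev SmoothAt [IsManifold (𝓡 (4 * n + 3)) ∞ M] (X : Π x : M, Tan n x) (x : M) : Prop :=
  ContMDiffAt (𝓡 (4 * n + 3)) (𝓡 (4 * n + 3)).tangent ∞
    (fun y => (⟨y, X y⟩ : TangentBundle (𝓡 (4 * n + 3)) M)) x

/-- The 1-form `θ` is smooth on `U`, as a section of the cotangent bundle. -/
abbrev SmoothFormOn [IsManifold (𝓡 (4 * n + 3)) ∞ M] (θ : Π x : M, Tan n x →L[ℝ] ℝ)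
    (U : Set M) : Prop :=
  ContMDiffOn (𝓡 (4 * n + 3)) ((𝓡 (4 * n + 3)).prod 𝓘(ℝ, Model n →L[ℝ] ℝ)) ∞
    (fun x => TotalSpace.mk' (Model n →L[ℝ] ℝ)
      (E := fun x : M => TangentSpace (𝓡 (4 * n + 3)) x →L[ℝ] Bundle.Trivial M ℝ x) x (θ x)) U

/-- The derivative `df_x(v)` of a real function. -/
def dFun (f : M → ℝ) (x : M) (v : Tan n x) : ℝ := mvfderiv (𝓡 (4 * n + 3)) f x v

/-- The exterior derivative of a 1-form:
`dθ(X, Y) = X(θ(Y)) - Y(θ(X)) - θ([X, Y])` at the point `x`. -/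
def dForm (θ : Π x : M, Tan n x →L[ℝ] ℝ) (X Y : Π x : M, Tan n x) (x : M) : ℝ :=
  dFun (fun y => θ y (Y y)) x (X x) - dFun (fun y => θ y (X y)) x (Y x)
    - θ x (mlieBracket (𝓡 (4 * n + 3)) X Y x)

end Manifold

/-! ### Paraquaternionic contact manifolds -/

/-- A field of subspaces `H` of the tangent spaces, a bilinear form `g` on each `H x`, and a
space `PQ x` of endomorphisms of each `H x`. -/
structure HorizontalData (n : ℕ) (M : Type*) [TopologicalSpace M] [ChartedSpace (Model n) M] where
  H : Π x : M, Submodule ℝ (Tan n x)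
  g : Π x : M, LinearMap.BilinForm ℝ (H x)
  PQ : Π x : M, Submodule ℝ (Module.End ℝ (H x))

section Structure

variable {n : ℕ} {M : Type*} [TopologicalSpace M] [ChartedSpace (Model n) M]
  [IsManifold (𝓡 (4 * n + 3)) ∞ M]

/-- A field `σ` of endomorphisms of `H` is smooth at `x`: it maps horizontal fields that are
smooth at `x` to such fields. -/
def SmoothEndAt (D : HorizontalData n M) (σ : Π x, Module.End ℝ (D.H x)) (x : M) : Prop :=
  ∀ Y : Π y, D.H y, SmoothAt (toField Y) x → SmoothAt (toField fun y => σ y (Y y)) x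

/-- `(η₁, η₂, η₃)` and `(I₁, I₂, I₃)` are local data of the pqc structure on the open set `U`. -/
structure IsLocalFrame (D : HorizontalData n M) (U : Set M)
    (η : Fin 3 → Π x : M, Tan n x →L[ℝ] ℝ) (I : Fin 3 → Π x : M, Module.End ℝ (D.H x)) :
    Prop where
  η_smooth : ∀ s, SmoothFormOn (η s) U
  I_smooth : ∀ s, ∀ x ∈ U, SmoothEndAt D (I s) x
  mem_H_iff : ∀ x ∈ U, ∀ v : Tan n x, v ∈ D.H x ↔ ∀ s, η s x v = 0
  PQ_eq : ∀ x ∈ U, D.PQ x = Submodule.span ℝ (Set.range fun s => I s x)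
  I₁_sq : ∀ x ∈ U, I 0 x * I 0 x = 1
  I₂_sq : ∀ x ∈ U, I 1 x * I 1 x = 1
  I₃_sq : ∀ x ∈ U, I 2 x * I 2 x = -1
  I₁_mul_I₂ : ∀ x ∈ U, I 0 x * I 1 x = I 2 x
  I₂_mul_I₁ : ∀ x ∈ U, I 1 x * I 0 x = -I 2 x
  /-- `g(I_s ·, I_s ·) = -ε_s g(·, ·)`. -/
  compatible : ∀ s, ∀ x ∈ U, ∀ u v : D.H x, D.g x (I s x u) (I s x v) = -eps s * D.g x u v
  /-- `dη_s(X, Y) = -2 ε_s g(I_s X, Y)` for horizontal `X`, `Y`. -/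
  contact : ∀ s, ∀ x ∈ U, ∀ X Y : Π y, D.H y, DiffAt (toField X) x → DiffAt (toField Y) x →
    dForm (η s) (toField X) (toField Y) x = -2 * eps s * D.g x (I s x (X x)) (Y x)

variable (n M) in
/-- A paraquaternionic contact structure on a manifold of dimension `4n + 3`, together with a
fixed metric `g` of its conformal class. -/
structure PQCStructure extends HorizontalData n M where
  /-- `H` has codimension three. -/
  finrank_H : ∀ x, Module.finrank ℝ (H x) = 4 * n
  g_symm : ∀ x, (g x).IsSymm
  g_nondegenerate : ∀ x, (g x).Nondegenerate
  /-- `g` has signature `(2n, 2n)`. -/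
  g_neutral : ∀ x, IsNeutral (g x) (2 * n)
  g_smooth : ∀ X Y : Π y, H y, ∀ x, SmoothAt (toField X) x → SmoothAt (toField Y) x →
    ContMDiffAt (𝓡 (4 * n + 3)) 𝓘(ℝ, ℝ) ∞ (fun y => g y (X y) (Y y)) x
  exists_frame : ∀ x, ∃ U : Set M, IsOpen U ∧ x ∈ U ∧
    ∃ (η : Fin 3 → Π x : M, Tan n x →L[ℝ] ℝ) (I : Fin 3 → Π x : M, Module.End ℝ (H x)),
      IsLocalFrame toHorizontalData U η I

/-- The Reeb vector fields `ξ₁, ξ₂, ξ₃` of `η` on `U`: `η_s(ξ_t) = δ_{st}` and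
`(ξ_s ⌟ dη_s)|_H = 0`; in dimension seven they are required to satisfy in addition
`(ξ_j ⌟ dη_i)|_H = ε_k (ξ_i ⌟ dη_j)|_H` for cyclic `(i, j, k)`. -/
structure IsReeb (D : HorizontalData n M) (U : Set M) (η : Fin 3 → Π x : M, Tan n x →L[ℝ] ℝ)
    (ξ : Fin 3 → Π x : M, Tan n x) : Prop where
  smooth : ∀ s, ∀ x ∈ U, SmoothAt (ξ s) x
  dual : ∀ x ∈ U, ∀ s t, η s x (ξ t x) = if s = t then 1 else 0
  contraction : ∀ s, ∀ x ∈ U, ∀ X : Π y, D.H y, DiffAt (toField X) x →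
    dForm (η s) (ξ s) (toField X) x = 0
  seven : n = 1 → ∀ i : Fin 3, ∀ x ∈ U, ∀ X : Π y, D.H y, DiffAt (toField X) x →
    dForm (η i) (ξ (i + 1)) (toField X) x
      = eps (i + 2) * dForm (η (i + 1)) (ξ i) (toField X) x

/-- `V` is the vertical distribution: it is complementary to `H` and locally generated by Reeb
vector fields. -/
structure IsVertical (S : PQCStructure n M) (V : Π x : M, Submodule ℝ (Tan n x)) : Prop where
  compl : ∀ x, IsCompl (S.H x) (V x)
  exists_reeb : ∀ x, ∃ U : Set M, IsOpen U ∧ x ∈ U ∧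
    ∃ (η : Fin 3 → Π x : M, Tan n x →L[ℝ] ℝ) (I : Fin 3 → Π x : M, Module.End ℝ (S.H x))
      (ξ : Fin 3 → Π x : M, Tan n x),
      IsLocalFrame S.toHorizontalData U η I ∧ IsReeb S.toHorizontalData U η ξ ∧
      ∀ y ∈ U, V y = Submodule.span ℝ (Set.range fun s => ξ s y)

/-- A linear connection on `M`; `D Y x v` is `∇_v Y` at the point `x`. -/
abbrev Connection (n : ℕ) (M : Type*) [TopologicalSpace M] [ChartedSpace (Model n) M]
    [IsManifold (𝓡 (4 * n + 3)) ∞ M] : Type _ :=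
  CovariantDerivative (𝓡 (4 * n + 3)) (Model n) (fun x : M => TangentSpace (𝓡 (4 * n + 3)) x)

section Projections

variable (S : PQCStructure n M) {V : Π x : M, Submodule ℝ (Tan n x)}

/-- The projection of the tangent space onto `H` along `V`. -/
def projH (hV : IsVertical S V) (x : M) : Tan n x →ₗ[ℝ] S.H x :=
  (S.H x).projectionOnto (V x) (hV.compl x)

/-- The projection of the tangent space onto `V` along `H`. -/
def projV (hV : IsVertical S V) (x : M) : Tan n x →ₗ[ℝ] V x :=
  (V x).projectionOnto (S.H x) (hV.compl x).symm

/-- The horizontal part of `∇_v Y` for a horizontal field `Y`. For a connection that preserves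
`H` this is `∇_v Y`. -/
def covH (hV : IsVertical S V) (D : Connection n M) (Y : Π y, S.H y) (x : M) (v : Tan n x) :
    S.H x :=
  projH S hV x (D (toField Y) x v)

/-- The endomorphism `X ↦ T(v, X)_H` of `H`, where `T` is the torsion of the connection. -/
def torsionEnd (hV : IsVertical S V) (D : Connection n M) (x : M) (v : Tan n x) :
    Module.End ℝ (S.H x) :=
  projH S hV x ∘ₗ (D.torsion x v).toLinearMap ∘ₗ (S.H x).subtype

/-- The natural identification of `V` with the bundle `PQ ≅ sp(1, ℝ)` that takes `ξ_s` to `I_s`,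
namely `v ↦ ∑ s, η_s(v) I_s`. -/
def identification (η : Fin 3 → Π x : M, Tan n x →L[ℝ] ℝ)
    (I : Fin 3 → Π x : M, Module.End ℝ (S.H x)) (x : M) (v : Tan n x) : Module.End ℝ (S.H x) :=
  ∑ s, η s x v • I s x

/-- `D` is the canonical pqc connection of the pqc structure with its fixed metric. -/
structure IsCanonicalConnection (hV : IsVertical S V) (D : Connection n M) : Prop where
  smooth : D.ContMDiffCovariantDerivative ∞
  preserves_H : ∀ (Y : Π y, S.H y) (x : M), DiffAt (toField Y) x →
    ∀ v, D (toField Y) x v ∈ S.H x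
  preserves_V : ∀ (Z : Π y, V y) (x : M), DiffAt (toField Z) x →
    ∀ v, D (toField Z) x v ∈ V x
  /-- `∇g = 0`. -/
  metric : ∀ (Y Z : Π y, S.H y) (x : M), DiffAt (toField Y) x → DiffAt (toField Z) x →
    ∀ v, dFun (fun y => S.g y (Y y) (Z y)) x v
      = S.g x (covH S hV D Y x v) (Z x) + S.g x (Y x) (covH S hV D Z x v)
  /-- `∇σ` is a section of `PQ` for every section `σ` of `PQ`. -/
  preserves_PQ : ∀ (σ : Π y, Module.End ℝ (S.H y)) (x : M), (∀ y, σ y ∈ S.PQ y) →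
    SmoothEndAt S.toHorizontalData σ x → ∀ v, ∃ A ∈ S.PQ x,
      ∀ Y : Π y, S.H y, DiffAt (toField Y) x →
        covH S hV D (fun y => σ y (Y y)) x v - σ x (covH S hV D Y x v) = A (Y x)
  /-- `T(X, Y) = -[X, Y]_V` for horizontal `X`, `Y`. -/
  torsion_H : ∀ (X Y : Π y, S.H y) (x : M), DiffAt (toField X) x → DiffAt (toField Y) x →
    D.torsion x (X x : Tan n x) (Y x : Tan n x)
      = -(projV S hV x (mlieBracket (𝓡 (4 * n + 3)) (toField X) (toField Y) x) : Tan n x)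
  /-- The endomorphism `T(v, ·)_H` of `H` lies in `(sp(n, ℝ) ⊕ sp(1, ℝ))^⊥` for vertical `v`. -/
  torsion_V : ∀ (x : M), ∀ v ∈ V x,
    MemSpPerp (S.g x) (S.g_nondegenerate x) (S.PQ x) (torsionEnd S hV D x v)
  /-- The natural identification `φ` of `V` with `PQ` is parallel:
  `(∇_v (φ(Z))) Y = φ(∇_v Z) Y` for vertical `Z` and horizontal `Y`. -/
  parallel_identification : ∀ (U : Set M) (η : Fin 3 → Π x : M, Tan n x →L[ℝ] ℝ)
    (I : Fin 3 → Π x : M, Module.End ℝ (S.H x)), IsOpen U →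
    IsLocalFrame S.toHorizontalData U η I → ∀ x ∈ U, ∀ (Z : Π y, V y) (Y : Π y, S.H y),
      DiffAt (toField Z) x → DiffAt (toField Y) x → ∀ v,
        covH S hV D (fun y => identification S η I y (Z y) (Y y)) x v
            - identification S η I x (Z x) (covH S hV D Y x v)
          = identification S η I x (D (toField Z) x v) (Y x)

/-! ### Curvature, torsion tensors and their derivatives -/

/-- The curvature `R(u, v)w = ∇_u ∇_v w - ∇_v ∇_u w - ∇_[u, v] w` at `x`, computed by extending
`u`, `v`, `w` to vector fields that are smooth near `x`; it does not depend on the extension. -/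
def curvature (D : Connection n M) (x : M) (u v w : Tan n x) : Tan n x :=
  let X : Π y : M, TangentSpace (𝓡 (4 * n + 3)) y := FiberBundle.extend (Model n) u
  let Y : Π y : M, TangentSpace (𝓡 (4 * n + 3)) y := FiberBundle.extend (Model n) v
  let Z : Π y : M, TangentSpace (𝓡 (4 * n + 3)) y := FiberBundle.extend (Model n) w
  D (fun y => D Z y (Y y)) x u - D (fun y => D Z y (X y)) x v
    - D Z x (mlieBracket (𝓡 (4 * n + 3)) X Y x)

/-- The horizontal pqc-Ricci tensor `Ric(B, C) = R(e_a, B, C, e_a)`. -/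
def pqcRic (hV : IsVertical S V) (D : Connection n M) (x : M) (B C : S.H x) : ℝ :=
  metricTrace (S.g x) (S.g_nondegenerate x) fun a b =>
    S.g x (projH S hV x (curvature D x (a : Tan n x) (B : Tan n x) (C : Tan n x))) b

/-- The pqc-scalar curvature `Scal = Ric(e_a, e_a)`. -/
def pqcScal (hV : IsVertical S V) (D : Connection n M) (x : M) : ℝ :=
  metricTrace (S.g x) (S.g_nondegenerate x) (pqcRic S hV D x)

/-- The symmetric part `T⁰(v, X, Y)` of `T(v, X, Y) = g(T(v, X), Y)`. -/
def torsionSym (hV : IsVertical S V) (D : Connection n M) (x : M) (v : Tan n x)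
    (X Y : S.H x) : ℝ :=
  (S.g x (torsionEnd S hV D x v X) Y + S.g x (torsionEnd S hV D x v Y) X) / 2

/-- The skew-symmetric part `Tᵃ(v, X, Y)` of `T(v, X, Y) = g(T(v, X), Y)`. -/
def torsionSkew (hV : IsVertical S V) (D : Connection n M) (x : M) (v : Tan n x)
    (X Y : S.H x) : ℝ :=
  (S.g x (torsionEnd S hV D x v X) Y - S.g x (torsionEnd S hV D x v Y) X) / 2

/-- The tensor `τ(X, Y) = -∑ s, ε_s T⁰(ξ_s, I_s X, Y)`. -/
def tau (hV : IsVertical S V) (D : Connection n M) (I : Fin 3 → Π x : M, Module.End ℝ (S.H x))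
    (ξ : Fin 3 → Π x : M, Tan n x) (x : M) (X Y : S.H x) : ℝ :=
  -∑ s, eps s * torsionSym S hV D x (ξ s x) (I s x X) Y

/-- The tensor `μ_s(X, Y) = ε_s Tᵃ(ξ_s, I_s X, Y)`. -/
def mu (hV : IsVertical S V) (D : Connection n M) (I : Fin 3 → Π x : M, Module.End ℝ (S.H x))
    (ξ : Fin 3 → Π x : M, Tan n x) (s : Fin 3) (x : M) (X Y : S.H x) : ℝ :=
  eps s * torsionSkew S hV D x (ξ s x) (I s x X) Y

/-- A horizontal field with value `u` at `x` that is smooth near `x`. -/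
def extendH (hV : IsVertical S V) {x : M} (u : S.H x) (y : M) : S.H y :=
  projH S hV y ((FiberBundle.extend (Model n) (u : TangentSpace (𝓡 (4 * n + 3)) x) :
    Π y : M, TangentSpace (𝓡 (4 * n + 3)) y) y)

/-- The covariant derivative `(∇_v P)(X, Y) = v(P(X, Y)) - P(∇_v X, Y) - P(X, ∇_v Y)` of a
`(0,2)`-tensor `P` on `H` at `x`, computed by extending `X`, `Y` to horizontal fields that are
smooth near `x`; it does not depend on the extension. -/
def covTensor (hV : IsVertical S V) (D : Connection n M) (P : Π x, S.H x → S.H x → ℝ) (x : M)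
    (v : Tan n x) (X Y : S.H x) : ℝ :=
  dFun (fun y => P y (extendH S hV X y) (extendH S hV Y y)) x v
    - P x (covH S hV D (extendH S hV X) x v) Y - P x X (covH S hV D (extendH S hV Y) x v)

/-- The horizontal divergence `(∇_{e_a} P)(e_a, X)`. -/
def divergence (hV : IsVertical S V) (D : Connection n M) (P : Π x, S.H x → S.H x → ℝ) (x : M)
    (X : S.H x) : ℝ :=
  metricTrace (S.g x) (S.g_nondegenerate x) fun a b => covTensor S hV D P x (a : Tan n x) b X

end Projections

end Structure

end PQC

end

/-! ## The algebra of a paraquaternionic contact structure with its canonical connection -/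

noncomputable section

namespace PQC

/-! For n ≥ 2 the identity comes from eliminating one auxiliary 1-form between a contracted first
and a contracted second Bianchi identity. The computation takes place over the ring A of smooth
functions on an open set. `ContactAlgebra` records fields, horizontal fields, bracket and connection
as algebra, with N = 4n the size of a frame of H. Below, (i, j, k) is cyclic and T_i denotes X ↦
T(ξ_i, X).

Torsion. The vertical part of the first Bianchi identity on three horizontal fields shows that
T(ξ_s, X) is horizontal (`eta_tor_xi_inc`); this needs N ≠ 4. On (X, Y, ξ_i) it expresses the
curvature of V on horizontal pairs through the torsion. That curvature is skew for the metric of V,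
and together with the orthogonality of T_i to sp(n,ℝ) ⊕ sp(1,ℝ) this forces T(ξ_i, ξ_j) to have
vertical part ε_k Λ ξ_k for a single function Λ (`t_cyclic`). It also fixes how the symmetric and
skew parts of T_i commute with the I_s. Hence μ does not depend on the index (`U_eq`), and the
torsion enters the contracted curvature only through τ and μ (`sum_K_mul_I`).

Curvature. Since V ≅ PQ is parallel, the curvature of V and the PQ-part of the curvature R of H are
given by the same three 2-forms σ_k, and 2 tr(R I_k) = ε_k N σ_k (`tr_curH_mul_I`). On H the forms
are known from Λ and the torsion (`sig_inc`). On mixed pairs they involve dΛ and the horizontal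
parts h_k of T(ξ_i, ξ_j). With B(X) = ∑ g(I_k h_k, X) one finds 2 ∑ σ_k(X, ξ_k) = -3 dΛ(X) + 2 B(X)
(`two_mul_sum_sig_xi`). Contracting the horizontal Bianchi identity gives Scal = 8n(n+2) Λ
(`scal_eq`).

Two relations. The horizontal part of the first Bianchi identity on (X, Y, ξ_i), contracted in two
ways, gives the divergence of τ in terms of dΛ and B (`four_mul_div_tau2`). The second Bianchi
identity, traced against I_k and contracted, gives the divergence of 6Λ g + 2τ + 12μ in terms of the
same forms (`div_Phi`). Eliminating B proves the identity (`ContactAlgebra.contracted_bianchi`).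

For n = 1 the factor n - 1 removes τ and Scal. What remains is the divergence of μ, and μ vanishes
because the skew endomorphisms of the four-dimensional H are exactly sp(1,ℝ) ⊕ PQ
(`MemSpPerp.skew_eq_zero`).

Transfer to the manifold. Smooth functions and fields on a small open set form a `ContactAlgebra`
(`Patch.contactAlgebra`). Function-linear maps evaluate pointwise (`fn_linear_congr`), so the
tensors of the statement are the values of the algebraic ones. -/

/-- The signs `ε₁ = ε₂ = 1`, `ε₃ = -1` in a commutative ring. -/
def sg (A : Type*) [CommRing A] : Fin 3 → A := ![1, 1, -1]

/-! ### Signs and cyclic indices. -/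

section Signs

variable {A : Type*} [CommRing A]

@[simp] lemma sg_mul_self (i : Fin 3) : sg A i * sg A i = 1 := by
  fin_cases i <;> simp [sg]

/-- The product of the three signs is -1. -/
lemma sg_mul_sg' (i : Fin 3) : sg A (i + 1) * sg A (i + 2) = -sg A i := by
  fin_cases i <;> simp [sg]

lemma sg_mul_sg'' (i : Fin 3) : sg A i * sg A (i + 2) = -sg A (i + 1) := by
  fin_cases i <;> simp [sg]

lemma sg_smul_sg_smul {B : Type*} [AddCommGroup B] [Module A B] (s : Fin 3) (x : B) :
    sg A s • sg A s • x = x := by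
  rw [smul_smul, sg_mul_self, one_smul]

/-- Addition in `Fin 3` wraps around, so i, i + 1, i + 2 always runs through a cyclic triple; this
lets one computation serve for all three indices. -/
lemma sum_cyclic {B : Type*} [AddCommMonoid B] (f : Fin 3 → B) (i : Fin 3) :
    ∑ s, f s = f i + f (i + 1) + f (i + 2) := by
  rw [Fin.sum_univ_three]
  fin_cases i
  · rfl
  · change _ = f 1 + f 2 + f 0
    abel
  · change _ = f 2 + f 0 + f 1
    abel

lemma sum_shift {B : Type*} [AddCommMonoid B] (f : Fin 3 → B) (i : Fin 3) :
    ∑ s, f (s + i) = ∑ s, f s :=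
  Fintype.sum_equiv (Equiv.addRight i) _ _ fun _ => rfl

end Signs

/-- The module `L` of vector fields over the ring `A` of functions, its submodule `H` of horizontal
fields, and a connection on `L`, with the properties of a paraquaternionic contact structure with a
canonical connection. The fields `e a` form a frame of `H`, with `g`-dual frame `e' a`. -/
structure ContactAlgebra (N : ℕ) (A L H : Type*) [CommRing A] [Algebra ℝ A] [AddCommGroup L]
    [Module A L] [AddCommGroup H] [Module A H] where
  d : L →ₗ[A] Derivation ℝ A A
  br : L → L → L
  br_skew : ∀ X Y, br X Y = -br Y X
  br_add_right : ∀ X Y Z, br X (Y + Z) = br X Y + br X Z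
  br_smul_right : ∀ X (f : A) Y, br X (f • Y) = d X f • Y + f • br X Y
  jacobi : ∀ X Y Z, br X (br Y Z) = br (br X Y) Z + br Y (br X Z)
  d_br : ∀ X Y (f : A), d (br X Y) f = d X (d Y f) - d Y (d X f)
  nab : L →ₗ[A] (L →+ L)
  nab_smul : ∀ X (f : A) Y, nab X (f • Y) = d X f • Y + f • nab X Y
  inc : H →ₗ[A] L
  pr : L →ₗ[A] H
  eta : Fin 3 → L →ₗ[A] A
  xi : Fin 3 → L
  pr_inc : ∀ X, pr (inc X) = X
  eta_inc : ∀ s X, eta s (inc X) = 0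
  eta_xi : ∀ s t, eta s (xi t) = if s = t then 1 else 0
  pr_xi : ∀ s, pr (xi s) = 0
  decomp : ∀ X, X = inc (pr X) + ∑ s, eta s X • xi s
  g : LinearMap.BilinForm A H
  g_symm : ∀ X Y, g X Y = g Y X
  e : Fin N → H
  e' : Fin N → H
  g_e_e' : ∀ a b, g (e a) (e' b) = if a = b then 1 else 0
  expand : ∀ X, ∑ a, g X (e' a) • e a = X
  I : Fin 3 → Module.End A H
  I_sq : ∀ s, I s * I s = sg A s • 1
  I_mul : ∀ s, I s * I (s + 1) = -sg A (s + 2) • I (s + 2)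
  I_mul' : ∀ s, I (s + 1) * I s = sg A (s + 2) • I (s + 2)
  I_skew : ∀ s X Y, g (I s X) Y = -g X (I s Y)
  eta_nab_inc : ∀ s X Y, eta s (nab X (inc Y)) = 0
  pr_nab : ∀ X Z, pr Z = 0 → pr (nab X Z) = 0
  d_g : ∀ X Y Z, d X (g Y Z) = g (pr (nab X (inc Y))) Z + g Y (pr (nab X (inc Z)))
  parallel : ∀ X Z Y, pr Z = 0 →
    pr (nab X (inc (∑ s, eta s Z • I s Y))) - ∑ s, eta s Z • I s (pr (nab X (inc Y)))
      = ∑ s, eta s (nab X Z) • I s Y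
  pr_br : ∀ X Y, pr (br (inc X) (inc Y)) = pr (nab (inc X) (inc Y)) - pr (nab (inc Y) (inc X))
  eta_br : ∀ s X Y, eta s (br (inc X) (inc Y)) = 2 * sg A s * g (I s X) Y
  perp_I : ∀ i s, ∑ a, g (pr (nab (xi i) (inc (e a)) - nab (inc (e a)) (xi i)
    - br (xi i) (inc (e a)))) (I s (e' a)) = 0
  -- K is twice the skew part of the torsion endomorphism of ξ_i. The equation says that its average
  -- over the I_s vanishes; the average is four times the projection to the commutant of the I_s.
  perp_sp : ∀ i X Y, ∀ K : H → H → A,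
    (∀ X Y, K X Y = g (pr (nab (xi i) (inc X) - nab (inc X) (xi i) - br (xi i) (inc X))) Y
      - g (pr (nab (xi i) (inc Y) - nab (inc Y) (xi i) - br (xi i) (inc Y))) X) →
    K X Y - ∑ s, sg A s * K (I s X) (I s Y) = 0

namespace ContactAlgebra

variable {N : ℕ} {A L H : Type*} [CommRing A] [Algebra ℝ A] [AddCommGroup L]
    [Module A L] [AddCommGroup H] [Module A H] (C : ContactAlgebra N A L H)

/-! ### Torsion, curvature and the Bianchi identities -/

lemma br_add_left (X Y Z : L) : C.br (X + Y) Z = C.br X Z + C.br Y Z := by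
  rw [C.br_skew, C.br_add_right, neg_add, ← C.br_skew, ← C.br_skew]

lemma br_smul_left (f : A) (X Y : L) : C.br (f • X) Y = f • C.br X Y - C.d Y f • X := by
  rw [C.br_skew, C.br_smul_right, C.br_skew X Y]
  module

/-- The torsion tensor. -/
def tor : L →ₗ[A] L →ₗ[A] L :=
  LinearMap.mk₂ A (fun X Y => C.nab X Y - C.nab Y X - C.br X Y)
    (fun X X' Y => by simp only [map_add, AddMonoidHom.add_apply, br_add_left]; abel)
    (fun f X Y => by
      simp only [map_smul, AddMonoidHom.smul_apply, br_smul_left, nab_smul]; module)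
    (fun X Y Y' => by simp only [map_add, AddMonoidHom.add_apply, br_add_right]; abel)
    (fun f X Y => by
      simp only [map_smul, AddMonoidHom.smul_apply, br_smul_right, nab_smul]; module)

lemma tor_apply (X Y : L) : C.tor X Y = C.nab X Y - C.nab Y X - C.br X Y := rfl

lemma tor_swap (X Y : L) : C.tor X Y = -C.tor Y X := by
  rw [tor_apply, tor_apply, C.br_skew X Y]; abel

lemma nab_smul_left (f : A) (X Y : L) : C.nab (f • X) Y = f • C.nab X Y := by simp

lemma nab_add_left (X X' Y : L) : C.nab (X + X') Y = C.nab X Y + C.nab X' Y := by simp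

lemma nab_sub_left (X X' Y : L) : C.nab (X - X') Y = C.nab X Y - C.nab X' Y := by simp

/-- The curvature tensor. -/
def cur : L →ₗ[A] L →ₗ[A] Module.End A L :=
  LinearMap.mk₂ A (fun X Y =>
    { toFun := fun Z => C.nab X (C.nab Y Z) - C.nab Y (C.nab X Z) - C.nab (C.br X Y) Z
      map_add' := fun Z Z' => by simp only [map_add]; abel
      map_smul' := fun f Z => by
        simp only [nab_smul, map_add, d_br, RingHom.id_apply]
        module })
    (fun X X' Y => by
      ext Z
      simp only [LinearMap.coe_mk, AddHom.coe_mk, LinearMap.add_apply, br_add_left, map_add,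
        AddMonoidHom.add_apply]
      abel)
    (fun f X Y => by
      ext Z
      simp only [LinearMap.coe_mk, AddHom.coe_mk, LinearMap.smul_apply, nab_smul_left, br_smul_left,
        nab_smul, nab_sub_left]
      module)
    (fun X Y Y' => by
      ext Z
      simp only [LinearMap.coe_mk, AddHom.coe_mk, LinearMap.add_apply, br_add_right, map_add,
        AddMonoidHom.add_apply]
      abel)
    (fun f X Y => by
      ext Z
      simp only [LinearMap.coe_mk, AddHom.coe_mk, LinearMap.smul_apply, nab_smul_left,
        br_smul_right, nab_smul, nab_add_left]
      module)

lemma cur_apply (X Y Z : L) :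
    C.cur X Y Z = C.nab X (C.nab Y Z) - C.nab Y (C.nab X Z) - C.nab (C.br X Y) Z := rfl

lemma cur_swap (X Y : L) : C.cur X Y = -C.cur Y X := by
  ext Z
  rw [LinearMap.neg_apply, cur_apply, cur_apply, C.br_skew X Y, map_neg, AddMonoidHom.neg_apply]
  abel

lemma br_neg_right (X Y : L) : C.br X (-Y) = -C.br X Y := by
  simpa using C.br_smul_right X (-1) Y

lemma jacobi_cyclic (X Y Z : L) :
    C.br (C.br X Y) Z + C.br (C.br Y Z) X + C.br (C.br Z X) Y = 0 := by
  have h := C.jacobi X Y Z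
  rw [C.br_skew X (C.br Y Z), C.br_skew Y (C.br X Z), C.br_skew X Z, C.br_skew (-C.br Z X) Y,
    neg_neg, br_neg_right, C.br_skew Y (C.br Z X), neg_neg] at h
  rw [add_assoc, add_comm (C.br (C.br Y Z) X), ← add_assoc, ← h]
  abel

/-- The covariant derivative of the torsion tensor. -/
def nabTor (X Y Z : L) : L :=
  C.nab X (C.tor Y Z) - C.tor (C.nab X Y) Z - C.tor Y (C.nab X Z)

/-- All terms with two covariant derivatives and all terms ∇_[X,Y] Z cancel on expansion. What is
left is the cyclic sum of [[X, Y], Z], which is zero by Jacobi. -/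
lemma first_bianchi (X Y Z : L) :
    C.cur X Y Z + C.cur Y Z X + C.cur Z X Y =
      C.nabTor X Y Z + C.nabTor Y Z X + C.nabTor Z X Y
        + C.tor (C.tor X Y) Z + C.tor (C.tor Y Z) X + C.tor (C.tor Z X) Y := by
  simp only [nabTor, tor_apply, cur_apply, map_sub, LinearMap.sub_apply]
  rw [← sub_eq_zero, ← neg_eq_zero, ← C.jacobi_cyclic X Y Z, C.br_skew Y (C.nab X Z), C.br_skew Z (C.nab Y X),
    C.br_skew X (C.nab Z Y)]
  abel

/-- The covariant derivative of the curvature tensor. -/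
def nabCur (X Y Z W : L) : L :=
  C.nab X (C.cur Y Z W) - C.cur (C.nab X Y) Z W - C.cur Y (C.nab X Z) W - C.cur Y Z (C.nab X W)

/-- Here the triple derivatives cancel by themselves, and Jacobi is needed only in the form ∇_U W =
0, where U is the cyclic sum of the double brackets. -/
lemma second_bianchi (X Y Z W : L) :
    C.nabCur X Y Z W + C.nabCur Y Z X W + C.nabCur Z X Y W
      + C.cur (C.tor X Y) Z W + C.cur (C.tor Y Z) X W + C.cur (C.tor Z X) Y W = 0 := by
  have hn := congrArg (fun U => C.nab U W) (C.jacobi_cyclic X Y Z)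
  simp only [map_add, map_zero, AddMonoidHom.add_apply, AddMonoidHom.zero_apply] at hn
  simp only [nabCur, tor_apply, map_sub, LinearMap.sub_apply]
  rw [C.cur_swap Y (C.nab X Z), C.cur_swap Z (C.nab Y X), C.cur_swap X (C.nab Z Y)]
  simp only [LinearMap.neg_apply, cur_apply, map_sub]
  rw [← hn]
  abel

end ContactAlgebra

end PQC

end

noncomputable section

namespace PQC

/-! ### Cancelling real constants in an ℝ-algebra. -/

section Cancel

variable {A : Type*} [CommRing A] [Algebra ℝ A]

/-- A ring of functions has zero divisors, but nonzero real constants are units in any ℝ-algebra.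
Every cancellation below is of such a constant. -/
lemma eq_zero_of_algebraMap_mul {r : ℝ} (hr : r ≠ 0) {x : A} (h : algebraMap ℝ A r * x = 0) :
    x = 0 := by
  have : algebraMap ℝ A r⁻¹ * (algebraMap ℝ A r * x) = x := by
    rw [← mul_assoc, ← map_mul, inv_mul_cancel₀ hr, map_one, one_mul]
  rw [← this, h, mul_zero]

lemma eq_zero_of_two_mul {x : A} (h : 2 * x = 0) : x = 0 :=
  eq_zero_of_algebraMap_mul (r := 2) two_ne_zero (by rwa [map_ofNat])

lemma eq_zero_of_natCast_mul {N : ℕ} (hN : N ≠ 0) {x : A} (h : (N : A) * x = 0) : x = 0 :=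
  eq_zero_of_algebraMap_mul (r := N) (by exact_mod_cast hN) (by simpa using h)

lemma eq_zero_of_two_smul {B : Type*} [AddCommGroup B] [Module A B] {x : B}
    (h : (2 : A) • x = 0) : x = 0 := by
  have : algebraMap ℝ A 2⁻¹ • ((2 : A) • x) = x := by
    rw [smul_smul, ← map_ofNat (algebraMap ℝ A) 2, ← map_mul,
      inv_mul_cancel₀ two_ne_zero, map_one, one_smul]
  rw [← this, h, smul_zero]

end Cancel

namespace ContactAlgebra

variable {N : ℕ} {A L H : Type*} [CommRing A] [Algebra ℝ A] [AddCommGroup L]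
    [Module A L] [AddCommGroup H] [Module A H] (C : ContactAlgebra N A L H)

/-! ### Contractions and traces on the horizontal module -/

lemma eq_of_g_left {X X' : H} (h : ∀ Y, C.g X Y = C.g X' Y) : X = X' := by
  rw [← C.expand X, ← C.expand X']
  simp only [h]

lemma expand' (X : H) : ∑ a, C.g X (C.e a) • C.e' a = X := by
  refine C.eq_of_g_left fun Y => ?_
  conv_rhs => rw [← C.expand Y]
  simp only [map_sum, LinearMap.sum_apply, map_smul, LinearMap.smul_apply, smul_eq_mul]
  refine Finset.sum_congr rfl fun a _ => ?_
  rw [C.g_symm (C.e' a) Y]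
  ring

lemma contract {F : H → A} (hF : IsLinearMap A F) (V : H) :
    ∑ a, C.g V (C.e a) * F (C.e' a) = F V := by
  conv_rhs => rw [← C.expand' V]
  change _ = hF.mk' F _
  simp only [map_sum, map_smul, smul_eq_mul, IsLinearMap.mk'_apply]

lemma contract' {F : H → A} (hF : IsLinearMap A F) (V : H) :
    ∑ a, C.g V (C.e' a) * F (C.e a) = F V := by
  conv_rhs => rw [← C.expand V]
  change _ = hF.mk' F _
  simp only [map_sum, map_smul, smul_eq_mul, IsLinearMap.mk'_apply]

/-- The two dual frames are related by the symmetric matrix g(e_a, e_b), so the contraction does not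
see which of them comes first. -/
lemma sum_swap {F : H → H → A} (h1 : ∀ Y, IsLinearMap A fun X => F X Y)
    (h2 : ∀ X, IsLinearMap A (F X)) :
    ∑ a, F (C.e a) (C.e' a) = ∑ a, F (C.e' a) (C.e a) := by
  have e1 : ∀ a, F (C.e a) (C.e' a) =
      ∑ b, C.g (C.e a) (C.e b) * F (C.e' b) (C.e' a) := fun a =>
    (C.contract (h1 (C.e' a)) (C.e a)).symm
  have e2 : ∀ b, ∑ a, C.g (C.e b) (C.e a) * F (C.e' b) (C.e' a) = F (C.e' b) (C.e b) := fun b =>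
    C.contract (h2 (C.e' b)) (C.e b)
  simp only [e1]
  rw [Finset.sum_comm, ← Finset.sum_congr rfl fun b _ => e2 b]
  refine Finset.sum_congr rfl fun b _ => Finset.sum_congr rfl fun a _ => ?_
  rw [C.g_symm]

/-- Skewness of I_s with respect to g: moving I_s across a contraction costs a sign. -/
lemma sum_I {F : H → H → A} (h1 : ∀ Y, IsLinearMap A fun X => F X Y)
    (h2 : ∀ X, IsLinearMap A (F X)) (s : Fin 3) :
    ∑ a, F (C.I s (C.e a)) (C.e' a) = -∑ a, F (C.e a) (C.I s (C.e' a)) := by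
  have e1 : ∀ a, F (C.I s (C.e a)) (C.e' a) =
      ∑ b, C.g (C.I s (C.e a)) (C.e' b) * F (C.e b) (C.e' a) := fun a =>
    (C.contract' (h1 (C.e' a)) _).symm
  have e2 : ∀ b, ∑ a, C.g (C.I s (C.e' b)) (C.e a) * F (C.e b) (C.e' a) =
      F (C.e b) (C.I s (C.e' b)) := fun b => C.contract (h2 (C.e b)) _
  simp only [e1]
  rw [Finset.sum_comm, ← Finset.sum_congr rfl fun b _ => e2 b, ← Finset.sum_neg_distrib]
  refine Finset.sum_congr rfl fun b _ => ?_
  rw [← Finset.sum_neg_distrib]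
  refine Finset.sum_congr rfl fun a _ => ?_
  rw [C.I_skew, C.g_symm (C.e a)]
  ring

/-- The trace of an endomorphism of `H`. -/
def tr : Module.End A H →ₗ[A] A where
  toFun P := ∑ a, C.g (P (C.e a)) (C.e' a)
  map_add' P Q := by simp [Finset.sum_add_distrib]
  map_smul' f P := by simp [Finset.mul_sum]

lemma tr_apply (P : Module.End A H) : C.tr P = ∑ a, C.g (P (C.e a)) (C.e' a) := rfl

lemma tr_one : C.tr 1 = N := by simp [tr_apply, g_e_e']

lemma tr_mul_comm (P Q : Module.End A H) : C.tr (P * Q) = C.tr (Q * P) := by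
  have key : ∀ P Q : Module.End A H, C.tr (P * Q) =
      ∑ a, ∑ b, C.g (Q (C.e a)) (C.e' b) * C.g (P (C.e b)) (C.e' a) := by
    intro P Q
    rw [tr_apply]
    refine Finset.sum_congr rfl fun a _ => ?_
    exact (C.contract' (F := fun X => C.g (P X) (C.e' a))
      ⟨fun _ _ => by simp, fun _ _ => by simp⟩ (Q (C.e a))).symm
  rw [key, key, Finset.sum_comm]
  exact Finset.sum_congr rfl fun a _ => Finset.sum_congr rfl fun b _ => mul_comm _ _

lemma tr_mul_assoc (P Q R : Module.End A H) : C.tr (P * Q * R) = C.tr (R * P * Q) := by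
  rw [tr_mul_comm, mul_assoc]

/-- The `g`-adjoint of an endomorphism of `H`. -/
def adj (P : Module.End A H) : Module.End A H where
  toFun X := ∑ a, C.g X (P (C.e a)) • C.e' a
  map_add' X Y := by simp [add_smul, Finset.sum_add_distrib]
  map_smul' f X := by simp [Finset.smul_sum, smul_smul]

lemma g_adj (P : Module.End A H) (X Y : H) : C.g (C.adj P X) Y = C.g X (P Y) := by
  simp only [adj, LinearMap.coe_mk, AddHom.coe_mk, map_sum, LinearMap.sum_apply, map_smul,
    LinearMap.smul_apply, smul_eq_mul]
  rw [← C.contract' (F := fun Y => C.g X (P Y)) ⟨fun _ _ => by simp, fun _ _ => by simp⟩ Y]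
  refine Finset.sum_congr rfl fun a _ => ?_
  rw [C.g_symm Y]
  ring

lemma g_adj_right (P : Module.End A H) (X Y : H) : C.g X (C.adj P Y) = C.g (P X) Y := by
  rw [C.g_symm, g_adj, C.g_symm]

lemma eq_adj {P P' : Module.End A H} (h : ∀ X Y, C.g (P' X) Y = C.g X (P Y)) : P' = C.adj P := by
  ext X
  refine C.eq_of_g_left fun Y => ?_
  rw [g_adj, h]

lemma adj_I (s : Fin 3) : C.adj (C.I s) = -C.I s := by
  refine (C.eq_adj fun X Y => ?_).symm
  rw [LinearMap.neg_apply, map_neg, LinearMap.neg_apply, C.I_skew, neg_neg]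

lemma adj_mul (P Q : Module.End A H) : C.adj (P * Q) = C.adj Q * C.adj P := by
  refine (C.eq_adj fun X Y => ?_).symm
  simp [g_adj]

lemma adj_add (P Q : Module.End A H) : C.adj (P + Q) = C.adj P + C.adj Q := by
  refine (C.eq_adj fun X Y => ?_).symm
  simp [g_adj]

lemma adj_neg (P : Module.End A H) : C.adj (-P) = -C.adj P := by
  refine (C.eq_adj fun X Y => ?_).symm
  simp [g_adj]

lemma adj_smul (f : A) (P : Module.End A H) : C.adj (f • P) = f • C.adj P := by
  refine (C.eq_adj fun X Y => ?_).symm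
  simp [g_adj]

lemma adj_adj (P : Module.End A H) : C.adj (C.adj P) = P :=
  (C.eq_adj fun X Y => (C.g_adj_right P X Y).symm).symm

lemma tr_adj (P : Module.End A H) : C.tr (C.adj P) = C.tr P := by
  simp only [tr_apply, g_adj]
  rw [C.sum_swap (F := fun X Y => C.g X (P Y)) (fun _ => ⟨fun _ _ => by simp, fun _ _ => by simp⟩)
    (fun _ => ⟨fun _ _ => by simp, fun _ _ => by simp⟩)]
  exact Finset.sum_congr rfl fun a _ => C.g_symm _ _

/-! ### The paraquaternionic relations -/

lemma I_sq_apply (s : Fin 3) (X : H) : C.I s (C.I s X) = sg A s • X := by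
  simpa using LinearMap.congr_fun (C.I_sq s) X

lemma I_mul'' (s : Fin 3) : C.I s * C.I (s + 2) = sg A (s + 1) • C.I (s + 1) := by
  have := C.I_mul' (s + 2)
  rwa [show s + 2 + 1 = s by omega, show s + 2 + 2 = s + 1 by omega] at this

lemma I_mul''' (s : Fin 3) : C.I (s + 2) * C.I s = -sg A (s + 1) • C.I (s + 1) := by
  have := C.I_mul (s + 2)
  rwa [show s + 2 + 1 = s by omega, show s + 2 + 2 = s + 1 by omega] at this

lemma I_mul4 (s : Fin 3) : C.I (s + 1) * C.I (s + 2) = -sg A s • C.I s := by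
  have := C.I_mul (s + 1)
  rwa [show s + 1 + 1 = s + 2 by omega, show s + 1 + 2 = s by omega] at this

lemma I_mul5 (s : Fin 3) : C.I (s + 2) * C.I (s + 1) = sg A s • C.I s := by
  have := C.I_mul' (s + 1)
  rwa [show s + 1 + 1 = s + 2 by omega, show s + 1 + 2 = s by omega] at this

lemma I_anticomm (s t : Fin 3) :
    C.I s * C.I t + C.I t * C.I s = (if s = t then 2 * sg A s else 0) • 1 := by
  have h : t = s ∨ t = s + 1 ∨ t = s + 2 := by omega
  rcases h with rfl | rfl | rfl
  · simp only [C.I_sq, if_true]; module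
  · rw [C.I_mul, C.I_mul', if_neg (by omega)]; module
  · rw [C.I_mul'', C.I_mul''', if_neg (by omega)]; module

/-- Take the trace of the Clifford relation `I_anticomm`; by cyclicity both products have the same
trace. -/
lemma tr_I_mul_I (s t : Fin 3) : C.tr (C.I s * C.I t) = if s = t then sg A s * N else 0 := by
  have h := congrArg C.tr (C.I_anticomm s t)
  rw [map_add, C.tr_mul_comm (C.I t), map_smul, tr_one] at h
  have : 2 * (C.tr (C.I s * C.I t) - if s = t then sg A s * N else 0) = 0 := by
    rw [mul_sub, two_mul, h]
    split_ifs <;> simp [mul_assoc]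
  exact sub_eq_zero.1 (eq_zero_of_two_mul this)

end ContactAlgebra

end PQC

end

noncomputable section

namespace PQC

namespace ContactAlgebra

variable {N : ℕ} {A L H : Type*} [CommRing A] [Algebra ℝ A] [AddCommGroup L]
    [Module A L] [AddCommGroup H] [Module A H] (C : ContactAlgebra N A L H)

/-! ### The connection on the horizontal and on the vertical module -/

lemma ext_of_components {X Y : L} (h : C.pr X = C.pr Y) (h' : ∀ s, C.eta s X = C.eta s Y) :
    X = Y := by
  rw [C.decomp X, C.decomp Y, h]
  simp only [h']

lemma eq_sum_xi {Z : L} (h : C.pr Z = 0) : Z = ∑ s, C.eta s Z • C.xi s := by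
  conv_lhs => rw [C.decomp Z, h, map_zero, zero_add]

/-- The connection on `H`. -/
def cov (X : L) (Y : H) : H := C.pr (C.nab X (C.inc Y))

lemma inc_cov (X : L) (Y : H) : C.inc (C.cov X Y) = C.nab X (C.inc Y) :=
  C.ext_of_components (C.pr_inc _) fun s => by rw [eta_inc, eta_nab_inc]

lemma cov_add_left (X X' : L) (Y : H) : C.cov (X + X') Y = C.cov X Y + C.cov X' Y := by
  simp [cov]

lemma cov_smul_left (f : A) (X : L) (Y : H) : C.cov (f • X) Y = f • C.cov X Y := by
  simp [cov]

lemma cov_add (X : L) (Y Y' : H) : C.cov X (Y + Y') = C.cov X Y + C.cov X Y' := by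
  simp [cov]

lemma cov_neg (X : L) (Y : H) : C.cov X (-Y) = -C.cov X Y := by
  simp [cov]

lemma cov_smul (X : L) (f : A) (Y : H) : C.cov X (f • Y) = C.d X f • Y + f • C.cov X Y := by
  simp [cov, nab_smul, pr_inc]

lemma cov_zero (X : L) : C.cov X 0 = 0 := by simp [cov]

lemma d_g_cov (X : L) (Y Z : H) :
    C.d X (C.g Y Z) = C.g (C.cov X Y) Z + C.g Y (C.cov X Z) := C.d_g X Y Z

lemma d_sg (X : L) (i : Fin 3) : C.d X (sg A i) = 0 := by
  fin_cases i <;> simp [sg]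

/-- The identification of the vertical module with the paraquaternionic structure. -/
def phi : L →ₗ[A] Module.End A H := ∑ s, (C.eta s).smulRight (C.I s)

lemma phi_eq (Z : L) : C.phi Z = ∑ s, C.eta s Z • C.I s := by
  simp [phi]

lemma phi_apply (Z : L) (Y : H) : C.phi Z Y = ∑ s, C.eta s Z • C.I s Y := by
  simp [phi_eq]

lemma phi_xi (s : Fin 3) : C.phi (C.xi s) = C.I s := by simp [phi_eq, eta_xi]

lemma cov_phi (X Z : L) (Y : H) :
    C.cov X (C.phi Z Y) = C.phi (C.nab X Z) Y + C.phi Z (C.cov X Y) := by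
  -- The axiom is stated for vertical fields, so it is applied to the vertical part of Z. The
  -- horizontal part is invisible to η_s, also after differentiation, because ∇ preserves H.
  have h := C.parallel X (Z - C.inc (C.pr Z)) Y (by rw [map_sub, pr_inc, sub_self])
  have h1 : ∀ s, C.eta s (Z - C.inc (C.pr Z)) = C.eta s Z := fun s => by
    rw [map_sub, eta_inc, sub_zero]
  have h2 : ∀ s, C.eta s (C.nab X (Z - C.inc (C.pr Z))) = C.eta s (C.nab X Z) := fun s => by
    rw [map_sub, map_sub, eta_nab_inc, sub_zero]
  simp only [h1, h2] at h
  rw [phi_apply, phi_apply, phi_apply, ← h, cov, cov, sub_add_cancel]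

/-- The covariant derivative of an endomorphism of `H`. -/
def covEnd (X : L) (P : Module.End A H) : Module.End A H where
  toFun Y := C.cov X (P Y) - P (C.cov X Y)
  map_add' Y Y' := by simp only [map_add, cov_add]; abel
  map_smul' f Y := by simp only [map_smul, map_add, cov_smul, RingHom.id_apply]; module

lemma covEnd_apply (X : L) (P : Module.End A H) (Y : H) :
    C.covEnd X P Y = C.cov X (P Y) - P (C.cov X Y) := rfl

lemma covEnd_mul (X : L) (P Q : Module.End A H) :
    C.covEnd X (P * Q) = C.covEnd X P * Q + P * C.covEnd X Q := by
  ext Y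
  simp [covEnd_apply]

lemma covEnd_add (X : L) (P Q : Module.End A H) :
    C.covEnd X (P + Q) = C.covEnd X P + C.covEnd X Q := by
  ext Y
  simp only [covEnd_apply, LinearMap.add_apply, cov_add]
  abel

lemma covEnd_smul (X : L) (f : A) (P : Module.End A H) :
    C.covEnd X (f • P) = C.d X f • P + f • C.covEnd X P := by
  ext Y
  simp only [covEnd_apply, LinearMap.add_apply, LinearMap.smul_apply, cov_smul]
  module

lemma covEnd_one (X : L) : C.covEnd X 1 = 0 := by
  ext Y
  simp [covEnd_apply]

lemma covEnd_zero (X : L) : C.covEnd X 0 = 0 := by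
  ext Y
  simp [covEnd_apply, cov_zero]

lemma covEnd_neg (X : L) (P : Module.End A H) : C.covEnd X (-P) = -C.covEnd X P := by
  ext Y
  simp only [covEnd_apply, LinearMap.neg_apply, cov_neg]
  abel

lemma covEnd_sum {ι : Type*} (s : Finset ι) (X : L) (P : ι → Module.End A H) :
    C.covEnd X (∑ i ∈ s, P i) = ∑ i ∈ s, C.covEnd X (P i) :=
  map_sum (AddMonoidHom.mk' (C.covEnd X) (C.covEnd_add X)) P s

lemma covEnd_smul_left (f : A) (X : L) (P : Module.End A H) :
    C.covEnd (f • X) P = f • C.covEnd X P := by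
  ext Y
  simp only [covEnd_apply, LinearMap.smul_apply, cov_smul_left, map_smul]
  module

lemma covEnd_add_left (X X' : L) (P : Module.End A H) :
    C.covEnd (X + X') P = C.covEnd X P + C.covEnd X' P := by
  ext Y
  simp only [covEnd_apply, LinearMap.add_apply, cov_add_left, map_add]
  abel

lemma covEnd_phi (X Z : L) : C.covEnd X (C.phi Z) = C.phi (C.nab X Z) := by
  ext Y
  rw [covEnd_apply, cov_phi, add_sub_cancel_right]

lemma covEnd_I (X : L) (s : Fin 3) :
    C.covEnd X (C.I s) = ∑ t, C.eta t (C.nab X (C.xi s)) • C.I t := by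
  rw [← phi_xi, covEnd_phi, phi_eq]

/-- The tensor ∑ e_a ⊗ e'_a is parallel: it is the inverse of the parallel metric, and
differentiating the constants g(e_a, e'_b) shows this on the frame. -/
lemma sum_cov_frame {F : H → H → A} (h1 : ∀ Y, IsLinearMap A fun X => F X Y)
    (h2 : ∀ X, IsLinearMap A (F X)) (X : L) :
    ∑ a, F (C.cov X (C.e a)) (C.e' a) + ∑ a, F (C.e a) (C.cov X (C.e' a)) = 0 := by
  have e1 : ∀ a, F (C.cov X (C.e a)) (C.e' a) =
      ∑ b, C.g (C.cov X (C.e a)) (C.e' b) * F (C.e b) (C.e' a) := fun a =>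
    (C.contract' (h1 (C.e' a)) _).symm
  have e2 : ∀ b, F (C.e b) (C.cov X (C.e' b)) =
      ∑ a, C.g (C.cov X (C.e' b)) (C.e a) * F (C.e b) (C.e' a) := fun b =>
    (C.contract (h2 (C.e b)) _).symm
  simp only [e1, e2]
  rw [Finset.sum_comm, ← Finset.sum_add_distrib]
  refine Finset.sum_eq_zero fun b _ => ?_
  rw [← Finset.sum_add_distrib]
  refine Finset.sum_eq_zero fun a _ => ?_
  rw [← add_mul, C.g_symm (C.cov X (C.e' b)), ← C.d_g_cov, C.g_e_e']
  split_ifs <;> simp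

lemma d_tr (X : L) (P : Module.End A H) : C.d X (C.tr P) = C.tr (C.covEnd X P) := by
  have h := C.sum_cov_frame (F := fun Y Z => C.g (P Y) Z)
    (fun _ => ⟨fun _ _ => by simp, fun _ _ => by simp⟩)
    (fun _ => ⟨fun _ _ => by simp, fun _ _ => by simp⟩) X
  simp only [tr_apply, map_sum, d_g_cov, covEnd_apply, map_sub, LinearMap.sub_apply,
    Finset.sum_add_distrib, Finset.sum_sub_distrib]
  linear_combination h

/-- The metric on the vertical module. -/
def dot (Z W : L) : A := ∑ s, sg A s * (C.eta s Z * C.eta s W)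

lemma dot_xi (Z : L) (s : Fin 3) : C.dot Z (C.xi s) = sg A s * C.eta s Z := by
  simp [dot, eta_xi]

lemma dot_comm (Z W : L) : C.dot Z W = C.dot W Z := by
  simp only [dot, mul_comm]

lemma dot_sub_left (Z Z' W : L) : C.dot (Z - Z') W = C.dot Z W - C.dot Z' W := by
  simp only [dot, map_sub, sub_mul, mul_sub, Finset.sum_sub_distrib]

lemma dot_sub_right (Z W W' : L) : C.dot Z (W - W') = C.dot Z W - C.dot Z W' := by
  simp only [dot, map_sub, mul_sub, Finset.sum_sub_distrib]

lemma eta_eq_zero_of_dot {Z : L} (h : ∀ W, C.dot Z W = 0) (s : Fin 3) : C.eta s Z = 0 := by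
  have := h (C.xi s)
  rw [dot_xi] at this
  rw [← one_mul (C.eta s Z), ← sg_mul_self s, mul_assoc, this, mul_zero]

/-- Invariant form of the Clifford relation: φ makes V with the metric `dot` act on H. -/
lemma phi_anticomm (Z W : L) :
    C.phi Z * C.phi W + C.phi W * C.phi Z = (2 * C.dot Z W) • 1 := by
  have h : ∀ s t, (C.eta s Z * C.eta t W) • (C.I s * C.I t + C.I t * C.I s) =
      (if s = t then 2 * (sg A s * (C.eta s Z * C.eta s W)) else 0) • 1 := by
    intro s t
    rw [C.I_anticomm, smul_smul]
    split_ifs with h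
    · subst h; congr 1; ring
    · simp
  have : C.phi Z * C.phi W + C.phi W * C.phi Z =
      ∑ s, ∑ t, (C.eta s Z * C.eta t W) • (C.I s * C.I t + C.I t * C.I s) := by
    simp only [phi_eq, Finset.sum_mul, Finset.mul_sum, smul_add, Finset.sum_add_distrib,
      smul_mul_assoc, mul_smul_comm, Finset.smul_sum, smul_smul]
    congr 1
    rw [Finset.sum_comm]
    simp only [mul_comm]
  rw [this]
  simp only [h]
  rw [dot, Finset.mul_sum, Finset.sum_smul]
  simp [← Finset.sum_smul]

/-- The vertical metric is parallel because the Clifford relation expresses it through φ and the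
trace on H, both of which are parallel. Taking the trace produces the factor N that is cancelled at
the end. -/
lemma d_dot (hN : N ≠ 0) (X Z W : L) :
    C.d X (C.dot Z W) = C.dot (C.nab X Z) W + C.dot Z (C.nab X W) := by
  have h := congrArg (fun P => C.tr (C.covEnd X P)) (C.phi_anticomm Z W)
  simp only [covEnd_add, covEnd_mul, covEnd_phi, covEnd_smul, covEnd_one, smul_zero, add_zero,
    map_smul, tr_one] at h
  have h1 := congrArg C.tr (C.phi_anticomm (C.nab X Z) W)
  have h2 := congrArg C.tr (C.phi_anticomm Z (C.nab X W))
  rw [map_smul, tr_one, map_add, smul_eq_mul] at h1 h2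
  simp only [map_add, smul_eq_mul, Derivation.leibniz] at h
  have hc : C.d X (2 : A) = 0 := by simpa using (C.d X).map_natCast 2
  rw [hc] at h
  have : (N : A) * (2 * (C.d X (C.dot Z W) - (C.dot (C.nab X Z) W + C.dot Z (C.nab X W)))) = 0 := by
    linear_combination h1 + h2 - h
  exact sub_eq_zero.1 (eq_zero_of_two_mul (eq_zero_of_natCast_mul hN this))

lemma dot_cur (hN : N ≠ 0) (X Y Z W : L) :
    C.dot (C.cur X Y Z) W = -C.dot Z (C.cur X Y W) := by
  have h := C.d_br X Y (C.dot Z W)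
  simp only [C.d_dot hN, map_add] at h
  simp only [cur_apply, dot_sub_left, dot_sub_right]
  linear_combination -h

/-- The curvature of the connection on `H`. -/
def curH : L →ₗ[A] L →ₗ[A] Module.End A H :=
  LinearMap.mk₂ A (fun X Y => C.pr ∘ₗ C.cur X Y ∘ₗ C.inc)
    (fun X X' Y => by ext; simp) (fun f X Y => by ext; simp)
    (fun X Y Y' => by ext; simp) (fun f X Y => by ext; simp)

lemma curH_apply (X Y : L) (Z : H) :
    C.curH X Y Z = C.cov X (C.cov Y Z) - C.cov Y (C.cov X Z) - C.cov (C.br X Y) Z := by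
  simp only [curH, LinearMap.mk₂_apply, LinearMap.comp_apply, cur_apply, map_sub, cov]
  simp only [← C.inc_cov, C.pr_inc]

lemma inc_curH (X Y : L) (Z : H) : C.inc (C.curH X Y Z) = C.cur X Y (C.inc Z) := by
  rw [curH_apply, cur_apply]
  simp only [map_sub, inc_cov]

lemma pr_cur_inc (X Y : L) (Z : H) : C.pr (C.cur X Y (C.inc Z)) = C.curH X Y Z := rfl

lemma eta_cur_inc (s : Fin 3) (X Y : L) (Z : H) : C.eta s (C.cur X Y (C.inc Z)) = 0 := by
  rw [← inc_curH, eta_inc]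

lemma pr_cur_xi (X Y : L) (s : Fin 3) : C.pr (C.cur X Y (C.xi s)) = 0 := by
  have h : ∀ X, C.pr (C.nab X (C.xi s)) = 0 := fun X => C.pr_nab X _ (C.pr_xi s)
  rw [cur_apply, map_sub, map_sub, h, C.pr_nab _ _ (h _), C.pr_nab _ _ (h _)]
  simp

lemma curH_swap (X Y : L) : C.curH X Y = -C.curH Y X := by
  ext Z
  simp only [curH, LinearMap.mk₂_apply, C.cur_swap X Y]
  simp

lemma g_curH (X Y : L) (Z W : H) : C.g (C.curH X Y Z) W = -C.g Z (C.curH X Y W) := by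
  have h := C.d_br X Y (C.g Z W)
  simp only [C.d_g_cov, map_add] at h
  simp only [curH_apply, map_sub, LinearMap.sub_apply]
  linear_combination -h

/-- Since φ is parallel, R(X, Y) on H and on V are intertwined by φ; this is how the curvature of V
controls the PQ-part of the curvature of H. -/
lemma curH_phi (X Y Z : L) (W : H) :
    C.curH X Y (C.phi Z W) = C.phi (C.cur X Y Z) W + C.phi Z (C.curH X Y W) := by
  simp only [curH_apply, cur_apply, map_sub, LinearMap.sub_apply, cov_phi, cov_add]
  abel

/-! ### The components of the torsion -/

lemma pr_tor_inc (X Y : H) : C.pr (C.tor (C.inc X) (C.inc Y)) = 0 := by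
  rw [tor_apply, map_sub, map_sub, pr_br, sub_self]

lemma eta_tor_inc (s : Fin 3) (X Y : H) :
    C.eta s (C.tor (C.inc X) (C.inc Y)) = -(2 * sg A s * C.g (C.I s X) Y) := by
  rw [tor_apply, map_sub, map_sub, eta_nab_inc, eta_nab_inc, eta_br]
  ring

lemma tor_inc (X Y : H) : C.tor (C.inc X) (C.inc Y) =
    -∑ s, (2 * sg A s * C.g (C.I s X) Y) • C.xi s := by
  rw [C.eq_sum_xi (C.pr_tor_inc X Y)]
  simp [eta_tor_inc]

lemma dot_tor_inc (X Y : H) (W : L) :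
    C.dot (C.tor (C.inc X) (C.inc Y)) W = -(2 * C.g (C.phi W X) Y) := by
  simp only [dot, eta_tor_inc, phi_apply, map_sum, LinearMap.sum_apply, map_smul,
    LinearMap.smul_apply, smul_eq_mul, Finset.mul_sum, ← Finset.sum_neg_distrib]
  refine Finset.sum_congr rfl fun s _ => ?_
  linear_combination -2 * C.g (C.I s X) Y * C.eta s W * sg_mul_self (A := A) s

/-- By `dot_tor_inc`, pairing T(Y, Z) with W gives -2 g(φ(W)Y, Z), which is built from the parallel
objects g, φ and the vertical metric. So T is parallel on H. -/
lemma nabTor_inc (hN : N ≠ 0) (X : L) (Y Z : H) : C.nabTor X (C.inc Y) (C.inc Z) = 0 := by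
  refine C.ext_of_components ?_ fun s => ?_
  · rw [nabTor, map_sub, map_sub, ← inc_cov, ← inc_cov, pr_tor_inc, pr_tor_inc,
      C.pr_nab _ _ (C.pr_tor_inc _ _), map_zero, sub_zero, sub_zero]
  · rw [map_zero]
    refine C.eta_eq_zero_of_dot (fun W => ?_) s
    have h := C.d_dot hN X (C.tor (C.inc Y) (C.inc Z)) W
    have hc : C.d X (2 : A) = 0 := by simpa using (C.d X).map_natCast 2
    simp only [dot_tor_inc, map_neg, Derivation.leibniz, smul_eq_mul, hc, d_g_cov, cov_phi,
      map_add, LinearMap.add_apply] at h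
    simp only [nabTor, dot_sub_left, ← inc_cov, dot_tor_inc]
    linear_combination -h

/-- The horizontal part of the torsion endomorphism of `ξ_i`. -/
def T (i : Fin 3) : Module.End A H := C.pr ∘ₗ C.tor (C.xi i) ∘ₗ C.inc

lemma T_apply (i : Fin 3) (X : H) : C.T i X = C.pr (C.tor (C.xi i) (C.inc X)) := rfl

/-- Contracting (Y, Z) with I_r gives 2 ∑ ε_s θ_s(I_r I_s X) = N θ_r(X). In terms of ψ_s = ε_s θ_s ∘
I_s this reads (4 - N) ψ_r = 2 ∑ ψ_s. Summing over r gives (N + 2) ∑ ψ_s = 0, and then (4 - N) ψ_r =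
0. For N = 4 the last step fails. -/
lemma eq_zero_of_cyclic_sum (hN : 4 < N) (θ : Fin 3 → H →ₗ[A] A)
    (h : ∀ X Y Z, ∑ s, sg A s * (C.g (C.I s X) Y * θ s Z + C.g (C.I s Y) Z * θ s X
      + C.g (C.I s Z) X * θ s Y) = 0) (s : Fin 3) : θ s = 0 := by
  have h1 : ∀ r X, 2 * ∑ s, sg A s * θ s (C.I r (C.I s X)) - N * θ r X = 0 := by
    intro r X
    have c1 : ∀ s, ∑ a, C.g (C.I s X) (C.e a) * θ s (C.I r (C.e' a)) = θ s (C.I r (C.I s X)) :=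
      fun s => C.contract (F := fun Y => θ s (C.I r Y))
        ⟨fun _ _ => by simp, fun _ _ => by simp⟩ _
    have c2 : ∀ s, ∑ a, C.g (C.I s (C.e a)) (C.I r (C.e' a)) * θ s X =
        -(if r = s then sg A r * N else 0) * θ s X := by
      intro s
      rw [← Finset.sum_mul, ← C.tr_I_mul_I, tr_apply, ← Finset.sum_neg_distrib]
      congr 1
      refine Finset.sum_congr rfl fun a _ => ?_
      rw [Module.End.mul_apply, C.I_skew r, neg_neg]
    have c3 : ∀ s, ∑ a, C.g (C.I s (C.I r (C.e' a))) X * θ s (C.e a) =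
        θ s (C.I r (C.I s X)) := by
      intro s
      rw [← C.contract' (F := θ s) ⟨fun _ _ => by simp, fun _ _ => by simp⟩ (C.I r (C.I s X))]
      refine Finset.sum_congr rfl fun a _ => ?_
      rw [C.I_skew s, C.I_skew r, neg_neg, C.g_symm]
    have := Finset.sum_eq_zero fun a (_ : a ∈ Finset.univ) => h X (C.e a) (C.I r (C.e' a))
    rw [Finset.sum_comm] at this
    simp only [← Finset.mul_sum, Finset.sum_add_distrib, c1, c2, c3] at this
    simp only [mul_add, Finset.sum_add_distrib] at this
    have c4 : ∑ s, sg A s * (-(if r = s then sg A r * N else 0) * θ s X) = -(N * θ r X) := by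
      rw [Finset.sum_eq_single r (fun s _ hs => by simp [hs.symm]) (by simp)]
      rw [if_pos rfl]
      linear_combination -(N * θ r X) * sg_mul_self (A := A) r
    rw [c4] at this
    linear_combination this
  set ψ : Fin 3 → H → A := fun s X => sg A s * θ s (C.I s X) with hψ
  have h2 : ∀ r X, (4 - N) * ψ r X = 2 * ∑ s, ψ s X := by
    intro r X
    have := h1 r (C.I r X)
    have e1 : ∀ s, C.I r (C.I s (C.I r X)) =
        (if s = r then 2 * sg A r else 0) • C.I r X - sg A r • C.I s X := by
      intro s
      have := LinearMap.congr_fun (C.I_anticomm s r) (C.I r X)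
      simp only [LinearMap.add_apply, Module.End.mul_apply, I_sq_apply, LinearMap.smul_apply,
        Module.End.one_apply, map_smul] at this
      rw [← eq_sub_iff_add_eq'] at this
      rw [this]
      split_ifs with h
      · rw [h]
      · rfl
    simp only [e1, map_sub, map_smul, smul_eq_mul, mul_sub, Finset.sum_sub_distrib] at this
    have e2 : ∑ s, sg A s * ((if s = r then 2 * sg A r else 0) * θ s (C.I r X)) =
        2 * sg A r * ψ r X := by
      rw [Finset.sum_eq_single r (fun s _ hs => by simp [hs]) (by simp), if_pos rfl, hψ]
      ring
    have e3 : ∑ s, sg A s * (sg A r * θ s (C.I s X)) = sg A r * ∑ s, ψ s X := by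
      rw [hψ, Finset.mul_sum]
      exact Finset.sum_congr rfl fun s _ => by ring
    rw [e2, e3] at this
    have e4 : θ r (C.I r X) = sg A r * ψ r X := by
      rw [hψ, ← mul_assoc, sg_mul_self, one_mul]
    rw [e4] at this
    linear_combination sg A r * this +
      (2 * (∑ s, ψ s X) - (4 - N) * ψ r X) * sg_mul_self (A := A) r
  have h3 : ∀ X, ∑ s, ψ s X = 0 := by
    intro X
    have h0 := h2 0 X
    have h1 := h2 1 X
    have h2 := h2 2 X
    -- The three equations add up to (4 - N) ∑ ψ = 6 ∑ ψ.
    refine eq_zero_of_natCast_mul (N := N + 2) (by omega) ?_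
    rw [Fin.sum_univ_three] at *
    push_cast
    linear_combination -h0 - h1 - h2
  ext X
  have h4 := h2 s (sg A s • C.I s X)
  rw [h3, mul_zero] at h4
  have h5 : ψ s (sg A s • C.I s X) = sg A s * θ s X := by
    simp only [hψ, map_smul, I_sq_apply, smul_eq_mul]
    linear_combination (sg A s * θ s X) * sg_mul_self (A := A) s
  rw [h5] at h4
  have h6 : sg A s * θ s X = 0 := by
    refine eq_zero_of_algebraMap_mul (r := 4 - N) ?_ (by rwa [map_sub, map_ofNat, map_natCast])
    have : (4 : ℝ) < N := by exact_mod_cast hN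
    linarith
  rw [← one_mul (θ s X), ← sg_mul_self s, mul_assoc, h6, mul_zero, LinearMap.zero_apply]

/-- In the vertical part of the first Bianchi identity on three horizontal fields the curvature
preserves H and ∇T vanishes. Only the cyclic sum of T(T(X, Y), Z) survives, and `tor_inc` turns it
into the hypothesis of `eq_zero_of_cyclic_sum`. -/
lemma eta_tor_xi_inc (hN : 4 < N) (s t : Fin 3) (X : H) :
    C.eta t (C.tor (C.xi s) (C.inc X)) = 0 := by
  have hN0 : N ≠ 0 := by omega
  refine LinearMap.congr_fun (C.eq_zero_of_cyclic_sum hN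
    (fun s => C.eta t ∘ₗ C.tor (C.xi s) ∘ₗ C.inc) (fun X Y Z => ?_) s) X
  have h := congrArg (C.eta t) (C.first_bianchi (C.inc X) (C.inc Y) (C.inc Z))
  simp only [C.nabTor_inc hN0, map_add, eta_cur_inc, tor_inc, map_neg,
    LinearMap.neg_apply, map_sum, LinearMap.sum_apply, map_smul, LinearMap.smul_apply,
    smul_eq_mul, zero_add] at h
  rw [← neg_add, ← neg_add, zero_eq_neg, ← Finset.sum_add_distrib, ← Finset.sum_add_distrib] at h
  refine eq_zero_of_two_mul ?_
  rw [← h, Finset.mul_sum]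
  refine Finset.sum_congr rfl fun s _ => ?_
  simp only [LinearMap.comp_apply]
  ring

lemma tor_xi_inc (hN : 4 < N) (s : Fin 3) (X : H) :
    C.tor (C.xi s) (C.inc X) = C.inc (C.T s X) :=
  C.ext_of_components (by rw [pr_inc, T_apply]) fun t => by
    rw [C.eta_tor_xi_inc hN, eta_inc]

lemma tor_inc_xi (hN : 4 < N) (s : Fin 3) (X : H) :
    C.tor (C.inc X) (C.xi s) = -C.inc (C.T s X) := by
  rw [tor_swap, C.tor_xi_inc hN]

end ContactAlgebra

end PQC

end

noncomputable section

namespace PQC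

namespace ContactAlgebra

variable {N : ℕ} {A L H : Type*} [CommRing A] [Algebra ℝ A] [AddCommGroup L]
    [Module A L] [AddCommGroup H] [Module A H] (C : ContactAlgebra N A L H)

/-! ### The algebraic structure of the torsion -/

/-- The vertical components of the torsion of two vertical fields. -/
def t (i j m : Fin 3) : A := C.eta m (C.tor (C.xi i) (C.xi j))

/-- The horizontal part of the torsion of two vertical fields. -/
def h (i j : Fin 3) : H := C.pr (C.tor (C.xi i) (C.xi j))

/-- The vertical components of the curvature. -/
def rho (i j : Fin 3) (X Y : L) : A := C.eta j (C.cur X Y (C.xi i))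

lemma t_swap (i j m : Fin 3) : C.t i j m = -C.t j i m := by
  rw [t, tor_swap, map_neg, t]

lemma t_self (i m : Fin 3) : C.t i i m = 0 :=
  eq_zero_of_two_mul (by linear_combination C.t_swap i i m)

lemma h_swap (i j : Fin 3) : C.h i j = -C.h j i := by
  rw [h, tor_swap, map_neg, h]

lemma h_self (i : Fin 3) : C.h i i = 0 := by
  refine eq_zero_of_two_smul (A := A) ?_
  rw [two_smul]
  nth_rewrite 1 [h_swap]
  exact neg_add_cancel _

/-- The curvature is skew for the parallel metric of V; the signs come from lowering an index. -/
lemma sg_mul_rho (hN : N ≠ 0) (i j : Fin 3) (X Y : L) :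
    sg A j * C.rho i j X Y = -(sg A i * C.rho j i X Y) := by
  have h := C.dot_cur hN X Y (C.xi i) (C.xi j)
  rw [dot_xi, dot_comm, dot_xi] at h
  exact h

lemma rho_self (hN : N ≠ 0) (i : Fin 3) (X Y : L) : C.rho i i X Y = 0 := by
  have h := C.sg_mul_rho hN i i X Y
  have : sg A i * C.rho i i X Y = 0 := eq_zero_of_two_mul (by linear_combination h)
  rw [← one_mul (C.rho i i X Y), ← sg_mul_self i, mul_assoc, this, mul_zero]

lemma cur_xi (X Y : L) (i : Fin 3) : C.cur X Y (C.xi i) = ∑ j, C.rho i j X Y • C.xi j :=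
  C.eq_sum_xi (C.pr_cur_xi X Y i)

lemma eta_tor_inc_of_pr (hN : 4 < N) (X : H) {Z : L} (hZ : C.pr Z = 0) (s : Fin 3) :
    C.eta s (C.tor (C.inc X) Z) = 0 := by
  rw [C.eq_sum_xi hZ]
  simp [C.tor_inc_xi hN, eta_inc]

/-- The endomorphism that represents the torsion part of the vertical curvature. -/
def K (i j : Fin 3) : Module.End A H := C.I j * C.T i + C.adj (C.T i) * C.I j

/-- Vertical part of the first Bianchi identity on (X, Y, ξ_i). The derivative terms vanish by
`eta_tor_xi_inc` and `nabTor_inc`. The term T(T(X, Y), ξ_i) gives the coefficients `t`, and T(T(ξ_i,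
X), Y) with its partner gives `K`. -/
lemma sg_mul_rho_inc (hN : 4 < N) (i j : Fin 3) (X Y : H) :
    sg A j * C.rho i j (C.inc X) (C.inc Y) =
      -(2 * ∑ s, sg A s * sg A j * C.t s i j * C.g (C.I s X) Y) - 2 * C.g (C.K i j X) Y := by
  have hN0 : N ≠ 0 := by omega
  have hb := congrArg (C.eta j) (C.first_bianchi (C.inc X) (C.inc Y) (C.xi i))
  have n1 : C.eta j (C.nabTor (C.inc X) (C.inc Y) (C.xi i)) = 0 := by
    rw [nabTor, C.tor_inc_xi hN, ← inc_cov, C.tor_inc_xi hN, map_sub, map_sub,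
      C.eta_tor_inc_of_pr hN _ (C.pr_nab _ _ (C.pr_xi i)), map_neg, map_neg, map_neg,
      eta_nab_inc, eta_inc]
    simp
  have n2 : C.eta j (C.nabTor (C.inc Y) (C.xi i) (C.inc X)) = 0 := by
    rw [nabTor, C.tor_xi_inc hN, ← inc_cov, ← inc_cov, C.tor_xi_inc hN, C.tor_swap (C.nab _ _),
      map_sub, map_sub, map_neg, C.eta_tor_inc_of_pr hN _ (C.pr_nab _ _ (C.pr_xi i)),
      eta_inc, eta_inc]
    simp
  simp only [map_add, n1, n2, C.nabTor_inc hN0, eta_cur_inc, C.tor_inc_xi hN, C.tor_xi_inc hN,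
    map_neg, LinearMap.neg_apply, map_zero, eta_tor_inc] at hb
  rw [tor_inc] at hb
  simp only [map_neg, LinearMap.neg_apply, map_sum, LinearMap.sum_apply, map_smul,
    LinearMap.smul_apply, smul_eq_mul] at hb
  have hs : ∑ s, sg A s * sg A j * C.t s i j * C.g (C.I s X) Y =
      sg A j * ∑ s, sg A s * C.g (C.I s X) Y * C.t s i j := by
    rw [Finset.mul_sum]
    exact Finset.sum_congr rfl fun s _ => by ring
  have hs' : ∑ s, 2 * sg A s * C.g (C.I s X) Y * C.eta j (C.tor (C.xi s) (C.xi i)) =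
      2 * ∑ s, sg A s * C.g (C.I s X) Y * C.t s i j := by
    rw [Finset.mul_sum]
    exact Finset.sum_congr rfl fun s _ => by rw [t]; ring
  rw [hs'] at hb
  have hk : C.g (C.K i j X) Y = C.g (C.I j (C.T i X)) Y - C.g (C.I j (C.T i Y)) X := by
    rw [K, LinearMap.add_apply, map_add, LinearMap.add_apply, Module.End.mul_apply,
      Module.End.mul_apply, g_adj, C.I_skew j (C.T i Y), C.g_symm (C.T i Y)]
    ring
  rw [hs, hk, rho]
  linear_combination sg A j * hb - 2 * (C.g (C.I j (C.T i X)) Y - C.g (C.I j (C.T i Y)) X) *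
    sg_mul_self (A := A) j

lemma tr_I_mul_T (s i : Fin 3) : C.tr (C.I s * C.T i) = 0 := by
  have := C.perp_I i s
  rw [tr_apply, ← neg_eq_zero, ← Finset.sum_neg_distrib, ← this]
  refine Finset.sum_congr rfl fun a _ => ?_
  rw [Module.End.mul_apply, C.I_skew, neg_neg]
  rfl

lemma tr_I_mul_adj_T (s i : Fin 3) : C.tr (C.I s * C.adj (C.T i)) = 0 := by
  rw [← C.tr_adj, adj_mul, adj_adj, adj_I, mul_neg, map_neg, tr_mul_comm, tr_I_mul_T, neg_zero]

lemma exists_I_mul_I {s u : Fin 3} (hsu : s ≠ u) : ∃ (c : A) (m : Fin 3),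
    C.I s * C.I u = c • C.I m := by
  have h : u = s ∨ u = s + 1 ∨ u = s + 2 := by omega
  rcases h with rfl | rfl | rfl
  · exact absurd rfl hsu
  · exact ⟨_, _, C.I_mul s⟩
  · exact ⟨_, _, C.I_mul'' s⟩

/-- T_i has zero trace against every I_s. For m ≠ j the product of I_m and I_j is a multiple of the
third generator, so only m = j can contribute, through tr T_i. -/
lemma tr_K_mul_I (i j m : Fin 3) :
    C.tr (C.K i j * C.I m) = if m = j then 2 * (sg A j * C.tr (C.T i)) else 0 := by
  rw [K, add_mul, map_add, C.tr_mul_assoc, mul_assoc (C.adj _),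
    C.tr_mul_comm (C.adj _)]
  split_ifs with hm
  · subst hm
    rw [C.I_sq, smul_mul_assoc, smul_mul_assoc, one_mul, one_mul, map_smul, map_smul, tr_adj,
      smul_eq_mul]
    ring
  · obtain ⟨c, l, hc⟩ := C.exists_I_mul_I hm
    obtain ⟨c', l', hc'⟩ := C.exists_I_mul_I (Ne.symm hm)
    rw [hc, hc', smul_mul_assoc, smul_mul_assoc, map_smul, map_smul, tr_I_mul_T, tr_I_mul_adj_T]
    simp

lemma tr_sum_I_mul_I (x : Fin 3 → A) (m : Fin 3) :
    C.tr ((∑ s, x s • C.I s) * C.I m) = x m * (sg A m * N) := by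
  simp only [Finset.sum_mul, map_sum, smul_mul_assoc, map_smul, tr_I_mul_I, smul_eq_mul]
  rw [Finset.sum_eq_single m (fun s _ hs => by simp [hs]) (by simp), if_pos rfl]

lemma eq_zero_of_mul_sg_mul (hN : N ≠ 0) {x : A} {m : Fin 3} (h : x * (sg A m * N) = 0) :
    x = 0 := by
  refine eq_zero_of_natCast_mul hN ?_
  linear_combination sg A m * h - N * x * sg_mul_self (A := A) m

/-- The left side of `sg_mul_rho_inc` is skew in i and j, so the symmetric part of the right side
vanishes. -/
lemma K_add_K (hN : 4 < N) (i j : Fin 3) : C.K i j + C.K j i =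
    ∑ s, (-(sg A s * (sg A j * C.t s i j + sg A i * C.t s j i))) • C.I s := by
  have hN0 : N ≠ 0 := by omega
  ext X
  refine C.eq_of_g_left fun Y => ?_
  have h1 := C.sg_mul_rho_inc hN i j X Y
  have h2 := C.sg_mul_rho_inc hN j i X Y
  rw [C.sg_mul_rho hN0, h2] at h1
  have : 2 * (C.g ((C.K i j + C.K j i) X) Y - C.g ((∑ s, (-(sg A s * (sg A j * C.t s i j
      + sg A i * C.t s j i))) • C.I s) X) Y) = 0 := by
    simp only [LinearMap.add_apply, map_add, LinearMap.sum_apply, map_sum, LinearMap.smul_apply,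
      map_smul, smul_eq_mul]
    simp only [Fin.sum_univ_three] at h1 ⊢
    linear_combination h1
  exact sub_eq_zero.1 (eq_zero_of_two_mul this)

lemma K_self (hN : 4 < N) (i : Fin 3) : C.K i i = 0 := by
  have hN0 : N ≠ 0 := by omega
  have h := C.K_add_K hN i i
  -- For s = i this is the skewness of T. For s ≠ i one traces against I_s, where the trace of K_ii
  -- vanishes before anything is known about tr T_i.
  have ht : ∀ s, C.t s i i = 0 := by
    intro s
    by_cases hs : s = i
    · rw [hs, t_self]
    · have h2 := congrArg (fun P => C.tr (P * C.I s)) h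
      simp only [add_mul, map_add, tr_K_mul_I, if_neg hs, tr_sum_I_mul_I] at h2
      have h3 := eq_zero_of_mul_sg_mul hN0 (by rw [← h2, add_zero])
      refine eq_zero_of_two_mul ?_
      have e1 := sg_mul_self (A := A) s
      have e2 := sg_mul_self (A := A) i
      linear_combination (-sg A i * sg A s) * h3 - 2 * C.t s i i * e2
        - 2 * C.t s i i * sg A i * sg A i * e1
  simp only [ht, mul_zero, add_zero, neg_zero, zero_smul, Finset.sum_const_zero] at h
  refine eq_zero_of_two_smul (A := A) ?_
  rw [two_smul, h]

lemma tr_T (hN : 4 < N) (i : Fin 3) : C.tr (C.T i) = 0 := by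
  have h := C.tr_K_mul_I i i i
  rw [C.K_self hN, zero_mul, map_zero, if_pos rfl] at h
  have h := eq_zero_of_two_mul h.symm
  rw [← one_mul (C.tr _), ← sg_mul_self i, mul_assoc, h, mul_zero]

lemma tr_K_mul_I_eq_zero (hN : 4 < N) (i j m : Fin 3) : C.tr (C.K i j * C.I m) = 0 := by
  rw [tr_K_mul_I, C.tr_T hN]
  simp

/-- Together with the skewness in the first two indices, this makes the index-lowered coefficients
totally skew on a space of rank three, hence given by the single function `Lam`. -/
lemma t_skew (hN : 4 < N) (s i j : Fin 3) :
    sg A j * C.t s i j + sg A i * C.t s j i = 0 := by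
  have hN0 : N ≠ 0 := by omega
  have h2 := congrArg (fun P => C.tr (P * C.I s)) (C.K_add_K hN i j)
  simp only [add_mul, map_add, C.tr_K_mul_I_eq_zero hN, tr_sum_I_mul_I] at h2
  have h3 := eq_zero_of_mul_sg_mul hN0 (by rw [← h2, add_zero])
  linear_combination -sg A s * h3 - (sg A j * C.t s i j + sg A i * C.t s j i) *
    sg_mul_self (A := A) s

lemma K_skew (hN : 4 < N) (i j : Fin 3) : C.K i j + C.K j i = 0 := by
  rw [C.K_add_K hN]
  simp [C.t_skew hN]

/-- The function `Λ` with `T(ξ_i, ξ_j)_V = ε_k Λ ξ_k` for cyclic `(i, j, k)`. -/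
def Lam : A := sg A 2 * C.t 0 1 2

lemma t_right (hN : 4 < N) (s i : Fin 3) : C.t s i i = 0 := by
  have h := C.t_skew hN s i i
  rw [← two_mul] at h
  have h := eq_zero_of_two_mul h
  rw [← one_mul (C.t s i i), ← sg_mul_self i, mul_assoc, h, mul_zero]

lemma t_left (hN : 4 < N) (s i : Fin 3) : C.t i s i = 0 := by
  rw [t_swap, C.t_right hN, neg_zero]

lemma t_cyclic (hN : 4 < N) (i : Fin 3) : C.t i (i + 1) (i + 2) = sg A (i + 2) * C.Lam := by
  have h1 := C.t_skew hN 0 1 2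
  have h2 := C.t_skew hN 2 1 0
  have h3 := C.t_swap 2 0 1
  have h4 := C.t_swap 1 2 0
  have e : sg A 0 = 1 ∧ sg A 1 = 1 ∧ sg A 2 = -1 := ⟨rfl, rfl, rfl⟩
  obtain ⟨e0, e1, e2⟩ := e
  fin_cases i
  · change C.t 0 1 2 = sg A 2 * (sg A 2 * C.t 0 1 2)
    rw [← mul_assoc, sg_mul_self, one_mul]
  · change C.t 1 2 0 = sg A 0 * (sg A 2 * C.t 0 1 2)
    simp only [e0, e1, e2] at h1 h2 ⊢
    linear_combination -h2 + h3 - h1 + h4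
  · change C.t 2 0 1 = sg A 1 * (sg A 2 * C.t 0 1 2)
    simp only [e0, e1, e2] at h1 h2 ⊢
    linear_combination h3 - h1

/-- The curvature forms of the paraquaternionic structure. -/
def sig (k : Fin 3) (X Y : L) : A := -(sg A (k + 2) * C.rho (k + 1) (k + 2) X Y)

lemma sig_inc (hN : 4 < N) (k : Fin 3) (X Y : H) :
    C.sig k (C.inc X) (C.inc Y) =
      2 * sg A k * C.Lam * C.g (C.I k X) Y + 2 * C.g (C.K (k + 1) (k + 2) X) Y := by
  rw [sig, C.sg_mul_rho_inc hN, sum_cyclic _ k]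
  have h1 := C.t_cyclic hN k
  rw [h1, C.t_self, C.t_left hN]
  linear_combination (2 * sg A k * C.Lam * C.g (C.I k X) Y) * sg_mul_self (A := A) (k + 2)

/-! ### Symmetric and skew parts of the torsion endomorphisms. -/

/-- Twice the symmetric part of `T i`. -/
def P (i : Fin 3) : Module.End A H := C.T i + C.adj (C.T i)

/-- Twice the skew-symmetric part of `T i`. -/
def Q (i : Fin 3) : Module.End A H := C.T i - C.adj (C.T i)

lemma I_mul_T (hN : 4 < N) (i : Fin 3) : C.I i * C.T i = -(C.adj (C.T i) * C.I i) := by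
  rw [eq_neg_iff_add_eq_zero]
  exact C.K_self hN i

lemma T_mul_I (hN : 4 < N) (i : Fin 3) : C.T i * C.I i = -(C.I i * C.adj (C.T i)) := by
  have h := congrArg (fun P => C.I i * P * C.I i) (C.I_mul_T hN i)
  simp only [← mul_assoc, I_sq, mul_neg, neg_mul, smul_mul_assoc, one_mul] at h
  rw [mul_assoc _ (C.I i) (C.I i), I_sq, mul_smul_comm, mul_one] at h
  have h := congrArg (fun P => sg A i • P) h
  simpa only [smul_neg, smul_smul, sg_mul_self, one_smul] using h

/-- K_ii = 0 says that I_i T_i is the negative of T_i* I_i. So I_i commutes with the skew part of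
T_i and, in the next lemma, anticommutes with the symmetric part. -/
lemma I_mul_Q (hN : 4 < N) (i : Fin 3) : C.I i * C.Q i = C.Q i * C.I i := by
  rw [Q, mul_sub, sub_mul, C.I_mul_T hN, C.T_mul_I hN]
  abel

lemma I_mul_P (hN : 4 < N) (i : Fin 3) : C.I i * C.P i = -(C.P i * C.I i) := by
  rw [P, mul_add, add_mul, C.I_mul_T hN, C.T_mul_I hN]
  abel

/-- Operator form of orthogonality to sp(n,ℝ): the average of Q_i over the I_s is zero. -/
lemma Q_add_sum (i : Fin 3) : C.Q i + ∑ s, sg A s • (C.I s * C.Q i * C.I s) = 0 := by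
  ext X
  refine C.eq_of_g_left fun Y => ?_
  have hQ : ∀ X Y, C.g (C.Q i X) Y = C.g (C.T i X) Y - C.g (C.T i Y) X := fun X Y => by
    rw [Q, LinearMap.sub_apply, map_sub, LinearMap.sub_apply, g_adj, C.g_symm X]
  have h := C.perp_sp i X Y (fun X Y => C.g (C.Q i X) Y) fun X Y => hQ X Y
  simp only [LinearMap.add_apply, LinearMap.sum_apply, LinearMap.smul_apply, Module.End.mul_apply,
    map_add, map_sum, map_smul, C.I_skew, smul_eq_mul, mul_neg, Finset.sum_neg_distrib,
    LinearMap.zero_apply, map_zero]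
  rw [← h, sub_eq_add_neg]

lemma I_mul_I_mul (s : Fin 3) (x : Module.End A H) : C.I s * (C.I s * x) = sg A s • x := by
  rw [← mul_assoc, I_sq, smul_mul_assoc, one_mul]

lemma I_mul_I_of_ne {i j : Fin 3} (h : i ≠ j) : C.I i * C.I j = -(C.I j * C.I i) := by
  have := C.I_anticomm i j
  rw [if_neg h, zero_smul] at this
  exact eq_neg_of_add_eq_zero_left this

/-- I_{i+2} is, up to sign, I_i I_{i+1}, and I_i commutes with Q_i, so the two conjugations agree.
-/
lemma conj_Q (hN : 4 < N) (i : Fin 3) :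
    sg A (i + 2) • (C.I (i + 2) * C.Q i * C.I (i + 2)) =
      sg A (i + 1) • (C.I (i + 1) * C.Q i * C.I (i + 1)) := by
  have h1 : C.I (i + 2) = -sg A (i + 2) • (C.I i * C.I (i + 1)) := by
    rw [I_mul, smul_smul, neg_mul_neg, sg_mul_self, one_smul]
  have h2 : C.I i * C.I (i + 1) * C.Q i * (C.I i * C.I (i + 1)) =
      -sg A i • (C.I (i + 1) * C.Q i * C.I (i + 1)) := by
    calc _ = C.I i * C.I (i + 1) * (C.Q i * C.I i) * C.I (i + 1) := by noncomm_ring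
      _ = C.I i * (C.I (i + 1) * C.I i) * C.Q i * C.I (i + 1) := by
        rw [← C.I_mul_Q hN]; noncomm_ring
      _ = -(C.I i * C.I i) * C.I (i + 1) * C.Q i * C.I (i + 1) := by
        rw [C.I_mul_I_of_ne (show i + 1 ≠ i by omega)]; noncomm_ring
      _ = _ := by
        rw [I_sq]; simp [mul_assoc]
  rw [h1, smul_mul_assoc, smul_mul_assoc, mul_smul_comm, smul_smul, smul_smul, h2, smul_smul]
  congr 1
  linear_combination (-(sg A (i + 2)) * sg A i) * sg_mul_self (A := A) (i + 2)
    - sg_mul_sg'' (A := A) i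

/-- In `Q_add_sum` the term s = i reproduces Q_i and the other two are equal by `conj_Q`. Hence Q_i
+ ε_j I_j Q_i I_j = 0 for j ≠ i. -/
lemma I_mul_Q_of_ne (hN : 4 < N) {i j : Fin 3} (hij : i ≠ j) :
    C.I j * C.Q i = -(C.Q i * C.I j) := by
  have h := C.Q_add_sum i
  have hi : sg A i • (C.I i * C.Q i * C.I i) = C.Q i := by
    rw [C.I_mul_Q hN, mul_assoc, I_sq, mul_smul_comm, mul_one, sg_smul_sg_smul]
  have hc := C.conj_Q hN i
  rw [sum_cyclic _ i, hi, hc] at h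
  have key : sg A j • (C.I j * C.Q i * C.I j) = -C.Q i := by
    have h3 : sg A (i + 1) • (C.I (i + 1) * C.Q i * C.I (i + 1)) = -C.Q i := by
      rw [eq_neg_iff_add_eq_zero]
      refine eq_zero_of_two_smul (A := A) ?_
      rw [two_smul, ← h]
      abel
    have : j = i ∨ j = i + 1 ∨ j = i + 2 := by omega
    rcases this with rfl | rfl | rfl
    · exact absurd rfl hij
    · exact h3
    · rw [hc, h3]
  have := congrArg (fun P => P * C.I j) key
  simp only [smul_mul_assoc, mul_assoc, I_sq, mul_smul_comm, mul_one, sg_smul_sg_smul] at this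
  rw [this, neg_mul]

lemma two_smul_K (hN : 4 < N) {i j : Fin 3} (hij : i ≠ j) :
    (2 : A) • C.K i j = C.I j * C.P i + C.P i * C.I j + (2 : A) • (C.I j * C.Q i) := by
  have h : C.I j * C.Q i = -(C.Q i * C.I j) := C.I_mul_Q_of_ne hN hij
  have h2 : (2 : A) • (C.I j * C.Q i) = C.I j * C.Q i - C.Q i * C.I j := by
    rw [two_smul]
    nth_rewrite 2 [h]
    abel
  rw [h2, two_smul, K, P, Q]
  noncomm_ring

/-- Twice K_ij + K_ji = 0 has the form Z + 2Y = 0, with Z from the symmetric parts and Y from the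
skew parts. Z commutes with I_i and Y anticommutes with it, so both vanish. -/
lemma sum_skew (hN : 4 < N) {i j : Fin 3} (hij : i ≠ j) :
    C.I j * C.P i + C.P i * C.I j + (C.I i * C.P j + C.P j * C.I i) = 0 ∧
      C.I j * C.Q i + C.I i * C.Q j = 0 := by
  have h := congrArg (fun P => (2 : A) • P) (C.K_skew hN i j)
  simp only [smul_add, smul_zero, C.two_smul_K hN hij, C.two_smul_K hN hij.symm] at h
  set Z := C.I j * C.P i + C.P i * C.I j + (C.I i * C.P j + C.P j * C.I i) with hZ
  set Y := C.I j * C.Q i + C.I i * C.Q j with hY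
  have h' : Z + (2 : A) • Y = 0 := by
    rw [← h, hY, smul_add, hZ]
    abel
  have c1 := C.I_mul_I_of_ne hij
  have c2 := C.I_mul_P hN i
  have c3 := C.I_mul_Q hN i
  have c4 := C.I_mul_Q_of_ne hN hij.symm
  have hIZ : C.I i * Z = Z * C.I i := by
    have a1 : C.I i * (C.I j * C.P i + C.P i * C.I j) =
        (C.I j * C.P i + C.P i * C.I j) * C.I i := by
      rw [mul_add, ← mul_assoc, c1, ← mul_assoc, c2, neg_mul, neg_mul, mul_assoc, c2,
        mul_assoc, c1]
      noncomm_ring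
    have a2 : C.I i * (C.I i * C.P j + C.P j * C.I i) =
        (C.I i * C.P j + C.P j * C.I i) * C.I i := by
      have : C.P j * C.I i * C.I i = C.I i * C.I i * C.P j := by
        rw [mul_assoc, I_sq]; simp
      rw [mul_add, add_mul, this]
      noncomm_ring
    rw [hZ, mul_add, a1, a2, ← add_mul]
  have hIY : C.I i * Y = -(Y * C.I i) := by
    have a1 : C.I i * (C.I j * C.Q i) = -(C.I j * C.Q i * C.I i) := by
      rw [← mul_assoc, c1, neg_mul, mul_assoc, c3, mul_assoc]
    have a2 : C.I i * (C.I i * C.Q j) = -(C.I i * C.Q j * C.I i) := by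
      nth_rewrite 1 [c4]
      rw [mul_neg, mul_assoc]
    rw [hY, mul_add, a1, a2, add_mul]
    abel
  -- Multiply Z + 2Y = 0 by I_i from the left and from the right and add; the Y-terms cancel.
  have h2 : (2 : A) • (C.I i * Z) = 0 := by
    have b1 : C.I i * Z + (2 : A) • (C.I i * Y) = 0 := by
      rw [← mul_smul_comm, ← mul_add, h', mul_zero]
    have b2 : Z * C.I i + (2 : A) • (Y * C.I i) = 0 := by
      rw [← smul_mul_assoc, ← add_mul, h', zero_mul]
    rw [hIY, smul_neg] at b1
    rw [← hIZ] at b2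
    rw [two_smul, ← add_zero (0 : Module.End A H)]
    nth_rewrite 2 [← b1]
    rw [← b2]
    abel
  have h3 := eq_zero_of_two_smul h2
  have hZ0 : Z = 0 := by
    have := C.I_mul_I_mul i Z
    rw [h3, mul_zero] at this
    rw [← sg_smul_sg_smul (A := A) i Z, ← this, smul_zero]
  refine ⟨hZ0, ?_⟩
  rw [hZ0, zero_add] at h'
  exact eq_zero_of_two_smul h'

/-- Twice the endomorphism that represents `μ`, defined with `ξ_i` and `I_i`. -/
def U (i : Fin 3) : Module.End A H := sg A i • (C.I i * C.Q i)

/-- The skew half of `sum_skew` solves for Q_{i+1} in terms of Q_i. This is why μ can be defined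
with any index. -/
lemma U_succ (hN : 4 < N) (i : Fin 3) : C.U (i + 1) = C.U i := by
  have hij : i ≠ i + 1 := by omega
  have h := congrArg (fun P => C.I i * P) (C.sum_skew hN hij).2
  simp only [mul_add, mul_zero, I_mul_I_mul] at h
  have h2 : C.Q (i + 1) = -sg A i • (C.I i * (C.I (i + 1) * C.Q i)) := by
    rw [neg_smul, eq_neg_of_add_eq_zero_left h, smul_neg, neg_neg, sg_smul_sg_smul]
  have h3 : C.I (i + 1) * (C.I i * (C.I (i + 1) * C.Q i)) =
      -sg A (i + 1) • (C.I i * C.Q i) := by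
    rw [← mul_assoc, C.I_mul_I_of_ne hij.symm, neg_mul, mul_assoc, I_mul_I_mul, mul_smul_comm,
      neg_smul]
  rw [U, U, h2, mul_smul_comm, h3, smul_smul, smul_smul]
  congr 1
  linear_combination sg A i * sg_mul_self (A := A) (i + 1)

lemma U_eq (hN : 4 < N) (i j : Fin 3) : C.U i = C.U j := by
  have h0 := C.U_succ hN 0
  have h1 := C.U_succ hN 1
  fin_cases i <;> fin_cases j <;> simp_all

/-- Twice the endomorphism that represents `τ`. -/
def tau2 : Module.End A H := -∑ s, sg A s • (C.P s * C.I s)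

lemma I_mul_P_mul_I (hN : 4 < N) (i : Fin 3) :
    C.I (i + 1) * C.P i * C.I (i + 2) = C.I (i + 2) * C.P i * C.I (i + 1) := by
  have h1 : C.I (i + 1) = -sg A (i + 1) • (C.I (i + 2) * C.I i) := by
    rw [I_mul''', smul_smul, neg_mul_neg, sg_mul_self, one_smul]
  conv_lhs => rw [h1]
  rw [smul_mul_assoc, smul_mul_assoc, mul_assoc (C.I (i + 2)), I_mul_P C hN, mul_neg, neg_mul,
    ← mul_assoc, mul_assoc _ (C.I i), I_mul'', mul_smul_comm, smul_neg, neg_smul, neg_neg,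
    sg_smul_sg_smul]

/-- Computes the part of the contracted curvature forms that depends on T_i. Each index k
contributes 2 U from the skew part of the torsion, and the symmetric parts add up to `tau2`. -/
lemma sum_K_mul_I (hN : 4 < N) :
    ∑ k, (2 : A) • (C.K (k + 1) (k + 2) * C.I k) = C.tau2 + (6 : A) • C.U 0 := by
  have h1 : ∀ k, (2 : A) • (C.K (k + 1) (k + 2) * C.I k) =
      (C.I (k + 2) * C.P (k + 1) + C.P (k + 1) * C.I (k + 2)) * C.I k + (2 : A) • C.U 0 := by
    intro k
    rw [← smul_mul_assoc, C.two_smul_K hN (show k + 1 ≠ k + 2 by omega), add_mul]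
    congr 1
    rw [smul_mul_assoc, mul_assoc, ← neg_eq_iff_eq_neg.2 (C.I_mul_Q_of_ne hN
      (show k + 1 ≠ k by omega)), mul_neg, ← mul_assoc, I_mul''', neg_smul, neg_mul, neg_neg,
      C.U_eq hN 0 (k + 1), U, smul_mul_assoc]
  -- One of the two copies is rewritten by the symmetric half of `sum_skew`. After summation the
  -- first two terms on the right cancel by a cyclic shift and `I_mul_P_mul_I`, and the last two
  -- give 2 `tau2`.
  have h2 : ∀ k, (2 : A) • ((C.I (k + 2) * C.P (k + 1) + C.P (k + 1) * C.I (k + 2)) * C.I k) =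
      C.I (k + 2) * C.P (k + 1) * C.I k - C.I (k + 1) * C.P (k + 2) * C.I k
        - sg A (k + 1) • (C.P (k + 1) * C.I (k + 1))
        - sg A (k + 2) • (C.P (k + 2) * C.I (k + 2)) := by
    intro k
    have h := eq_neg_of_add_eq_zero_left (C.sum_skew hN (show k + 1 ≠ k + 2 by omega)).1
    rw [two_smul]
    nth_rewrite 2 [h]
    rw [add_mul, neg_mul, add_mul, mul_assoc (C.P _), I_mul''', mul_assoc (C.P _), I_mul']
    simp only [mul_smul_comm]
    module
  have h3 : ∑ k, C.I (k + 2) * C.P (k + 1) * C.I k =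
      ∑ k, C.I (k + 1) * C.P k * C.I (k + 2) := by
    rw [← sum_shift (fun k => C.I (k + 1) * C.P k * C.I (k + 2)) 1]
    refine Finset.sum_congr rfl fun k _ => ?_
    rw [show k + 1 + 1 = k + 2 by omega, show k + 1 + 2 = k by omega]
  have h4 : ∑ k, C.I (k + 1) * C.P (k + 2) * C.I k =
      ∑ k, C.I (k + 1) * C.P k * C.I (k + 2) := by
    rw [← sum_shift (fun k => C.I (k + 1) * C.P k * C.I (k + 2)) 2]
    refine Finset.sum_congr rfl fun k _ => ?_
    rw [C.I_mul_P_mul_I hN, show k + 2 + 1 = k by omega, show k + 2 + 2 = k + 1 by omega]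
  have h5 := sum_shift (fun k => sg A k • (C.P k * C.I k)) 1
  have h6 := sum_shift (fun k => sg A k • (C.P k * C.I k)) 2
  have h7 : ∑ k, (C.I (k + 2) * C.P (k + 1) + C.P (k + 1) * C.I (k + 2)) * C.I k = C.tau2 := by
    rw [← sub_eq_zero]
    refine eq_zero_of_two_smul (A := A) ?_
    rw [smul_sub, Finset.smul_sum]
    simp only [h2, Finset.sum_sub_distrib]
    rw [h3, h4, h5, h6, tau2]
    module
  simp only [h1, Finset.sum_add_distrib, h7]
  simp only [Finset.sum_const, Finset.card_univ, Fintype.card_fin]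
  module

end ContactAlgebra

end PQC

end

noncomputable section

namespace PQC

namespace ContactAlgebra

variable {N : ℕ} {A L H : Type*} [CommRing A] [Algebra ℝ A] [AddCommGroup L]
    [Module A L] [AddCommGroup H] [Module A H] (C : ContactAlgebra N A L H)

/-! ### The curvature forms and the scalar curvature -/

lemma rho_succ (i : Fin 3) (X Y : L) :
    C.rho i (i + 1) X Y = -(sg A (i + 1) * C.sig (i + 2) X Y) := by
  rw [sig, show i + 2 + 1 = i by omega, show i + 2 + 2 = i + 1 by omega]
  linear_combination -C.rho i (i + 1) X Y * sg_mul_self (A := A) (i + 1)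

lemma rho_succ_succ (hN : N ≠ 0) (i : Fin 3) (X Y : L) :
    C.rho i (i + 2) X Y = sg A (i + 2) * C.sig (i + 1) X Y := by
  rw [sig, show i + 1 + 1 = i + 2 by omega, show i + 1 + 2 = i by omega]
  have h := C.sg_mul_rho hN (i + 2) i X Y
  linear_combination sg A (i + 2) * h - C.rho i (i + 2) X Y * sg_mul_self (A := A) (i + 2)

lemma sig_swap (k : Fin 3) (X Y : L) : C.sig k X Y = -C.sig k Y X := by
  rw [sig, sig, rho, rho, C.cur_swap X Y]
  simp

lemma isLinearMap_sig_left (k : Fin 3) (Y : L) : IsLinearMap A fun X => C.sig k X Y :=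
  ⟨fun _ _ => by simp only [sig, rho, map_add, LinearMap.add_apply]; ring,
    fun _ _ => by simp only [sig, rho, map_smul, LinearMap.smul_apply, smul_eq_mul]; ring⟩

lemma isLinearMap_sig_right (k : Fin 3) (X : L) : IsLinearMap A fun Y => C.sig k X Y :=
  ⟨fun _ _ => by simp only [sig, rho, map_add, LinearMap.add_apply]; ring,
    fun _ _ => by simp only [sig, rho, map_smul, LinearMap.smul_apply, smul_eq_mul]; ring⟩

/-- The commutator of R with I_i is R acting on ξ_i, moved to H by φ; the forms σ appear as the
curvature of V. -/
lemma curH_mul_I (hN : N ≠ 0) (i : Fin 3) (X Y : L) : C.curH X Y * C.I i =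
    C.I i * C.curH X Y - (sg A (i + 1) * C.sig (i + 2) X Y) • C.I (i + 1)
      + (sg A (i + 2) * C.sig (i + 1) X Y) • C.I (i + 2) := by
  ext W
  have h := C.curH_phi X Y (C.xi i) W
  rw [phi_xi, cur_xi, sum_cyclic _ i, C.rho_self hN, rho_succ, C.rho_succ_succ hN] at h
  simp only [map_add, map_smul, phi_xi, LinearMap.add_apply, LinearMap.smul_apply] at h
  simp only [Module.End.mul_apply, h, LinearMap.add_apply, LinearMap.sub_apply,
    LinearMap.smul_apply]
  module

/-- Multiply the commutator relation for I_{k+1} by I_{k+2} and take the trace: both triple products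
reduce to multiples of I_k R with opposite signs, and σ_k survives with coefficient N. -/
lemma tr_curH_mul_I (hN : N ≠ 0) (k : Fin 3) (X Y : L) :
    2 * C.tr (C.curH X Y * C.I k) = sg A k * N * C.sig k X Y := by
  have h := congrArg (fun P => C.tr (P * C.I (k + 2))) (C.curH_mul_I hN (k + 1) X Y)
  simp only [show k + 1 + 1 = k + 2 by omega, show k + 1 + 2 = k by omega, add_mul, sub_mul,
    smul_mul_assoc, map_add, map_sub, map_smul, tr_I_mul_I] at h
  rw [mul_assoc, I_mul4, C.tr_mul_assoc, I_mul5, mul_smul_comm, smul_mul_assoc, map_smul,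
    map_smul, C.tr_mul_comm (C.I k), if_neg (show k ≠ k + 2 by omega)] at h
  simp only [smul_eq_mul, if_true] at h
  linear_combination (-sg A k) * h - 2 * C.tr (C.curH X Y * C.I k) * sg_mul_self (A := A) k
    + sg A k * C.sig k X Y * N * sg_mul_self (A := A) (k + 2)

lemma sum_g_I_I (s m : Fin 3) : ∑ a, C.g (C.I s (C.e a)) (C.I m (C.e' a)) =
    -(if m = s then sg A m * N else 0) := by
  rw [← C.tr_I_mul_I, tr_apply, ← Finset.sum_neg_distrib]
  refine Finset.sum_congr rfl fun a _ => ?_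
  rw [Module.End.mul_apply, C.I_skew m, neg_neg]

lemma sum_g_apply_I (P : Module.End A H) (m : Fin 3) :
    ∑ a, C.g (P (C.e a)) (C.I m (C.e' a)) = -C.tr (P * C.I m) := by
  rw [C.tr_mul_comm, tr_apply, ← Finset.sum_neg_distrib]
  refine Finset.sum_congr rfl fun a _ => ?_
  rw [Module.End.mul_apply, C.I_skew, neg_neg]

/-- Only the Λ-term of `sig_inc` contributes, since the K-term has zero trace against I_k. -/
lemma sum_sig (hN : 4 < N) (k : Fin 3) :
    ∑ a, C.sig k (C.inc (C.e a)) (C.inc (C.I k (C.e' a))) = -(2 * C.Lam * N) := by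
  simp only [C.sig_inc hN, Finset.sum_add_distrib, ← Finset.mul_sum]
  rw [sum_g_I_I, if_pos rfl, sum_g_apply_I, C.tr_K_mul_I_eq_zero hN]
  linear_combination (-2 * C.Lam * N) * sg_mul_self (A := A) k

lemma bianchi_horizontal (hN : N ≠ 0) (X Y Z : H) :
    C.curH (C.inc X) (C.inc Y) Z + C.curH (C.inc Y) (C.inc Z) X + C.curH (C.inc Z) (C.inc X) Y =
      -∑ s, (2 * sg A s) • (C.g (C.I s X) Y • C.T s Z + C.g (C.I s Y) Z • C.T s X
        + C.g (C.I s Z) X • C.T s Y) := by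
  have h := congrArg C.pr (C.first_bianchi (C.inc X) (C.inc Y) (C.inc Z))
  simp only [C.nabTor_inc hN, map_add, pr_cur_inc, tor_inc, map_neg, LinearMap.neg_apply, map_sum,
    LinearMap.sum_apply, map_smul, LinearMap.smul_apply, zero_add] at h
  rw [h, ← neg_add, ← neg_add, neg_inj, ← Finset.sum_add_distrib, ← Finset.sum_add_distrib]
  refine Finset.sum_congr rfl fun s _ => ?_
  simp only [T_apply]
  module

/-- The scalar curvature. -/
def scal : A := ∑ b, ∑ a, C.g (C.curH (C.inc (C.e a)) (C.inc (C.e b)) (C.e' b)) (C.e' a)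

lemma I_conj (m s : Fin 3) :
    C.I m * C.I s * C.I m = (if m = s then 2 * sg A m else 0) • C.I m - sg A m • C.I s := by
  have h := C.I_anticomm m s
  rw [eq_sub_of_add_eq h, sub_mul, mul_assoc, I_sq, smul_mul_assoc, one_mul, mul_smul_comm, mul_one]

lemma sum_g_T_I (s m : Fin 3) : ∑ a, C.g (C.T s (C.e a)) (C.I m (C.e' a)) = 0 := by
  rw [sum_g_apply_I, tr_mul_comm, tr_I_mul_T, neg_zero]

lemma sum_g_T_I_I_I (s m : Fin 3) :
    ∑ a, C.g (C.T s (C.e a)) (C.I m (C.I s (C.I m (C.e' a)))) = 0 := by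
  have h : ∀ Y, C.I m (C.I s (C.I m Y)) =
      (if m = s then 2 * sg A m else 0) • C.I m Y - sg A m • C.I s Y := fun Y =>
    LinearMap.congr_fun (C.I_conj m s) Y
  simp only [h, map_sub, map_smul, smul_eq_mul, Finset.sum_sub_distrib, ← Finset.mul_sum,
    sum_g_T_I, mul_zero, sub_zero]

/-- The torsion drops out of the contraction that computes the scalar curvature: every term is a
trace of some T_s against an I_m or against I_m I_s I_m, which is again a combination of the I's. -/
lemma sum_torsion_eq_zero (m : Fin 3) :
    ∑ b, ∑ a, C.g (∑ s, (2 * sg A s) • (C.g (C.I s (C.e b)) (C.I m (C.e' b)) • C.T s (C.e a)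
      + C.g (C.I s (C.I m (C.e' b))) (C.e a) • C.T s (C.e b)
      + C.g (C.I s (C.e a)) (C.e b) • C.T s (C.I m (C.e' b)))) (C.I m (C.e' a)) = 0 := by
  simp only [map_sum, LinearMap.sum_apply, map_smul, LinearMap.smul_apply, smul_eq_mul, map_add,
    LinearMap.add_apply]
  have c : ∀ b, ∑ a, ∑ s, 2 * sg A s * (C.g (C.I s (C.e b)) (C.I m (C.e' b)) *
      C.g (C.T s (C.e a)) (C.I m (C.e' a)) + C.g (C.I s (C.I m (C.e' b))) (C.e a) *
      C.g (C.T s (C.e b)) (C.I m (C.e' a)) + C.g (C.I s (C.e a)) (C.e b) *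
      C.g (C.T s (C.I m (C.e' b))) (C.I m (C.e' a))) =
      ∑ s, 2 * sg A s * (C.g (C.T s (C.e b)) (C.I m (C.I s (C.I m (C.e' b)))) -
        C.g (C.T s (C.I m (C.e' b))) (C.I m (C.I s (C.e b)))) := by
    intro b
    rw [Finset.sum_comm]
    refine Finset.sum_congr rfl fun s _ => ?_
    rw [← Finset.mul_sum, Finset.sum_add_distrib, Finset.sum_add_distrib, ← Finset.mul_sum,
      sum_g_T_I, mul_zero, zero_add, C.contract (F := fun V => C.g (C.T s (C.e b)) (C.I m V))
        ⟨fun _ _ => by simp, fun _ _ => by simp⟩,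
      ← C.contract (F := fun V => C.g (C.T s (C.I m (C.e' b))) (C.I m V))
        ⟨fun _ _ => by simp, fun _ _ => by simp⟩ (C.I s (C.e b)),
      sub_eq_add_neg, ← Finset.sum_neg_distrib]
    congr 2
    refine Finset.sum_congr rfl fun a _ => ?_
    rw [C.I_skew s (C.e a), C.g_symm (C.e a)]
    ring
  simp only [c]
  rw [Finset.sum_comm]
  refine Finset.sum_eq_zero fun s _ => ?_
  rw [← Finset.mul_sum, Finset.sum_sub_distrib, sum_g_T_I_I_I,
    ← C.sum_swap (F := fun X Y => C.g (C.T s (C.I m X)) (C.I m (C.I s Y)))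
      (fun _ => ⟨fun _ _ => by simp, fun _ _ => by simp⟩)
      (fun _ => ⟨fun _ _ => by simp, fun _ _ => by simp⟩),
    C.sum_I (F := fun X Y => C.g (C.T s X) (C.I m (C.I s Y)))
      (fun _ => ⟨fun _ _ => by simp, fun _ _ => by simp⟩)
      (fun _ => ⟨fun _ _ => by simp, fun _ _ => by simp⟩), sum_g_T_I_I_I]
  simp

lemma sum_sig_g (hN : 4 < N) (k : Fin 3) :
    ∑ b, ∑ a, C.sig k (C.inc (C.e a)) (C.inc (C.e b)) * C.g (C.I k (C.e' b)) (C.e' a) =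
      2 * C.Lam * N := by
  have h : ∀ b, ∑ a, C.sig k (C.inc (C.e a)) (C.inc (C.e b)) * C.g (C.I k (C.e' b)) (C.e' a) =
      C.sig k (C.inc (C.I k (C.e' b))) (C.inc (C.e b)) := by
    intro b
    rw [← C.contract' (F := fun X => C.sig k (C.inc X) (C.inc (C.e b)))
      ⟨fun _ _ => by rw [map_add, (C.isLinearMap_sig_left k _).map_add],
        fun _ _ => by rw [map_smul, (C.isLinearMap_sig_left k _).map_smul]⟩]
    exact Finset.sum_congr rfl fun a _ => mul_comm _ _
  simp only [h]
  rw [← neg_neg (2 * C.Lam * (N : A)), ← C.sum_sig hN k, ← Finset.sum_neg_distrib]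
  exact Finset.sum_congr rfl fun b _ => C.sig_swap _ _ _

/-- Moving I_i through R leaves the scalar curvature and two correction terms with σ_{i+1} and
σ_{i+2}, each of which contracts to 2ΛN. -/
lemma sum_curH_I (hN : 4 < N) (i : Fin 3) :
    ∑ b, ∑ a, C.g (C.curH (C.inc (C.e a)) (C.inc (C.e b)) (C.I i (C.e' b))) (C.I i (C.e' a)) =
      sg A i * (4 * C.Lam * N - C.scal) := by
  have hN0 : N ≠ 0 := by omega
  have h : ∀ b a, C.g (C.curH (C.inc (C.e a)) (C.inc (C.e b)) (C.I i (C.e' b)))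
      (C.I i (C.e' a)) =
      -(sg A i * C.g (C.curH (C.inc (C.e a)) (C.inc (C.e b)) (C.e' b)) (C.e' a))
      - sg A (i + 1) * sg A (i + 2) * (C.sig (i + 2) (C.inc (C.e a)) (C.inc (C.e b)) *
        C.g (C.I (i + 2) (C.e' b)) (C.e' a))
      - sg A (i + 1) * sg A (i + 2) * (C.sig (i + 1) (C.inc (C.e a)) (C.inc (C.e b)) *
        C.g (C.I (i + 1) (C.e' b)) (C.e' a)) := by
    intro b a
    have h1 := LinearMap.congr_fun (C.curH_mul_I hN0 i (C.inc (C.e a)) (C.inc (C.e b))) (C.e' b)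
    simp only [Module.End.mul_apply, LinearMap.add_apply, LinearMap.sub_apply,
      LinearMap.smul_apply] at h1
    rw [h1]
    have h2 : ∀ X, C.I i (C.I (i + 1) X) = -sg A (i + 2) • C.I (i + 2) X := fun X =>
      LinearMap.congr_fun (C.I_mul i) X
    have h3 : ∀ X, C.I i (C.I (i + 2) X) = sg A (i + 1) • C.I (i + 1) X := fun X =>
      LinearMap.congr_fun (C.I_mul'' i) X
    have h4 : ∀ X Y, C.g X (C.I i Y) = -C.g (C.I i X) Y := fun X Y => by rw [C.I_skew, neg_neg]
    rw [h4]
    simp only [map_add, map_sub, map_smul, LinearMap.add_apply, LinearMap.sub_apply,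
      LinearMap.smul_apply, I_sq_apply, h2, h3, smul_eq_mul]
    ring
  simp only [h, Finset.sum_sub_distrib, Finset.sum_neg_distrib, ← Finset.mul_sum]
  rw [C.sum_sig_g hN, C.sum_sig_g hN, scal]
  linear_combination (-4 * C.Lam * N) * sg_mul_sg' (A := A) i

/-- Horizontal Bianchi on (e_b, I e'_b, e_a), paired with I e'_a and summed. The first curvature
term gives N²Λ, the other two are equal to 4ΛN - Scal each, and the torsion side vanishes. I is the
first generator, with ε = 1. -/
lemma two_mul_scal (hN : 4 < N) : 2 * C.scal = (N ^ 2 + 8 * N) * C.Lam := by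
  have hN0 : N ≠ 0 := by omega
  have h := Finset.sum_congr rfl fun b (_ : b ∈ Finset.univ) =>
    Finset.sum_congr rfl fun a (_ : a ∈ Finset.univ) =>
    congrArg (fun Z => C.g Z (C.I 0 (C.e' a)))
      (C.bianchi_horizontal hN0 (C.e b) (C.I 0 (C.e' b)) (C.e a))
  simp only [map_neg, LinearMap.neg_apply, Finset.sum_neg_distrib, sum_torsion_eq_zero] at h
  simp only [map_add, LinearMap.add_apply, Finset.sum_add_distrib] at h
  rw [C.sum_curH_I hN] at h
  have h0 : sg A 0 = 1 := rfl
  have h1 : 2 * ∑ b, ∑ a, C.g (C.curH (C.inc (C.e b)) (C.inc (C.I 0 (C.e' b))) (C.e a))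
      (C.I 0 (C.e' a)) = 2 * (N ^ 2 * C.Lam) := by
    simp only [sum_g_apply_I, Finset.sum_neg_distrib, mul_neg]
    rw [Finset.mul_sum]
    simp only [C.tr_curH_mul_I hN0]
    rw [← Finset.mul_sum, C.sum_sig hN, h0]
    ring
  have h2 : ∑ b, ∑ a, C.g (C.curH (C.inc (C.I 0 (C.e' b))) (C.inc (C.e a)) (C.e b))
      (C.I 0 (C.e' a)) = ∑ b, ∑ a, C.g (C.curH (C.inc (C.e a)) (C.inc (C.e b)) (C.I 0 (C.e' b)))
      (C.I 0 (C.e' a)) := by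
    rw [Finset.sum_comm]
    conv_rhs => rw [Finset.sum_comm]
    refine Finset.sum_congr rfl fun a _ => ?_
    have e1 := C.sum_I (F := fun X Y => C.g (C.curH (C.inc Y) (C.inc (C.e a)) X)
      (C.I 0 (C.e' a))) (fun _ => ⟨fun _ _ => by simp, fun _ _ => by simp⟩)
      (fun _ => ⟨fun _ _ => by simp, fun _ _ => by simp⟩) 0
    have e2 := C.sum_swap (F := fun X Y => C.g (C.curH (C.inc Y) (C.inc (C.e a)) (C.I 0 X))
      (C.I 0 (C.e' a))) (fun _ => ⟨fun _ _ => by simp, fun _ _ => by simp⟩)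
      (fun _ => ⟨fun _ _ => by simp, fun _ _ => by simp⟩)
    rw [← neg_inj, ← e1, e2, ← Finset.sum_neg_distrib]
    refine Finset.sum_congr rfl fun b _ => ?_
    rw [C.curH_swap (C.inc (C.e b))]
    simp
  rw [h2, C.sum_curH_I hN] at h
  rw [h0] at h
  refine sub_eq_zero.1 (eq_zero_of_two_mul ?_)
  linear_combination h1 - 2 * h

end ContactAlgebra

end PQC

end

noncomputable section

namespace PQC

namespace ContactAlgebra

variable {N : ℕ} {A L H : Type*} [CommRing A] [Algebra ℝ A] [AddCommGroup L]
    [Module A L] [AddCommGroup H] [Module A H] (C : ContactAlgebra N A L H)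

/-! ### The vertical derivative of the vertical curvature -/

lemma eta_nab_xi_skew (hN : N ≠ 0) (X : L) (i j : Fin 3) :
    sg A i * C.eta j (C.nab X (C.xi i)) + sg A j * C.eta i (C.nab X (C.xi j)) = 0 := by
  have h := C.d_dot hN X (C.xi i) (C.xi j)
  rw [dot_xi, dot_comm _ (C.xi i), dot_xi, dot_xi, eta_xi] at h
  have h0 : C.d X (sg A j * if j = i then 1 else 0) = 0 := by
    split_ifs <;> simp [d_sg]
  rw [h0] at h
  linear_combination -sg A i * sg A j * h
    - sg A i * C.eta j (C.nab X (C.xi i)) * sg_mul_self (A := A) j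
    - sg A j * C.eta i (C.nab X (C.xi j)) * sg_mul_self (A := A) i

/-- The connection coefficients of V are skew for the metric ε, so they vanish against a symmetric
expression. This removes the derivatives of ξ_i and I_i from all sums ∑ ε_i (…) over the frame of V.
-/
lemma sum_eta_nab_xi (hN : N ≠ 0) {B : Type*} [AddCommGroup B] [Module A B] (X : L)
    (F : Fin 3 → Fin 3 → B) :
    ∑ i, sg A i • ∑ j, C.eta j (C.nab X (C.xi i)) • (F i j + F j i) = 0 := by
  have h : ∑ i, sg A i • ∑ j, C.eta j (C.nab X (C.xi i)) • (F i j + F j i) =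
      ∑ i, ∑ j, (sg A i * C.eta j (C.nab X (C.xi i))
        + sg A j * C.eta i (C.nab X (C.xi j))) • F i j := by
    simp only [add_smul, smul_add, Finset.smul_sum, Finset.sum_add_distrib, smul_smul]
    congr 1
    rw [Finset.sum_comm]
  rw [h]
  simp only [C.eta_nab_xi_skew hN, zero_smul, Finset.sum_const_zero]

/-- Frame-free form of `t_cyclic`: on V the vertical torsion is a multiple of the commutator in PQ,
with factor Λ. It can then be differentiated with φ parallel. -/
lemma phi_tor_xi (hN : 4 < N) (i j : Fin 3) : (2 : A) • C.phi (C.tor (C.xi i) (C.xi j)) =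
    -(C.Lam • (C.I i * C.I j - C.I j * C.I i)) := by
  have key : ∀ i, (2 : A) • C.phi (C.tor (C.xi i) (C.xi (i + 1))) =
      -(C.Lam • (C.I i * C.I (i + 1) - C.I (i + 1) * C.I i)) := by
    intro i
    have h := C.t_cyclic hN i
    have h1 := C.t_left hN (i + 1) i
    have h2 := C.t_right hN i (i + 1)
    rw [t] at h h1 h2
    rw [phi_eq, sum_cyclic _ i, h, h1, h2, I_mul, I_mul']
    module
  have h : j = i ∨ j = i + 1 ∨ i = j + 1 := by omega
  rcases h with rfl | rfl | rfl
  · have := C.tor_swap (C.xi j) (C.xi j)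
    have h0 : C.tor (C.xi j) (C.xi j) = 0 := by
      refine eq_zero_of_two_smul (A := A) ?_
      rw [two_smul]
      nth_rewrite 1 [this]
      exact neg_add_cancel _
    simp [h0]
  · exact key i
  · rw [tor_swap, map_neg, smul_neg, key]
    module

lemma phi_tor (hN : 4 < N) {Z W : L} (hZ : C.pr Z = 0) (hW : C.pr W = 0) :
    (2 : A) • C.phi (C.tor Z W) = -(C.Lam • (C.phi Z * C.phi W - C.phi W * C.phi Z)) := by
  rw [C.eq_sum_xi hZ, C.eq_sum_xi hW]
  simp only [map_sum, map_smul, LinearMap.sum_apply, LinearMap.smul_apply, phi_xi,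
    Finset.smul_sum, smul_comm (2 : A), C.phi_tor_xi hN, Finset.sum_mul, Finset.mul_sum,
    smul_mul_assoc, mul_smul_comm, smul_neg, smul_sub, Finset.sum_neg_distrib,
    Finset.sum_sub_distrib]
  congr 2
  · refine Finset.sum_congr rfl fun i _ => Finset.sum_congr rfl fun j _ => ?_
    module
  · rw [Finset.sum_comm]
    refine Finset.sum_congr rfl fun i _ => Finset.sum_congr rfl fun j _ => ?_
    module

lemma eta_eq_of_phi (hN : N ≠ 0) {Z W : L} (h : C.phi Z = C.phi W) (s : Fin 3) :
    C.eta s Z = C.eta s W := by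
  have h1 := congrArg (fun P => C.tr (P * C.I s)) h
  simp only [phi_eq, tr_sum_I_mul_I] at h1
  exact sub_eq_zero.1 (eq_zero_of_mul_sg_mul hN (m := s) (by linear_combination h1))

/-- By `phi_tor` the vertical torsion on V is Λ times a parallel bracket, so its derivative involves
only dΛ. -/
lemma eta_nabTor_xi (hN : 4 < N) (X : L) (k m : Fin 3) :
    C.eta m (C.nabTor X (C.xi (k + 1)) (C.xi (k + 2))) =
      if m = k then sg A k * C.d X C.Lam else 0 := by
  have hN0 : N ≠ 0 := by omega
  have h1 : ∀ i, C.pr (C.nab X (C.xi i)) = 0 := fun i => C.pr_nab _ _ (C.pr_xi i)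
  have hc : C.d X (2 : A) = 0 := by simpa using (C.d X).map_natCast 2
  have h2 : (2 : A) • C.phi (C.nab X (C.tor (C.xi (k + 1)) (C.xi (k + 2)))) =
      C.covEnd X ((2 : A) • C.phi (C.tor (C.xi (k + 1)) (C.xi (k + 2)))) := by
    rw [covEnd_smul, covEnd_phi, hc, zero_smul, zero_add]
  have h3 : (2 : A) • C.phi (C.nabTor X (C.xi (k + 1)) (C.xi (k + 2))) =
      (2 : A) • C.phi ((sg A k * C.d X C.Lam) • C.xi k) := by
    rw [nabTor, map_sub, map_sub, smul_sub, smul_sub, h2, C.phi_tor hN (C.pr_xi _) (C.pr_xi _),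
      C.phi_tor hN (h1 _) (C.pr_xi _), C.phi_tor hN (C.pr_xi _) (h1 _), covEnd_neg, covEnd_smul,
      sub_eq_add_neg (C.phi _ * C.phi _), covEnd_add, covEnd_neg, covEnd_mul, covEnd_mul,
      covEnd_phi, covEnd_phi]
    simp only [phi_xi, map_smul, I_mul4, I_mul5, ← sub_eq_add_neg]
    module
  have h4 : C.phi (C.nabTor X (C.xi (k + 1)) (C.xi (k + 2))) =
      C.phi ((sg A k * C.d X C.Lam) • C.xi k) := by
    rw [← sub_eq_zero]
    refine eq_zero_of_two_smul (A := A) ?_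
    rw [smul_sub, h3, sub_self]
  rw [C.eta_eq_of_phi hN0 h4, map_smul, eta_xi, smul_eq_mul, mul_ite, mul_one, mul_zero]

lemma eta_nabTor_eq_zero (hN : 4 < N) (X : L) (Y : H) {Z : L} (hZ : C.pr Z = 0) (m : Fin 3) :
    C.eta m (C.nabTor X (C.inc Y) Z) = 0 := by
  have h : ∀ Z, C.pr Z = 0 → C.tor (C.inc Y) Z = C.inc (C.pr (C.tor (C.inc Y) Z)) := fun Z hZ =>
    C.ext_of_components (C.pr_inc _).symm fun s => by rw [C.eta_tor_inc_of_pr hN _ hZ, eta_inc]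
  rw [nabTor, map_sub, map_sub, h Z hZ, eta_nab_inc, ← inc_cov, C.eta_tor_inc_of_pr hN _ hZ,
    C.eta_tor_inc_of_pr hN _ (C.pr_nab _ _ hZ), sub_zero, sub_zero]

lemma nabTor_swap (X Y Z : L) : C.nabTor X Y Z = -C.nabTor X Z Y := by
  rw [nabTor, nabTor, C.tor_swap Y Z, C.tor_swap (C.nab X Y), C.tor_swap Y (C.nab X Z), map_neg]
  abel

/-- The horizontal part of `T(ξ_i, ξ_j)` for cyclic `(i, j, k)`. -/
def hh (k : Fin 3) : H := C.h (k + 1) (k + 2)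

lemma tor_xi_xi (k : Fin 3) : ∃ Z, C.pr Z = 0 ∧
    C.tor (C.xi (k + 1)) (C.xi (k + 2)) = C.inc (C.hh k) + Z :=
  ⟨C.tor (C.xi (k + 1)) (C.xi (k + 2)) - C.inc (C.hh k), by
    rw [map_sub, pr_inc, hh, h, sub_self], by abel⟩

/-- Vertical part of the first Bianchi identity on (X, ξ_{k+1}, ξ_{k+2}). The three values of m
yield the next three lemmas. For m = k only a sum of two curvature terms is determined, which is
enough after summing over k. -/
lemma rho_add_rho (hN : 4 < N) (k m : Fin 3) (X : H) :
    C.rho (k + 2) m (C.inc X) (C.xi (k + 1)) + C.rho (k + 1) m (C.xi (k + 2)) (C.inc X) =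
      (if m = k then sg A k * C.d (C.inc X) C.Lam else 0)
        - 2 * sg A m * C.g (C.I m (C.hh k)) X := by
  have hb := congrArg (C.eta m) (C.first_bianchi (C.inc X) (C.xi (k + 1)) (C.xi (k + 2)))
  obtain ⟨Z, hZ, h⟩ := C.tor_xi_xi k
  rw [C.nabTor_swap (C.xi (k + 1))] at hb
  simp only [map_add, map_neg, LinearMap.neg_apply, eta_cur_inc, eta_inc,
    C.eta_nabTor_xi hN, C.eta_nabTor_eq_zero hN _ _ (C.pr_xi _), C.tor_inc_xi hN,
    C.tor_xi_inc hN] at hb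
  rw [h, C.tor_swap _ (C.inc X), map_neg, map_add, map_add, C.eta_tor_inc_of_pr hN _ hZ,
    eta_tor_inc] at hb
  rw [C.I_skew, C.g_symm]
  rw [rho, rho]
  linear_combination hb

lemma sig_xi_succ (hN : 4 < N) (k : Fin 3) (X : H) :
    C.sig k (C.inc X) (C.xi (k + 1)) = -(2 * C.g (C.I (k + 1) (C.hh k)) X) := by
  have h := C.rho_add_rho hN k (k + 1) X
  have h1 := C.rho_succ_succ (by omega) (k + 2) (C.inc X) (C.xi (k + 1))
  rw [show k + 2 + 2 = k + 1 by omega, show k + 2 + 1 = k by omega] at h1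
  rw [C.rho_self (by omega), h1, if_neg (by omega)] at h
  linear_combination sg A (k + 1) * h - (C.sig k (C.inc X) (C.xi (k + 1))
    + 2 * C.g (C.I (k + 1) (C.hh k)) X) * sg_mul_self (A := A) (k + 1)

lemma sig_xi_succ_succ (hN : 4 < N) (k : Fin 3) (X : H) :
    C.sig k (C.inc X) (C.xi (k + 2)) = -(2 * C.g (C.I (k + 2) (C.hh k)) X) := by
  have h := C.rho_add_rho hN k (k + 2) X
  have h1 := C.rho_succ (k + 1) (C.xi (k + 2)) (C.inc X)
  rw [show k + 1 + 2 = k by omega, show k + 1 + 1 = k + 2 by omega] at h1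
  rw [C.rho_self (by omega), h1, if_neg (by omega), C.sig_swap] at h
  linear_combination sg A (k + 2) * h - (C.sig k (C.inc X) (C.xi (k + 2))
    + 2 * C.g (C.I (k + 2) (C.hh k)) X) * sg_mul_self (A := A) (k + 2)

lemma sig_xi_add (hN : 4 < N) (k : Fin 3) (X : H) :
    C.sig (k + 1) (C.inc X) (C.xi (k + 1)) + C.sig (k + 2) (C.inc X) (C.xi (k + 2)) =
      -C.d (C.inc X) C.Lam + 2 * C.g (C.I k (C.hh k)) X := by
  have h := C.rho_add_rho hN k k X
  have h1 := C.rho_succ (k + 2) (C.inc X) (C.xi (k + 1))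
  have h2 := C.rho_succ_succ (by omega) (k + 1) (C.xi (k + 2)) (C.inc X)
  rw [show k + 2 + 1 = k by omega, show k + 2 + 2 = k + 1 by omega] at h1
  rw [show k + 1 + 2 = k by omega, show k + 1 + 1 = k + 2 by omega] at h2
  rw [h1, h2, if_pos rfl, C.sig_swap _ (C.xi _)] at h
  linear_combination -sg A k * h - (C.sig (k + 1) (C.inc X) (C.xi (k + 1))
    + C.sig (k + 2) (C.inc X) (C.xi (k + 2)) + C.d (C.inc X) C.Lam
    - 2 * C.g (C.I k (C.hh k)) X) * sg_mul_self (A := A) k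

/-- The 1-form `∑ g(I_k T(ξ_i, ξ_j), X)`, summed over cyclic `(i, j, k)`. -/
def B (X : H) : A := ∑ k, C.g (C.I k (C.hh k)) X

lemma two_mul_sum_sig_xi (hN : 4 < N) (X : H) :
    2 * ∑ k, C.sig k (C.inc X) (C.xi k) = -(3 * C.d (C.inc X) C.Lam) + 2 * C.B X := by
  have h := Finset.sum_congr rfl fun k (_ : k ∈ Finset.univ) => C.sig_xi_add hN k X
  rw [Finset.sum_add_distrib, sum_shift (fun k => C.sig k (C.inc X) (C.xi k)),
    sum_shift (fun k => C.sig k (C.inc X) (C.xi k)), Finset.sum_add_distrib,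
    ← Finset.mul_sum] at h
  simp only [Finset.sum_const, Finset.card_univ, Fintype.card_fin] at h
  rw [two_mul, h, B]
  ring

end ContactAlgebra

end PQC

end

noncomputable section

namespace PQC

namespace ContactAlgebra

variable {N : ℕ} {A L H : Type*} [CommRing A] [Algebra ℝ A] [AddCommGroup L]
    [Module A L] [AddCommGroup H] [Module A H] (C : ContactAlgebra N A L H)

/-! ### The first divergence formula -/

/-- The divergence of an endomorphism of `H`. -/
def div (P : Module.End A H) (X : H) : A := ∑ a, C.g (C.covEnd (C.inc (C.e a)) P (C.e' a)) X

lemma adj_covEnd (X : L) (P : Module.End A H) :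
    C.adj (C.covEnd X P) = C.covEnd X (C.adj P) := by
  refine (C.eq_adj fun Y Z => ?_).symm
  have h := congrArg (C.d X) (C.g_adj P Y Z)
  rw [d_g_cov, d_g_cov, g_adj] at h
  rw [covEnd_apply, covEnd_apply, map_sub, map_sub, LinearMap.sub_apply, g_adj]
  linear_combination h

/-- The covariant derivative of the torsion endomorphisms `T i`. -/
def nabT (X : L) (i : Fin 3) : Module.End A H :=
  C.covEnd X (C.T i) - ∑ s, C.eta s (C.nab X (C.xi i)) • C.T s

lemma tr_nabT (hN : 4 < N) (X : L) (i : Fin 3) : C.tr (C.nabT X i) = 0 := by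
  rw [nabT, map_sub, ← d_tr, C.tr_T hN]
  simp [C.tr_T hN]

lemma tr_nabT_mul_I (X : L) (i m : Fin 3) : C.tr (C.nabT X i * C.I m) = 0 := by
  have hT : ∀ s, C.tr (C.T s * C.I m) = 0 := fun s => by rw [tr_mul_comm, tr_I_mul_T]
  have h := C.d_tr X (C.T i * C.I m)
  rw [hT, map_zero, covEnd_mul, map_add, covEnd_I, Finset.mul_sum, map_sum] at h
  have h0 : ∀ t, C.tr (C.T i * C.eta t (C.nab X (C.xi m)) • C.I t) = 0 := fun t => by
    rw [mul_smul_comm, map_smul, tr_mul_comm, tr_I_mul_T, smul_zero]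
  simp only [h0, Finset.sum_const_zero, add_zero] at h
  rw [nabT, sub_mul, map_sub, ← h, Finset.sum_mul, map_sum]
  simp [hT]

lemma pr_tor_inc_of_pr (hN : 4 < N) (X : H) {Z : L} (hZ : C.pr Z = 0) :
    C.pr (C.tor (C.inc X) Z) = -∑ s, C.eta s Z • C.T s X := by
  conv_lhs => rw [C.eq_sum_xi hZ]
  simp [C.tor_inc_xi hN, pr_inc]

lemma pr_nabTor_inc_xi (hN : 4 < N) (X : L) (Y : H) (i : Fin 3) :
    C.pr (C.nabTor X (C.inc Y) (C.xi i)) = -C.nabT X i Y := by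
  rw [nabTor, C.tor_inc_xi hN, map_sub, map_sub, map_neg, map_neg, ← inc_cov, ← inc_cov,
    C.tor_inc_xi hN, map_neg, pr_inc, pr_inc, C.pr_tor_inc_of_pr hN _ (C.pr_nab _ _ (C.pr_xi i)),
    nabT, LinearMap.sub_apply, covEnd_apply, LinearMap.sum_apply]
  simp only [LinearMap.smul_apply]
  abel

/-- Horizontal part of the first Bianchi identity on (X, Y, ξ_i). The curvature of V does not
contribute, and T(X, Y) enters through the horizontal parts of T(ξ_s, ξ_i). -/
lemma bianchi_xi (hN : 4 < N) (X Y : H) (i : Fin 3) :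
    C.curH (C.inc Y) (C.xi i) X + C.curH (C.xi i) (C.inc X) Y =
      -C.nabT (C.inc X) i Y + C.nabT (C.inc Y) i X
        - ∑ s, (2 * sg A s * C.g (C.I s X) Y) • C.h s i := by
  have hb := congrArg C.pr (C.first_bianchi (C.inc X) (C.inc Y) (C.xi i))
  rw [C.nabTor_swap (C.inc Y) (C.xi i), C.nabTor_inc (by omega)] at hb
  simp only [map_add, map_neg, C.pr_nabTor_inc_xi hN, pr_cur_inc, pr_cur_xi, C.tor_inc_xi hN,
    C.tor_xi_inc hN, LinearMap.neg_apply, pr_tor_inc, C.tor_inc X Y, map_sum, map_smul,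
    LinearMap.sum_apply, LinearMap.smul_apply, map_zero] at hb
  simp only [h]
  rw [zero_add] at hb
  rw [hb]
  abel

lemma tr_curH (X Y : L) : C.tr (C.curH X Y) = 0 := by
  have h : C.adj (C.curH X Y) = -C.curH X Y := by
    refine (C.eq_adj fun Z W => ?_).symm
    rw [LinearMap.neg_apply, map_neg, LinearMap.neg_apply, g_curH, neg_neg]
  have h1 := C.tr_adj (C.curH X Y)
  rw [h, map_neg] at h1
  exact eq_zero_of_two_mul (by linear_combination -h1)

/-- By `I_mul_T`, P_i I_i is the commutator of T_i with I_i. The derivatives of the frames ξ_i and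
I_i cancel by `sum_eta_nab_xi`, so only the tensorial derivatives of T_i remain. -/
lemma sum_covEnd_tau2 (hN : 4 < N) (X : L) :
    ∑ i, sg A i • (C.nabT X i * C.I i - C.I i * C.nabT X i) = -C.covEnd X C.tau2 := by
  have hN0 : N ≠ 0 := by omega
  have h1 : -C.tau2 = ∑ i, sg A i • (C.T i * C.I i + -(C.I i * C.T i)) := by
    rw [tau2, neg_neg]
    refine Finset.sum_congr rfl fun i _ => ?_
    rw [C.I_mul_T hN, P, add_mul, neg_neg]
  rw [← covEnd_neg, h1, covEnd_sum, ← sub_eq_zero, ← Finset.sum_sub_distrib,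
    ← neg_eq_zero, ← C.sum_eta_nab_xi hN0 X fun i j => C.T j * C.I i - C.I i * C.T j,
    ← Finset.sum_neg_distrib]
  refine Finset.sum_congr rfl fun i _ => ?_
  rw [covEnd_smul, d_sg, zero_smul, zero_add, covEnd_add, covEnd_neg, covEnd_mul, covEnd_mul,
    covEnd_I, nabT, ← smul_sub, ← smul_neg]
  congr 1
  simp only [sub_mul, mul_sub, Finset.sum_mul, Finset.mul_sum, smul_add, smul_sub,
    Finset.sum_add_distrib, Finset.sum_sub_distrib, smul_mul_assoc, mul_smul_comm]
  abel

lemma I_mul_apply (i : Fin 3) (X : H) : C.I i (C.I (i + 1) X) = -sg A (i + 2) • C.I (i + 2) X :=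
  LinearMap.congr_fun (C.I_mul i) X

lemma I_mul_apply' (i : Fin 3) (X : H) : C.I (i + 1) (C.I i X) = sg A (i + 2) • C.I (i + 2) X :=
  LinearMap.congr_fun (C.I_mul' i) X

lemma I_mul_apply'' (i : Fin 3) (X : H) : C.I i (C.I (i + 2) X) = sg A (i + 1) • C.I (i + 1) X :=
  LinearMap.congr_fun (C.I_mul'' i) X

lemma I_mul_apply''' (i : Fin 3) (X : H) :
    C.I (i + 2) (C.I i X) = -sg A (i + 1) • C.I (i + 1) X :=
  LinearMap.congr_fun (C.I_mul''' i) X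

lemma sg_mul_sig_xi_I_succ (hN : 4 < N) (i : Fin 3) (Y : H) :
    sg A (i + 1) * C.sig (i + 2) (C.xi i) (C.inc (C.I (i + 1) Y)) =
      2 * sg A i * C.g (C.I (i + 2) (C.hh (i + 2))) Y := by
  have h := C.sig_xi_succ hN (i + 2) (C.I (i + 1) Y)
  have h1 := C.I_skew (i + 1) (C.I i (C.hh (i + 2))) Y
  rw [I_mul_apply', map_smul, LinearMap.smul_apply, smul_eq_mul] at h1
  rw [show i + 2 + 1 = i by omega] at h
  rw [sig_swap, h]
  linear_combination 2 * sg A (i + 1) * h1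
    - 2 * C.g (C.I (i + 2) (C.hh (i + 2))) Y * sg_mul_sg' (A := A) i

lemma sg_mul_sig_xi_I_succ_succ (hN : 4 < N) (i : Fin 3) (Y : H) :
    sg A (i + 2) * C.sig (i + 1) (C.xi i) (C.inc (C.I (i + 2) Y)) =
      -(2 * sg A i * C.g (C.I (i + 1) (C.hh (i + 1))) Y) := by
  have h := C.sig_xi_succ_succ hN (i + 1) (C.I (i + 2) Y)
  have h1 := C.I_skew (i + 2) (C.I i (C.hh (i + 1))) Y
  rw [I_mul_apply''', map_smul, LinearMap.smul_apply, smul_eq_mul] at h1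
  rw [show i + 1 + 2 = i by omega] at h
  rw [sig_swap, h]
  linear_combination 2 * sg A (i + 2) * h1
    + 2 * C.g (C.I (i + 1) (C.hh (i + 1))) Y * sg_mul_sg' (A := A) i

/-- Commuting I_i past R(ξ_i, e_a) costs values of σ_{i+1} and σ_{i+2} on pairs containing ξ_i.
These are the mixed values that `sig_xi_succ` and `sig_xi_succ_succ` determine completely. -/
lemma sum_curH_xi_I (hN : 4 < N) (i : Fin 3) (Y : H) :
    ∑ a, C.g (C.curH (C.xi i) (C.inc (C.e a)) Y) (C.I i (C.e' a)) =
      -∑ a, C.g (C.curH (C.xi i) (C.inc (C.e a)) (C.I i Y)) (C.e' a)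
        - 2 * sg A i * (C.g (C.I (i + 1) (C.hh (i + 1))) Y
          + C.g (C.I (i + 2) (C.hh (i + 2))) Y) := by
  have hN0 : N ≠ 0 := by omega
  have h : ∀ a, C.g (C.curH (C.xi i) (C.inc (C.e a)) Y) (C.I i (C.e' a)) =
      -C.g (C.curH (C.xi i) (C.inc (C.e a)) (C.I i Y)) (C.e' a)
      - sg A (i + 1) * (C.g (C.I (i + 1) Y) (C.e' a) * C.sig (i + 2) (C.xi i) (C.inc (C.e a)))
      + sg A (i + 2) * (C.g (C.I (i + 2) Y) (C.e' a) *
        C.sig (i + 1) (C.xi i) (C.inc (C.e a))) := by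
    intro a
    have h1 := congrArg (fun Z => C.g Z (C.e' a))
      (LinearMap.congr_fun (C.curH_mul_I hN0 i (C.xi i) (C.inc (C.e a))) Y)
    simp only [Module.End.mul_apply, LinearMap.add_apply, LinearMap.sub_apply,
      LinearMap.smul_apply, map_add, map_sub, map_smul, smul_eq_mul, C.I_skew i (C.curH _ _ _)]
      at h1
    linear_combination h1
  have h2 : ∀ m X, ∑ a, C.g X (C.e' a) * C.sig m (C.xi i) (C.inc (C.e a)) =
      C.sig m (C.xi i) (C.inc X) := fun m X =>
    C.contract' (F := fun X => C.sig m (C.xi i) (C.inc X))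
      ⟨fun _ _ => by rw [map_add, (C.isLinearMap_sig_right m _).map_add],
        fun _ _ => by rw [map_smul, (C.isLinearMap_sig_right m _).map_smul]⟩ X
  simp only [h, Finset.sum_add_distrib, Finset.sum_sub_distrib, Finset.sum_neg_distrib,
    ← Finset.mul_sum, h2]
  rw [C.sg_mul_sig_xi_I_succ hN, C.sg_mul_sig_xi_I_succ_succ hN]
  ring

/-- `bianchi_xi` is contracted twice: with I_i e'_a at Y, and with e'_a at I_i Y. Adding the two
removes the unknown Ricci-type sum of g(R(ξ_i, e_a) I_i Y, e'_a) and leaves σ_i(Y, ξ_i). -/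
lemma sum_bianchi_xi (hN : 4 < N) (i : Fin 3) (Y : H) :
    sg A i * N * C.sig i (C.inc Y) (C.xi i) + 4 * sg A i * (C.g (C.I (i + 1) (C.hh (i + 1))) Y
      + C.g (C.I (i + 2) (C.hh (i + 2))) Y) =
    2 * ∑ a, C.g ((C.nabT (C.inc (C.e a)) i * C.I i - C.I i * C.nabT (C.inc (C.e a)) i) Y)
      (C.e' a) := by
  have hN0 : N ≠ 0 := by omega
  have b1 := Finset.sum_congr rfl fun a (_ : a ∈ Finset.univ) =>
    congrArg (fun Z => C.g Z (C.I i (C.e' a))) (C.bianchi_xi hN (C.e a) Y i)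
  have b2 := Finset.sum_congr rfl fun a (_ : a ∈ Finset.univ) =>
    congrArg (fun Z => C.g Z (C.e' a)) (C.bianchi_xi hN (C.e a) (C.I i Y) i)
  simp only [map_add, map_sub, map_neg, map_sum, map_smul, LinearMap.add_apply,
    LinearMap.sub_apply, LinearMap.neg_apply, LinearMap.sum_apply, LinearMap.smul_apply,
    Finset.sum_add_distrib, Finset.sum_sub_distrib, Finset.sum_neg_distrib, smul_eq_mul,
    sum_g_apply_I, C.sum_curH_xi_I hN, tr_nabT_mul_I, neg_zero, add_zero] at b1
  simp only [map_add, map_sub, map_neg, map_sum, map_smul, LinearMap.add_apply,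
    LinearMap.sub_apply, LinearMap.neg_apply, LinearMap.sum_apply, LinearMap.smul_apply,
    Finset.sum_add_distrib, Finset.sum_sub_distrib, Finset.sum_neg_distrib, smul_eq_mul,
    ← tr_apply, tr_curH, C.tr_nabT hN, add_zero, zero_add] at b2
  -- The horizontal torsion terms of the two contractions cancel: I_i and I_s anticommute for s ≠ i,
  -- and for s = i the torsion T(ξ_i, ξ_i) is zero.
  have e : ∑ a, ∑ s, 2 * sg A s * C.g (C.I s (C.e a)) Y * C.g (C.h s i) (C.I i (C.e' a)) +
      ∑ a, ∑ s, 2 * sg A s * C.g (C.I s (C.e a)) (C.I i Y) * C.g (C.h s i) (C.e' a) = 0 := by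
    rw [Finset.sum_comm, Finset.sum_comm (γ := Fin N), ← Finset.sum_add_distrib]
    refine Finset.sum_eq_zero fun s _ => ?_
    have c1 : ∑ a, 2 * sg A s * C.g (C.I s (C.e a)) Y * C.g (C.h s i) (C.I i (C.e' a)) =
        -(2 * sg A s * C.g (C.h s i) (C.I i (C.I s Y))) := by
      rw [← C.contract (F := fun V => C.g (C.h s i) (C.I i V))
        ⟨fun _ _ => by simp, fun _ _ => by simp⟩ (C.I s Y), Finset.mul_sum,
        ← Finset.sum_neg_distrib]
      refine Finset.sum_congr rfl fun a _ => ?_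
      rw [C.I_skew s, C.g_symm (C.e a)]
      ring
    have c2 : ∑ a, 2 * sg A s * C.g (C.I s (C.e a)) (C.I i Y) * C.g (C.h s i) (C.e' a) =
        -(2 * sg A s * C.g (C.h s i) (C.I s (C.I i Y))) := by
      rw [← C.contract (F := fun V => C.g (C.h s i) V)
        ⟨fun _ _ => by simp, fun _ _ => by simp⟩ (C.I s (C.I i Y)), Finset.mul_sum,
        ← Finset.sum_neg_distrib]
      refine Finset.sum_congr rfl fun a _ => ?_
      rw [C.I_skew s, C.g_symm (C.e a)]
      ring
    have c3 := congrArg (C.g (C.h s i)) (LinearMap.congr_fun (C.I_anticomm i s) Y)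
    simp only [LinearMap.add_apply, Module.End.mul_apply, map_add, LinearMap.smul_apply,
      map_smul] at c3
    rw [c1, c2]
    rcases eq_or_ne i s with rfl | his
    · simp [h_self]
    · rw [if_neg his, zero_smul] at c3
      linear_combination -2 * sg A s * c3
  have h1 := C.tr_curH_mul_I hN0 i (C.inc Y) (C.xi i)
  have e2 : ∀ a, C.g (C.nabT (C.inc (C.e a)) i Y) (C.I i (C.e' a)) =
      -C.g (C.I i (C.nabT (C.inc (C.e a)) i Y)) (C.e' a) := fun a => by rw [C.I_skew, neg_neg]
  simp only [e2, Finset.sum_neg_distrib] at b1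
  simp only [LinearMap.sub_apply, Module.End.mul_apply, map_sub, LinearMap.sub_apply,
    Finset.sum_sub_distrib]
  linear_combination -h1 - 2 * b1 - 2 * b2 + 2 * e

/-- First relation between the divergence of `τ` and the differential of `Λ`. -/
lemma four_mul_div_tau2 (hN : 4 < N) (Y : H) :
    4 * ∑ a, C.g (C.covEnd (C.inc (C.e a)) C.tau2 Y) (C.e' a) =
      3 * N * C.d (C.inc Y) C.Lam - (2 * N + 16) * C.B Y := by
  have h1 : ∀ a, C.g (C.covEnd (C.inc (C.e a)) C.tau2 Y) (C.e' a) =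
      -∑ i, sg A i * C.g ((C.nabT (C.inc (C.e a)) i * C.I i
        - C.I i * C.nabT (C.inc (C.e a)) i) Y) (C.e' a) := by
    intro a
    have h := congrArg (fun P => C.g (P Y) (C.e' a)) (C.sum_covEnd_tau2 hN (C.inc (C.e a)))
    simp only [LinearMap.sum_apply, map_sum, LinearMap.smul_apply, map_smul, smul_eq_mul,
      LinearMap.neg_apply, map_neg] at h
    rw [h, neg_neg]
  simp only [h1, Finset.sum_neg_distrib]
  rw [Finset.sum_comm]
  simp only [← Finset.mul_sum]
  have h2 : ∀ i, 2 * (sg A i * ∑ a, C.g ((C.nabT (C.inc (C.e a)) i * C.I i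
      - C.I i * C.nabT (C.inc (C.e a)) i) Y) (C.e' a)) =
      N * C.sig i (C.inc Y) (C.xi i) + 4 * (C.g (C.I (i + 1) (C.hh (i + 1))) Y
        + C.g (C.I (i + 2) (C.hh (i + 2))) Y) := by
    intro i
    linear_combination -sg A i * C.sum_bianchi_xi hN i Y + (N * C.sig i (C.inc Y) (C.xi i) +
      4 * (C.g (C.I (i + 1) (C.hh (i + 1))) Y + C.g (C.I (i + 2) (C.hh (i + 2))) Y))
      * sg_mul_self (A := A) i
  -- On summing over i, each g(I_k h_k, Y) is counted twice, and the sum of σ_i(Y, ξ_i) is known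
  -- from `two_mul_sum_sig_xi`.
  have h3 := Finset.sum_congr rfl fun i (_ : i ∈ Finset.univ) => h2 i
  rw [← Finset.mul_sum, Finset.sum_add_distrib, ← Finset.mul_sum, ← Finset.mul_sum,
    Finset.sum_add_distrib, sum_shift (fun i => C.g (C.I i (C.hh i)) Y),
    sum_shift (fun i => C.g (C.I i (C.hh i)) Y)] at h3
  have h4 := C.two_mul_sum_sig_xi hN Y
  simp only [B] at h4 ⊢
  linear_combination -2 * h3 - N * h4

end ContactAlgebra

end PQC

end

noncomputable section

namespace PQC

namespace ContactAlgebra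

variable {N : ℕ} {A L H : Type*} [CommRing A] [Algebra ℝ A] [AddCommGroup L]
    [Module A L] [AddCommGroup H] [Module A H] (C : ContactAlgebra N A L H)

/-! ### The second divergence formula -/

/-- The covariant derivative of the curvature of `H`. -/
def nabCurH (X Y Z : L) : Module.End A H :=
  C.covEnd X (C.curH Y Z) - C.curH (C.nab X Y) Z - C.curH Y (C.nab X Z)

lemma second_bianchi_curH (X Y Z : L) :
    C.nabCurH X Y Z + C.nabCurH Y Z X + C.nabCurH Z X Y + C.curH (C.tor X Y) Z
      + C.curH (C.tor Y Z) X + C.curH (C.tor Z X) Y = 0 := by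
  ext W
  have h := congrArg C.pr (C.second_bianchi X Y Z (C.inc W))
  have h1 : ∀ X Y Z, C.pr (C.nabCur X Y Z (C.inc W)) = C.nabCurH X Y Z W := by
    intro X Y Z
    simp only [nabCur, nabCurH, map_sub, LinearMap.sub_apply, covEnd_apply, ← inc_cov,
      ← inc_curH, pr_inc]
    abel
  simp only [map_add, h1, pr_cur_inc, map_zero] at h
  simpa using h

lemma nabCurH_swap (X Y Z : L) : C.nabCurH X Y Z = -C.nabCurH X Z Y := by
  rw [nabCurH, nabCurH, C.curH_swap Y Z, C.curH_swap (C.nab X Y), C.curH_swap Y, covEnd_neg]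
  abel

lemma nabCurH_add_left (X X' Y Z : L) :
    C.nabCurH (X + X') Y Z = C.nabCurH X Y Z + C.nabCurH X' Y Z := by
  simp only [nabCurH, covEnd_add_left, map_add, AddMonoidHom.add_apply, LinearMap.add_apply]
  abel

lemma nabCurH_smul_left (f : A) (X Y Z : L) : C.nabCurH (f • X) Y Z = f • C.nabCurH X Y Z := by
  simp only [nabCurH, covEnd_smul_left, map_smul, AddMonoidHom.smul_apply, LinearMap.smul_apply]
  module

/-- Linearity of ∇R over functions in its first two slots is what permits contracting it with a
frame and moving I_k across the contraction. -/
lemma nabCurH_add_middle (X Y Y' Z : L) :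
    C.nabCurH X (Y + Y') Z = C.nabCurH X Y Z + C.nabCurH X Y' Z := by
  simp only [nabCurH, covEnd_add, map_add, LinearMap.add_apply]
  abel

lemma nabCurH_smul_middle (f : A) (X Y Z : L) :
    C.nabCurH X (f • Y) Z = f • C.nabCurH X Y Z := by
  simp only [nabCurH, covEnd_smul, map_smul, nab_smul, map_add, LinearMap.add_apply,
    LinearMap.smul_apply]
  module

lemma tr_nabCurH_mul_I (X Y Z : L) (k : Fin 3) : C.tr (C.nabCurH X Y Z * C.I k) =
    C.d X (C.tr (C.curH Y Z * C.I k))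
      - ∑ t, C.eta t (C.nab X (C.xi k)) * C.tr (C.curH Y Z * C.I t)
      - C.tr (C.curH (C.nab X Y) Z * C.I k) - C.tr (C.curH Y (C.nab X Z) * C.I k) := by
  rw [nabCurH, sub_mul, sub_mul, map_sub, map_sub, d_tr, covEnd_mul, map_add, covEnd_I,
    Finset.mul_sum, map_sum]
  simp only [mul_smul_comm, map_smul, smul_eq_mul]
  ring

lemma cov_I (X : L) (k : Fin 3) (Y : H) : C.cov X (C.I k Y) =
    ∑ t, C.eta t (C.nab X (C.xi k)) • C.I t Y + C.I k (C.cov X Y) := by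
  have h := LinearMap.congr_fun (C.covEnd_I X k) Y
  rw [covEnd_apply, LinearMap.sum_apply] at h
  rw [← sub_eq_iff_eq_add, h]
  rfl

/-- The endomorphism of `H` that represents `(Z, X) ↦ ∑ k, ε_k tr(R(I_k Z, X) I_k)`. -/
def Phi : Module.End A H := (6 * C.Lam) • 1 + C.tau2 + (6 : A) • C.U 0

/-- By `tr_curH_mul_I` the traces are multiples of σ_k(I_k Z, X). `sig_inc` splits these into the
multiple 6Λ of the identity and the sum evaluated by `sum_K_mul_I`, so `Phi` represents the form up
to the factor N/2. -/
lemma sum_tr_curH_I (hN : 4 < N) (Z X : H) :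
    2 * ∑ k, sg A k * C.tr (C.curH (C.inc (C.I k Z)) (C.inc X) * C.I k) =
      N * C.g (C.Phi Z) X := by
  have h : ∀ k, 2 * (sg A k * C.tr (C.curH (C.inc (C.I k Z)) (C.inc X) * C.I k)) =
      N * (2 * C.Lam * C.g Z X + C.g (((2 : A) • (C.K (k + 1) (k + 2) * C.I k)) Z) X) := by
    intro k
    have h1 := C.tr_curH_mul_I (by omega) k (C.inc (C.I k Z)) (C.inc X)
    rw [C.sig_inc hN, I_sq_apply] at h1
    simp only [map_smul, LinearMap.smul_apply, smul_eq_mul, Module.End.mul_apply] at h1 ⊢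
    linear_combination sg A k * h1 + (N * (2 * C.Lam * C.g Z X * (sg A k * sg A k + 1) +
      2 * C.g (C.K (k + 1) (k + 2) (C.I k Z)) X)) * sg_mul_self (A := A) k
  rw [Finset.mul_sum]
  simp only [h]
  have h2 : ∑ k, C.g (((2 : A) • (C.K (k + 1) (k + 2) * C.I k)) Z) X =
      C.g ((C.tau2 + (6 : A) • C.U 0) Z) X := by
    rw [← C.sum_K_mul_I hN, LinearMap.sum_apply, map_sum, LinearMap.sum_apply]
  rw [← Finset.mul_sum, Finset.sum_add_distrib, h2]
  simp only [Finset.sum_const, Finset.card_univ, Fintype.card_fin, Phi, LinearMap.add_apply,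
    map_add, LinearMap.smul_apply, map_smul, smul_eq_mul, Module.End.one_apply, nsmul_eq_mul]
  push_cast
  ring

/-- Differentiate `sum_tr_curH_I`. The weights ε_k make the sum invariant under rotations of the
frame I_k, so the derivatives of I_k cancel. -/
lemma sum_tr_nabCurH_I (hN : 4 < N) (V : L) (Z X : H) :
    2 * ∑ k, sg A k * C.tr (C.nabCurH V (C.inc (C.I k Z)) (C.inc X) * C.I k) =
      N * C.g (C.covEnd V C.Phi Z) X := by
  have hN0 : N ≠ 0 := by omega
  have h0 := C.sum_eta_nab_xi hN0 V
    fun k t => C.tr (C.curH (C.inc (C.I k Z)) (C.inc X) * C.I t)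
  simp only [smul_eq_mul, mul_add, Finset.sum_add_distrib] at h0
  have h1 := congrArg (C.d V) (C.sum_tr_curH_I hN Z X)
  have h2 := C.sum_tr_curH_I hN (C.cov V Z) X
  have h3 := C.sum_tr_curH_I hN Z (C.cov V X)
  have hc : C.d V (2 : A) = 0 := by simpa using (C.d V).map_natCast 2
  have hc' : C.d V (N : A) = 0 := (C.d V).map_natCast N
  simp only [Derivation.leibniz, hc, hc', map_sum, d_sg, smul_eq_mul, d_g_cov] at h1
  simp only [tr_nabCurH_mul_I, ← inc_cov, cov_I, map_add, map_sum, map_smul, LinearMap.add_apply,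
    LinearMap.sum_apply, LinearMap.smul_apply, add_mul, Finset.sum_mul, smul_mul_assoc,
    smul_eq_mul, mul_sub, mul_add, Finset.sum_sub_distrib, Finset.sum_add_distrib]
  rw [covEnd_apply, map_sub, LinearMap.sub_apply]
  simp only [mul_zero, add_zero] at h1
  linear_combination h1 - h2 - h3 - 2 * h0

/-- Here both remaining slots are contracted. Each weighted trace is the function -N²Λ, and there
are three of them. -/
lemma sum_tr_nabCurH_frame (hN : 4 < N) (X : L) :
    ∑ k, sg A k * ∑ a, C.tr (C.nabCurH X (C.inc (C.e a)) (C.inc (C.I k (C.e' a))) * C.I k) =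
      -(3 * N ^ 2 * C.d X C.Lam) := by
  have hN0 : N ≠ 0 := by omega
  have h0 := C.sum_eta_nab_xi hN0 X
    fun k t => ∑ a, C.tr (C.curH (C.inc (C.e a)) (C.inc (C.I t (C.e' a))) * C.I k)
  simp only [smul_eq_mul, mul_add, Finset.sum_add_distrib] at h0
  have h1 : ∀ k, 2 * (sg A k * ∑ a, C.tr (C.curH (C.inc (C.e a)) (C.inc (C.I k (C.e' a))) *
      C.I k)) = -(2 * (N ^ 2 * C.Lam)) := by
    intro k
    have := Finset.sum_congr rfl fun a (_ : a ∈ Finset.univ) =>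
      C.tr_curH_mul_I hN0 k (C.inc (C.e a)) (C.inc (C.I k (C.e' a)))
    rw [← Finset.mul_sum, ← Finset.mul_sum, C.sum_sig hN] at this
    linear_combination sg A k * this - 2 * N ^ 2 * C.Lam * sg_mul_self (A := A) k
  have h2 : ∀ k, sg A k * ∑ a, C.tr (C.curH (C.inc (C.e a)) (C.inc (C.I k (C.e' a))) *
      C.I k) = -(N ^ 2 * C.Lam) := fun k =>
    sub_eq_zero.1 (eq_zero_of_two_mul (by linear_combination h1 k))
  have hc' : C.d X (N : A) = 0 := (C.d X).map_natCast N
  have h3 : ∀ k, sg A k * ∑ a, C.d X (C.tr (C.curH (C.inc (C.e a)) (C.inc (C.I k (C.e' a))) *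
      C.I k)) = -(N ^ 2 * C.d X C.Lam) := by
    intro k
    have := congrArg (C.d X) (h2 k)
    simpa [Derivation.leibniz, d_sg, hc', Derivation.leibniz_pow] using this
  have h4 : ∀ k, ∑ a, C.tr (C.curH (C.inc (C.cov X (C.e a))) (C.inc (C.I k (C.e' a))) * C.I k)
      + ∑ a, C.tr (C.curH (C.inc (C.e a)) (C.inc (C.I k (C.cov X (C.e' a)))) * C.I k) = 0 :=
    fun k => C.sum_cov_frame
      (F := fun Y Z => C.tr (C.curH (C.inc Y) (C.inc (C.I k Z)) * C.I k))
      (fun _ => ⟨fun _ _ => by simp [add_mul], fun _ _ => by simp⟩)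
      (fun _ => ⟨fun _ _ => by simp [add_mul], fun _ _ => by simp⟩) X
  have h5 := Finset.sum_congr rfl fun k (_ : k ∈ Finset.univ) => congrArg (sg A k * ·) (h4 k)
  have h6 := Finset.sum_congr rfl fun k (_ : k ∈ Finset.univ) => h3 k
  simp only [mul_zero, mul_add, Finset.sum_add_distrib, Finset.sum_const_zero] at h5
  simp only [tr_nabCurH_mul_I, ← inc_cov, cov_I, map_add, map_sum, map_smul,
    add_mul, Finset.sum_mul, smul_mul_assoc, smul_eq_mul, mul_sub, mul_add, Finset.sum_sub_distrib, Finset.sum_add_distrib]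
  have c : ∀ F : Fin 3 → Fin N → Fin 3 → A, ∑ k, sg A k * ∑ a, ∑ t,
      C.eta t (C.nab X (C.xi k)) * F k a t =
      ∑ k, sg A k * ∑ t, C.eta t (C.nab X (C.xi k)) * ∑ a, F k a t := by
    intro F
    refine Finset.sum_congr rfl fun k _ => ?_
    rw [Finset.sum_comm]
    simp only [Finset.mul_sum]
  rw [c fun k a t => C.tr (C.curH (C.inc (C.e a)) (C.inc (C.I k (C.e' a))) * C.I t),
    c fun k a t => C.tr (C.curH (C.inc (C.e a)) (C.inc (C.I t (C.e' a))) * C.I k)]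
  simp only [Finset.sum_const, Finset.card_univ, Fintype.card_fin, nsmul_eq_mul] at h6
  push_cast at h6
  linear_combination h6 - h5 - h0

/-- Skewness of the curvature and skewness of I_k in the contraction make the two sums equal; each
is half of N times the divergence of `Phi`. -/
lemma sum_tr_nabCurH_div (hN : 4 < N) (X : H) :
    ∑ k, sg A k * ∑ a, C.tr (C.nabCurH (C.inc (C.e a)) (C.inc (C.I k (C.e' a))) (C.inc X) * C.I k)
      + ∑ k, sg A k * ∑ a, C.tr (C.nabCurH (C.inc (C.I k (C.e' a))) (C.inc X) (C.inc (C.e a)) *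
        C.I k) = N * C.div C.Phi X := by
  have h1 : ∀ k, ∑ a, C.tr (C.nabCurH (C.inc (C.I k (C.e' a))) (C.inc X) (C.inc (C.e a)) *
      C.I k) = ∑ a, C.tr (C.nabCurH (C.inc (C.e a)) (C.inc (C.I k (C.e' a))) (C.inc X) *
      C.I k) := by
    intro k
    have l1 : ∀ Z : H, IsLinearMap A fun Y : H =>
        C.tr (C.nabCurH (C.inc Y) (C.inc Z) (C.inc X) * C.I k) := fun Z =>
      ⟨fun _ _ => by simp [nabCurH_add_left, add_mul], fun _ _ => by simp [nabCurH_smul_left]⟩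
    have l2 : ∀ Y : H, IsLinearMap A fun Z : H =>
        C.tr (C.nabCurH (C.inc Y) (C.inc Z) (C.inc X) * C.I k) := fun Y =>
      ⟨fun _ _ => by simp [nabCurH_add_middle, add_mul], fun _ _ => by simp [nabCurH_smul_middle]⟩
    have s1 := C.sum_I l1 l2 k
    have s2 := C.sum_swap
      (F := fun Y Z => C.tr (C.nabCurH (C.inc (C.I k Y)) (C.inc Z) (C.inc X) * C.I k))
      (fun Z => ⟨fun _ _ => by simp [nabCurH_add_left, add_mul],
        fun _ _ => by simp [nabCurH_smul_left]⟩)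
      (fun Y => l2 (C.I k Y))
    rw [← neg_inj, ← s1, s2, ← Finset.sum_neg_distrib]
    refine Finset.sum_congr rfl fun a _ => ?_
    rw [nabCurH_swap, neg_mul, map_neg, neg_neg]
  simp only [h1]
  have h2 := Finset.sum_congr rfl fun a (_ : a ∈ Finset.univ) =>
    C.sum_tr_nabCurH_I hN (C.inc (C.e a)) (C.e' a) X
  rw [← Finset.mul_sum, ← Finset.mul_sum, Finset.sum_comm] at h2
  simp only [← Finset.mul_sum] at h2
  rw [div]
  linear_combination h2

/-- The term s = k gives σ_k(X, ξ_k). In the other two, I_k I_s is a multiple of the third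
generator, and the known mixed values of σ_k contribute 2 g(I_k h_k, X) each, with a minus sign. -/
lemma sum_sig_xi_I (hN : 4 < N) (k : Fin 3) (X : H) :
    ∑ s, sg A s * C.sig k (C.xi s) (C.inc (C.I k (C.I s X))) =
      -C.sig k (C.inc X) (C.xi k) - 4 * C.g (C.I k (C.hh k)) X := by
  have h1 := C.sig_xi_succ hN k (C.I (k + 2) X)
  have h2 := C.sig_xi_succ_succ hN k (C.I (k + 1) X)
  have h3 := C.I_skew (k + 2) (C.I (k + 1) (C.hh k)) X
  have h4 := C.I_skew (k + 1) (C.I (k + 2) (C.hh k)) X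
  have e1 : C.I (k + 2) (C.I (k + 1) (C.hh k)) = sg A k • C.I k (C.hh k) :=
    LinearMap.congr_fun (C.I_mul5 k) _
  have e2 : C.I (k + 1) (C.I (k + 2) (C.hh k)) = -sg A k • C.I k (C.hh k) :=
    LinearMap.congr_fun (C.I_mul4 k) _
  rw [e1, map_smul, LinearMap.smul_apply, smul_eq_mul] at h3
  rw [e2, map_smul, LinearMap.smul_apply, smul_eq_mul] at h4
  rw [sum_cyclic _ k, I_sq_apply, I_mul_apply, I_mul_apply'', map_smul, map_smul, map_smul,
    (C.isLinearMap_sig_right k _).map_smul, (C.isLinearMap_sig_right k _).map_smul,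
    (C.isLinearMap_sig_right k _).map_smul, C.sig_swap k (C.xi k), C.sig_swap k (C.xi (k + 1)),
    C.sig_swap k (C.xi (k + 2)), h1, h2]
  simp only [smul_eq_mul]
  linear_combination (-C.sig k (C.inc X) (C.xi k) - 4 * C.g (C.I k (C.hh k)) X) *
    sg_mul_self (A := A) k
    + (-2 * C.g (C.I (k + 1) (C.hh k)) (C.I (k + 2) X) +
      2 * C.g (C.I (k + 2) (C.hh k)) (C.I (k + 1) X)) * sg_mul_sg' (A := A) k
    + 2 * sg A k * h3 - 2 * sg A k * h4

lemma sum_sig_tor (k : Fin 3) (X : H) :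
    ∑ a, C.sig k (C.tor (C.inc X) (C.inc (C.e a))) (C.inc (C.I k (C.e' a))) =
      -(2 * ∑ s, sg A s * C.sig k (C.xi s) (C.inc (C.I k (C.I s X)))) ∧
    ∑ a, C.sig k (C.tor (C.inc (C.e a)) (C.inc (C.I k (C.e' a)))) (C.inc X) =
      2 * N * C.sig k (C.xi k) (C.inc X) ∧
    ∑ a, C.sig k (C.tor (C.inc (C.I k (C.e' a))) (C.inc X)) (C.inc (C.e a)) =
      -(2 * ∑ s, sg A s * C.sig k (C.xi s) (C.inc (C.I k (C.I s X)))) := by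
  have h : ∀ X Y Z, C.sig k (C.tor (C.inc X) (C.inc Y)) Z =
      -(2 * ∑ s, sg A s * (C.g (C.I s X) Y * C.sig k (C.xi s) Z)) := by
    intro X Y Z
    have := ((C.isLinearMap_sig_left k Z).mk' _).map_neg
    rw [tor_inc]
    change (C.isLinearMap_sig_left k Z).mk' _ _ = _
    rw [map_neg, map_sum, Finset.mul_sum]
    congr 1
    refine Finset.sum_congr rfl fun s _ => ?_
    rw [map_smul, IsLinearMap.mk'_apply, smul_eq_mul]
    ring
  have hl : ∀ s, IsLinearMap A fun V : H => C.sig k (C.xi s) (C.inc V) := fun s =>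
    ⟨fun _ _ => by rw [map_add, (C.isLinearMap_sig_right k _).map_add],
      fun _ _ => by rw [map_smul, (C.isLinearMap_sig_right k _).map_smul]⟩
  have hl' : ∀ s, IsLinearMap A fun V : H => C.sig k (C.xi s) (C.inc (C.I k V)) := fun s =>
    ⟨fun _ _ => by rw [map_add, map_add, (C.isLinearMap_sig_right k _).map_add],
      fun _ _ => by rw [map_smul, map_smul, (C.isLinearMap_sig_right k _).map_smul]⟩
  simp only [h, Finset.sum_neg_distrib, ← Finset.mul_sum]
  refine ⟨?_, ?_, ?_⟩
  · rw [Finset.sum_comm]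
    simp only [← Finset.mul_sum]
    congr 2
    refine Finset.sum_congr rfl fun s _ => ?_
    rw [← C.contract (hl' s)]
  · rw [Finset.sum_comm]
    simp only [← Finset.mul_sum, ← Finset.sum_mul, sum_g_I_I]
    rw [Finset.sum_eq_single k (fun s _ hs => by simp [hs.symm]) (by simp), if_pos rfl]
    linear_combination 2 * N * C.sig k (C.xi k) (C.inc X) * sg_mul_self (A := A) k
  · rw [Finset.sum_comm]
    simp only [← Finset.mul_sum]
    congr 2
    refine Finset.sum_congr rfl fun s _ => ?_
    rw [← C.contract' (hl s)]
    congr 1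
    refine Finset.sum_congr rfl fun a _ => ?_
    rw [C.I_skew s, C.I_skew k, neg_neg, C.g_symm]

/-- Second relation between the divergences of `τ` and `μ` and the differential of `Λ`. -/
lemma div_Phi (hN : 4 < N) (X : H) :
    2 * C.div C.Phi X = 6 * N * C.d (C.inc X) C.Lam
      - (N - 2) * (3 * C.d (C.inc X) C.Lam - 2 * C.B X) - 16 * C.B X := by
  have hN0 : N ≠ 0 := by omega
  -- Second Bianchi identity on (X, e_a, I_k e'_a), traced against I_k and summed over the frame.
  -- The sums over k of the derivative terms are the two preceding contractions.
  have hb : ∀ k, ∑ a, (C.tr (C.nabCurH (C.inc X) (C.inc (C.e a)) (C.inc (C.I k (C.e' a))) * C.I k)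
      + C.tr (C.nabCurH (C.inc (C.e a)) (C.inc (C.I k (C.e' a))) (C.inc X) * C.I k)
      + C.tr (C.nabCurH (C.inc (C.I k (C.e' a))) (C.inc X) (C.inc (C.e a)) * C.I k)
      + (C.tr (C.curH (C.tor (C.inc X) (C.inc (C.e a))) (C.inc (C.I k (C.e' a))) * C.I k)
      + C.tr (C.curH (C.tor (C.inc (C.e a)) (C.inc (C.I k (C.e' a)))) (C.inc X) * C.I k)
      + C.tr (C.curH (C.tor (C.inc (C.I k (C.e' a))) (C.inc X)) (C.inc (C.e a)) * C.I k))) =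
      0 := by
    intro k
    refine Finset.sum_eq_zero fun a _ => ?_
    have := congrArg (fun P => C.tr (P * C.I k))
      (C.second_bianchi_curH (C.inc X) (C.inc (C.e a)) (C.inc (C.I k (C.e' a))))
    simp only [add_mul, map_add, zero_mul, map_zero] at this
    linear_combination this
  -- The three torsion terms by `sum_sig_tor`: the first and third agree, and the second supplies
  -- the factor N, since T(e_a, I_k e'_a) contracts to a multiple of ξ_k.
  have hs : ∀ k, 2 * ∑ a, (C.tr (C.curH (C.tor (C.inc X) (C.inc (C.e a)))
        (C.inc (C.I k (C.e' a))) * C.I k)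
      + C.tr (C.curH (C.tor (C.inc (C.e a)) (C.inc (C.I k (C.e' a)))) (C.inc X) * C.I k)
      + C.tr (C.curH (C.tor (C.inc (C.I k (C.e' a))) (C.inc X)) (C.inc (C.e a)) * C.I k)) =
      sg A k * N * ((4 - 2 * N) * C.sig k (C.inc X) (C.xi k)
        + 16 * C.g (C.I k (C.hh k)) X) := by
    intro k
    obtain ⟨t1, t2, t3⟩ := C.sum_sig_tor k X
    rw [C.sum_sig_xi_I hN] at t1 t3
    simp only [Finset.mul_sum, mul_add, C.tr_curH_mul_I hN0, Finset.sum_add_distrib]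
    simp only [← Finset.mul_sum]
    rw [t1, t2, t3, C.sig_swap k (C.xi k)]
    ring
  have hf := Finset.sum_congr rfl fun k (_ : k ∈ Finset.univ) =>
    congrArg (2 * sg A k * ·) (hb k)
  have hs' := Finset.sum_congr rfl fun k (_ : k ∈ Finset.univ) => congrArg (sg A k * ·) (hs k)
  have hs2 : ∀ k, sg A k * (sg A k * N * ((4 - 2 * N) * C.sig k (C.inc X) (C.xi k)
      + 16 * C.g (C.I k (C.hh k)) X)) = N * ((4 - 2 * N) * C.sig k (C.inc X) (C.xi k)
      + 16 * C.g (C.I k (C.hh k)) X) := by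
    intro k
    linear_combination (N * ((4 - 2 * N) * C.sig k (C.inc X) (C.xi k)
      + 16 * C.g (C.I k (C.hh k)) X)) * sg_mul_self (A := A) k
  simp only [hs2] at hs'
  simp only [← Finset.mul_sum, Finset.sum_add_distrib, mul_zero, Finset.sum_const_zero,
    mul_add, mul_assoc, mul_left_comm (sg A _) (2 : A)] at hf hs'
  have k1 := C.sum_tr_nabCurH_frame hN (C.inc X)
  have k2 := C.sum_tr_nabCurH_div hN X
  have k3 := C.two_mul_sum_sig_xi hN X
  refine sub_eq_zero.1 (eq_zero_of_natCast_mul hN0 ?_)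
  rw [B] at k3 ⊢
  linear_combination hf - hs' - 2 * k1 - 2 * k2 - N * (2 - N) * k3

end ContactAlgebra

end PQC

end

noncomputable section

namespace PQC

namespace ContactAlgebra

variable {N : ℕ} {A L H : Type*} [CommRing A] [Algebra ℝ A] [AddCommGroup L]
    [Module A L] [AddCommGroup H] [Module A H] (C : ContactAlgebra N A L H)

/-! ### The contracted second Bianchi identity -/

lemma adj_tau2 (hN : 4 < N) : C.adj C.tau2 = C.tau2 := by
  have h : ∀ s, C.adj (C.P s * C.I s) = C.P s * C.I s := by
    intro s
    rw [adj_mul, adj_I, P, adj_add, adj_adj, add_comm, ← P, neg_mul, C.I_mul_P hN, neg_neg]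
  rw [tau2, adj_neg, Fin.sum_univ_three, adj_add, adj_add]
  simp only [adj_smul, h]

/-- Since τ is symmetric, its divergence may be taken in either slot. The first relation produces
one form and the second relation the other. -/
lemma div_tau2 (hN : 4 < N) (X : H) :
    C.div C.tau2 X = ∑ a, C.g (C.covEnd (C.inc (C.e a)) C.tau2 X) (C.e' a) := by
  refine Finset.sum_congr rfl fun a _ => ?_
  rw [C.g_symm, ← g_adj, adj_covEnd, C.adj_tau2 hN]

lemma div_Phi_eq (X : H) :
    C.div C.Phi X = 6 * C.d (C.inc X) C.Lam + C.div C.tau2 X + 6 * C.div (C.U 0) X := by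
  have h6 : ∀ Z, C.d Z (6 : A) = 0 := fun Z => by simpa using (C.d Z).map_natCast 6
  have h := C.contract' (F := fun V => C.d (C.inc V) C.Lam)
    ⟨fun _ _ => by simp, fun _ _ => by simp⟩ X
  simp only [C.g_symm X] at h
  simp only [div, Phi, covEnd_add, covEnd_smul, covEnd_one, smul_zero, add_zero, h6, zero_smul,
    zero_add, Derivation.leibniz, smul_eq_mul, mul_zero, LinearMap.add_apply,
    LinearMap.smul_apply, Module.End.one_apply, map_add, map_smul, Finset.sum_add_distrib,
    ← Finset.mul_sum]
  rw [← h, Finset.mul_sum]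
  simp only [mul_assoc, mul_comm (C.d _ _), ← Finset.mul_sum]

theorem scal_eq (hN : 4 < N) {n : ℕ} (hn : N = 4 * n) : C.scal = 8 * n * (n + 2) * C.Lam := by
  have h := C.two_mul_scal hN
  refine sub_eq_zero.1 (eq_zero_of_two_mul ?_)
  have hc : (N : A) = 4 * n := by rw [hn, Nat.cast_mul, Nat.cast_ofNat]
  rw [hc] at h
  linear_combination h

theorem contracted_bianchi (hN : 4 < N) {n : ℕ} (hn : N = 4 * n) (i : Fin 3) (X : H) :
    (n - 1) * C.div C.tau2 X + 2 * (n + 2) * C.div (C.U i) X =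
      2 * (n - 1) * (2 * n + 1) * C.d (C.inc X) C.Lam := by
  have h1 := C.four_mul_div_tau2 hN X
  have h2 := C.div_Phi hN X
  rw [C.div_Phi_eq] at h2
  have hc : (N : A) = 4 * n := by rw [hn, Nat.cast_mul, Nat.cast_ofNat]
  rw [← C.div_tau2 hN, hc] at h1
  rw [hc] at h2
  rw [C.U_eq hN i 0]
  refine sub_eq_zero.1 (eq_zero_of_natCast_mul (N := 12) (by norm_num) ?_)
  push_cast
  -- With N = 4n, B has coefficient 4(2n - 5) in the second relation and -8(n + 2) in the first.
  -- These multipliers remove it, and 12 divides all remaining coefficients.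
  linear_combination (2 * n + 4) * h2 + (2 * n - 5) * h1

end ContactAlgebra

end PQC

end

noncomputable section

namespace PQC

/-! ## Calculus of smooth fields -/

section Calculus

variable {n : ℕ} {M : Type*} [TopologicalSpace M] [ChartedSpace (Model n) M]

/-- The function `f` is smooth at `x`. -/
abbrev SmoothFunAt (n : ℕ) {M : Type*} [TopologicalSpace M] [ChartedSpace (Model n) M] (f : M → ℝ)
    (x : M) : Prop :=
  ContMDiffAt (𝓡 (4 * n + 3)) 𝓘(ℝ, ℝ) ∞ f x

lemma dFun_congr {f f' : M → ℝ} {x : M} (h : f =ᶠ[nhds x] f') (v : Tan n x) :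
    dFun f x v = dFun f' x v := by
  simp only [dFun, mvfderiv, h.mfderiv_eq]
  rw [h.eq_of_nhds]

lemma dFun_add {f f' : M → ℝ} {x : M} (hf : SmoothFunAt n f x) (hf' : SmoothFunAt n f' x)
    (v : Tan n x) : dFun (f + f') x v = dFun f x v + dFun f' x v := by
  rw [dFun, mvfderiv_add (hf.mdifferentiableAt (by simp)) (hf'.mdifferentiableAt (by simp))]
  rfl

lemma dFun_mul {f f' : M → ℝ} {x : M} (hf : SmoothFunAt n f x) (hf' : SmoothFunAt n f' x)
    (v : Tan n x) : dFun (f * f') x v = f x * dFun f' x v + f' x * dFun f x v := by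
  rw [dFun, mvfderiv_mul (hf.mdifferentiableAt (by simp)) (hf'.mdifferentiableAt (by simp))]
  rfl

lemma dFun_const (c : ℝ) (x : M) (v : Tan n x) : dFun (fun _ : M => c) x v = 0 := by
  rw [dFun, mvfderiv_const]
  rfl

lemma dFun_add_right (f : M → ℝ) (x : M) (v w : Tan n x) :
    dFun f x (v + w) = dFun f x v + dFun f x w := map_add _ _ _

lemma dFun_smul_right (f : M → ℝ) (x : M) (c : ℝ) (v : Tan n x) :
    dFun f x (c • v) = c * dFun f x v := map_smul _ _ _

lemma mlieBracket_congr {X X' Y Y' : Π y : M, Tan n y} {x : M} (hX : X =ᶠ[nhds x] X')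
    (hY : Y =ᶠ[nhds x] Y') :
    mlieBracket (𝓡 (4 * n + 3)) X Y x = mlieBracket (𝓡 (4 * n + 3)) X' Y' x :=
  Filter.EventuallyEq.mlieBracket_vectorField_eq hX hY

variable [IsManifold (𝓡 (4 * n + 3)) ∞ M]

lemma SmoothAt.diffAt {X : Π x : M, Tan n x} {x : M} (h : SmoothAt X x) : DiffAt X x :=
  h.mdifferentiableAt (by simp)

lemma SmoothAt.congr {X Y : Π x : M, Tan n x} {x : M} (h : SmoothAt X x)
    (hXY : ∀ᶠ y in nhds x, Y y = X y) : SmoothAt Y x :=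
  ContMDiffAt.congr_of_eventuallyEq h (hXY.mono fun y hy => by simp only [hy])

lemma SmoothAt.add {X Y : Π x : M, Tan n x} {x : M} (hX : SmoothAt X x) (hY : SmoothAt Y x) :
    SmoothAt (X + Y) x :=
  ContMDiffAt.add_section hX hY

lemma SmoothAt.smul {X : Π x : M, Tan n x} {x : M} {f : M → ℝ} (hf : SmoothFunAt n f x)
    (hX : SmoothAt X x) : SmoothAt (f • X) x :=
  ContMDiffAt.smul_section hf hX

lemma smoothAt_zero (x : M) : SmoothAt (fun _ => 0 : Π x : M, Tan n x) x :=
  (contMDiff_zeroSection _ _).contMDiffAt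

lemma SmoothAt.mlieBracket {X Y : Π x : M, Tan n x} {x : M} (hX : SmoothAt X x)
    (hY : SmoothAt Y x) : SmoothAt (mlieBracket (𝓡 (4 * n + 3)) X Y) x :=
by
  have : IsManifold (𝓡 (4 * n + 3)) (minSmoothness ℝ 2) M := IsManifold.of_le (n := ∞) (by
    rw [minSmoothness_of_isRCLikeNormedField]
    exact ENat.LEInfty.out)
  have : IsManifold (𝓡 (4 * n + 3)) (((⊤ : ℕ∞) : WithTop ℕ∞) + 1) M :=
    inferInstanceAs (IsManifold (𝓡 (4 * n + 3)) ∞ M)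
  exact ContMDiffAt.mlieBracket_vectorField (n := ⊤) (m := ⊤) hX hY (by simp)

lemma SmoothFormOn.apply {θ : Π x : M, Tan n x →L[ℝ] ℝ} {U : Set M} (hθ : SmoothFormOn θ U)
    {x : M} (hU : U ∈ nhds x) {X : Π x : M, Tan n x} (hX : SmoothAt X x) :
    SmoothFunAt n (fun y => θ y (X y)) x := by
  have h := ContMDiffAt.clm_bundle_apply (E₂ := Bundle.Trivial M ℝ) (hθ.contMDiffAt hU) hX
  rw [contMDiffAt_section] at h
  exact h

/-- A bump function supported where X is smooth makes X globally smooth without changing its germ at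
x. -/
lemma exists_cutoff [T2Space M] {x : M} {X : Π x : M, Tan n x}
    (hX : ∀ᶠ y in nhds x, SmoothAt X y) :
    ∃ f : M → ℝ, (∀ᶠ y in nhds x, f y = 1) ∧ ∀ y, SmoothAt (f • X) y := by
  obtain ⟨W, hW, hWo, hxW⟩ := eventually_nhds_iff.1 hX
  have : LocallyCompactSpace M := ChartedSpace.locallyCompactSpace (Model n) M
  obtain ⟨f, hf, hs⟩ := (SmoothBumpFunction.nhds_basis_tsupport (I := 𝓡 (4 * n + 3)) x).mem_iff.1
    (hWo.mem_nhds hxW)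
  have hs' : ContMDiff (𝓡 (4 * n + 3)) (𝓡 (4 * n + 3)).tangent ∞
      (fun y => (⟨y, ((f : M → ℝ) • X) y⟩ : TangentBundle (𝓡 (4 * n + 3)) M)) :=
    ContMDiffOn.smul_section_of_tsupport f.contMDiff.contMDiffOn hWo hs
      fun y hy => (hW y hy).contMDiffWithinAt
  exact ⟨f, f.eventuallyEq_one, fun y => hs'.contMDiffAt⟩

/-- Smoothness of a connection is a statement about globally smooth sections. Cutting Y off reduces
the local claim to that, because a connection depends only on germs. -/
lemma smoothAt_connection {D : Connection n M} (hD : D.ContMDiffCovariantDerivative ∞) {x : M}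
    [T2Space M] {X Y : Π x : M, Tan n x} (hX : SmoothAt X x) (hY : ∀ᶠ y in nhds x, SmoothAt Y y) :
    SmoothAt (fun y => D Y y (X y)) x := by
  obtain ⟨f, hf, hs⟩ := exists_cutoff hY
  have h1 := hD.contMDiff.contMDiff (σ := f • Y) fun y _ => (hs y).contMDiffWithinAt
  have h2 := ContMDiffAt.clm_bundle_apply (h1.contMDiffAt Filter.univ_mem) hX
  refine SmoothAt.congr h2 ?_
  have he : ∀ᶠ y in nhds x, (f • Y) y = Y y := hf.mono fun y hy => by
    simp [hy]
  filter_upwards [he.eventually_nhds, hY] with y hy hyW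
  rw [D.isCovariantDerivativeOnUniv.congr_of_eventuallyEq (SmoothAt.diffAt hyW)
    (SmoothAt.diffAt (hs y)) Filter.univ_mem (hy.mono fun _ h => h.symm)]

end Calculus

end PQC

end

noncomputable section

namespace PQC

open TopologicalSpace (Opens)

/-! ## Smooth functions and fields on an open set -/

section ExtendByZero

variable {M : Type*} [TopologicalSpace M] {W : Opens M} {E : M → Type*}

open Classical in
/-- Extension of a section on `W` by zero. -/
def ext0 [∀ y, Zero (E y)] (f : Π y : W, E y) (y : M) : E y :=
  if h : y ∈ W then f ⟨y, h⟩ else 0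

lemma ext0_apply [∀ y, Zero (E y)] (f : Π y : W, E y) (y : W) : ext0 f y = f y := by
  simp [ext0]

/-- Near a point of the open set W the extension equals the original section. Brackets, derivatives
and connections are local, so the value zero outside W never matters. -/
lemma ext0_restrict [∀ y, Zero (E y)] (F : Π y, E y) (y : W) :
    ∀ᶠ z in nhds (y : M), ext0 (fun z : W => F z) z = F z := by
  filter_upwards [W.isOpen.mem_nhds y.2] with z hz
  exact ext0_apply (fun z : W => F z) ⟨z, hz⟩

lemma ext0_add [∀ y, AddMonoid (E y)] (f f' : Π y : W, E y) :
    ext0 (f + f') = ext0 f + ext0 f' := by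
  ext y
  by_cases h : y ∈ W <;> simp [ext0, h]

lemma ext0_smul [∀ y, AddMonoid (E y)] [∀ y, DistribMulAction ℝ (E y)] (a : W → ℝ)
    (f : Π y : W, E y) (y : M) :
    ext0 (fun y : W => a y • f y) y = ext0 (E := fun _ => ℝ) a y • ext0 f y := by
  by_cases h : y ∈ W <;> simp [ext0, h]

lemma ext0_mul (a b : W → ℝ) :
    ext0 (E := fun _ => ℝ) (a * b) = ext0 (E := fun _ => ℝ) a * ext0 (E := fun _ => ℝ) b := by
  ext y
  by_cases h : y ∈ W <;> simp [ext0, h]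

end ExtendByZero

section Rings

variable (n : ℕ) {M : Type*} [TopologicalSpace M] [ChartedSpace (Model n) M]

/-- The algebra of smooth functions on `W`, as a subalgebra of the algebra of all functions. -/
def smoothSubalgebra (W : Opens M) : Subalgebra ℝ (W → ℝ) where
  carrier := {f | ∀ y : W, SmoothFunAt n (ext0 (E := fun _ => ℝ) f) y}
  mul_mem' {f f'} hf hf' y := by
    rw [ext0_mul]
    exact (hf y).mul (hf' y)
  add_mem' {f f'} hf hf' y := by
    rw [ext0_add]
    exact (hf y).add (hf' y)
  algebraMap_mem' r y :=
    (contMDiffAt_const (c := r)).congr_of_eventuallyEq (ext0_restrict (fun _ => r) y)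

/-- The algebra of smooth functions on `W`. -/
def SmoothFun (W : Opens M) : Type _ := smoothSubalgebra n W

instance (W : Opens M) : CommRing (SmoothFun n W) :=
  inferInstanceAs (CommRing (smoothSubalgebra n W))

instance (W : Opens M) : Algebra ℝ (SmoothFun n W) :=
  inferInstanceAs (Algebra ℝ (smoothSubalgebra n W))

variable {n} {W : Opens M}

/-- A smooth function on `W` as a function on `M`. -/
def fn (f : SmoothFun n W) : M → ℝ := ext0 (E := fun _ => ℝ) f.1

lemma smooth_fn (f : SmoothFun n W) (y : W) : SmoothFunAt n (fn f) y := f.2 y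

lemma fn_apply (f : SmoothFun n W) (y : W) : fn f y = f.1 y := ext0_apply _ y

lemma fn_add (f f' : SmoothFun n W) : fn (f + f') = fn f + fn f' :=
  ext0_add (E := fun _ => ℝ) f.1 f'.1

lemma fn_mul (f f' : SmoothFun n W) : fn (f * f') = fn f * fn f' := ext0_mul f.1 f'.1

lemma fn_algebraMap (r : ℝ) (y : W) : fn (algebraMap ℝ (SmoothFun n W) r) y = r :=
  fn_apply _ y

lemma fn_zero : fn (0 : SmoothFun n W) = 0 := by
  have h : fn (0 : SmoothFun n W) + fn (0 : SmoothFun n W) = fn (0 : SmoothFun n W) := by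
    rw [← fn_add, add_zero]
  exact left_eq_add.1 h.symm

lemma fn_sub (f f' : SmoothFun n W) : fn (f - f') = fn f - fn f' := by
  rw [eq_sub_iff_add_eq, ← fn_add, sub_add_cancel]

/-- The restriction to `W` of a function that is smooth on `W`. -/
def mkFn (F : M → ℝ) (hF : ∀ y : W, SmoothFunAt n F y) : SmoothFun n W :=
  ⟨fun y => F y, fun y => (hF y).congr_of_eventuallyEq (ext0_restrict F y)⟩

lemma fn_mkFn (F : M → ℝ) (hF : ∀ y : W, SmoothFunAt n F y) (y : W) :
    fn (mkFn F hF) =ᶠ[nhds (y : M)] F := ext0_restrict F y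

lemma ext_fn {f f' : SmoothFun n W} (h : ∀ y : W, fn f y = fn f' y) : f = f' :=
  Subtype.ext (funext fun y => by rw [← fn_apply, ← fn_apply, h])

variable [IsManifold (𝓡 (4 * n + 3)) ∞ M]

variable (n W) in
/-- The group of smooth vector fields on `W`, as a subgroup of the group of all fields. -/
def fieldsSubgroup : AddSubgroup (Π y : W, Tan n (y : M)) where
  carrier := {X | ∀ y : W, SmoothAt (ext0 X) y}
  add_mem' {X Y} hX hY y := by
    rw [ext0_add]
    exact (hX y).add (hY y)
  zero_mem' y := (smoothAt_zero _).congr (ext0_restrict (fun _ => 0) y)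
  neg_mem' {X} hX y := by
    refine ((hX y).smul (contMDiffAt_const (c := (-1 : ℝ)))).congr
      (Filter.Eventually.of_forall fun z => ?_)
    by_cases h : z ∈ W <;> simp [ext0, h]

variable (n W) in
/-- The module of smooth vector fields on `W`. -/
def Fields : Type _ := fieldsSubgroup n W

instance : AddCommGroup (Fields n W) := inferInstanceAs (AddCommGroup (fieldsSubgroup n W))

instance : Module (SmoothFun n W) (Fields n W) where
  smul f X := ⟨fun y => f.1 y • X.1 y, fun y =>
    (SmoothAt.smul (smooth_fn f y) (X.2 y)).congr (Filter.Eventually.of_forall fun z =>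
      ext0_smul f.1 X.1 z)⟩
  one_smul X := Subtype.ext (funext fun y => one_smul ℝ (X.1 y))
  mul_smul f f' X := Subtype.ext (funext fun y => mul_smul (f.1 y) (f'.1 y) (X.1 y))
  smul_zero f := Subtype.ext (funext fun y => smul_zero (f.1 y))
  smul_add f X Y := Subtype.ext (funext fun y => smul_add (f.1 y) (X.1 y) (Y.1 y))
  add_smul f f' X := Subtype.ext (funext fun y => add_smul (f.1 y) (f'.1 y) (X.1 y))
  zero_smul X := Subtype.ext (funext fun y => zero_smul ℝ (X.1 y))

/-- A smooth field on `W` as a field on `M`. -/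
def fld (X : Fields n W) : Π y : M, Tan n y := ext0 X.1

lemma smooth_fld (X : Fields n W) (y : W) : SmoothAt (fld X) y := X.2 y

lemma eventually_smooth_fld (X : Fields n W) (y : W) :
    ∀ᶠ z in nhds (y : M), SmoothAt (fld X) z := by
  filter_upwards [W.isOpen.mem_nhds y.2] with z hz
  exact X.2 ⟨z, hz⟩

lemma fld_add (X Y : Fields n W) : fld (X + Y) = fld X + fld Y := ext0_add X.1 Y.1

lemma fld_smul (f : SmoothFun n W) (X : Fields n W) : fld (f • X) = fn f • fld X :=
  funext fun y => ext0_smul f.1 X.1 y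

lemma fld_zero : fld (0 : Fields n W) = 0 := by
  have h : fld (0 : Fields n W) + fld (0 : Fields n W) = fld (0 : Fields n W) := by
    rw [← fld_add, add_zero]
  exact left_eq_add.1 h.symm

lemma fld_neg (X : Fields n W) : fld (-X) = -fld X :=
  eq_neg_of_add_eq_zero_left (by rw [← fld_add, neg_add_cancel, fld_zero])

lemma fld_sub (X Y : Fields n W) : fld (X - Y) = fld X - fld Y := by
  rw [sub_eq_add_neg, fld_add, fld_neg, sub_eq_add_neg]

/-- The restriction to `W` of a field that is smooth on `W`. -/
def mkFld (F : Π y : M, Tan n y) (hF : ∀ y : W, SmoothAt F y) : Fields n W :=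
  ⟨fun y => F y, fun y => (hF y).congr (ext0_restrict F y)⟩

lemma fld_mkFld (F : Π y : M, Tan n y) (hF : ∀ y : W, SmoothAt F y) (y : W) :
    fld (mkFld F hF) =ᶠ[nhds (y : M)] F := ext0_restrict F y

lemma ext_fld {X Y : Fields n W} (h : ∀ y : W, fld X y = fld Y y) : X = Y :=
  Subtype.ext (funext fun y => by simpa [fld, ext0_apply] using h y)

/-! ### Derivations, the Lie bracket and the connection -/

/-- The Lie bracket. -/
def bracket (X Y : Fields n W) : Fields n W :=
  mkFld (mlieBracket (𝓡 (4 * n + 3)) (fld X) (fld Y)) fun y =>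
    SmoothAt.mlieBracket (smooth_fld X y) (smooth_fld Y y)

lemma fld_bracket (X Y : Fields n W) (y : W) :
    fld (bracket X Y) =ᶠ[nhds (y : M)] mlieBracket (𝓡 (4 * n + 3)) (fld X) (fld Y) :=
  fld_mkFld _ _ y

lemma bracket_apply (X Y : Fields n W) (y : W) :
    fld (bracket X Y) y = mlieBracket (𝓡 (4 * n + 3)) (fld X) (fld Y) y :=
  (fld_bracket X Y y).eq_of_nhds

lemma bracket_skew (X Y : Fields n W) : bracket X Y = -bracket Y X :=
  ext_fld fun y => by
    rw [fld_neg, Pi.neg_apply, bracket_apply, bracket_apply, mlieBracket_swap, Pi.neg_apply]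

lemma bracket_add_right (X Y Z : Fields n W) :
    bracket X (Y + Z) = bracket X Y + bracket X Z := by
  have : IsManifold (𝓡 (4 * n + 3)) 2 M := IsManifold.of_le (n := ∞) ENat.LEInfty.out
  refine ext_fld fun y => ?_
  rw [fld_add, Pi.add_apply, bracket_apply, bracket_apply, bracket_apply, fld_add,
    mlieBracket_add_right (smooth_fld Y y).diffAt (smooth_fld Z y).diffAt]

lemma bracket_jacobi (X Y Z : Fields n W) :
    bracket X (bracket Y Z) = bracket (bracket X Y) Z + bracket Y (bracket X Z) := by
  have : IsManifold (𝓡 (4 * n + 3)) (minSmoothness ℝ 3) M := IsManifold.of_le (n := ∞) (by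
    rw [minSmoothness_of_isRCLikeNormedField]
    exact ENat.LEInfty.out)
  have h : ∀ (X : Fields n W) (y : W), ContMDiffAt (𝓡 (4 * n + 3)) (𝓡 (4 * n + 3)).tangent
      (minSmoothness ℝ 2) (fun z => (⟨z, fld X z⟩ : TangentBundle (𝓡 (4 * n + 3)) M)) y :=
    fun X y => (smooth_fld X y).of_le (by
      rw [minSmoothness_of_isRCLikeNormedField]
      exact ENat.LEInfty.out)
  refine ext_fld fun y => ?_
  rw [fld_add, Pi.add_apply, bracket_apply, bracket_apply, bracket_apply,
    mlieBracket_congr (.of_forall fun _ => rfl) (fld_bracket Y Z y),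
    mlieBracket_congr (fld_bracket X Y y) (.of_forall fun _ => rfl),
    mlieBracket_congr (.of_forall fun _ => rfl) (fld_bracket X Z y)]
  exact leibniz_identity_mlieBracket_apply (h X y) (h Y y) (h Z y)

lemma bracket_smul_apply (X : Fields n W) (f : SmoothFun n W) (Y : Fields n W) (y : W) :
    fld (bracket X (f • Y)) y = dFun (fn f) y (fld X y) • fld Y y + fn f y • fld (bracket X Y) y := by
  have : IsManifold (𝓡 (4 * n + 3)) 2 M := IsManifold.of_le (n := ∞) ENat.LEInfty.out
  rw [bracket_apply, bracket_apply, fld_smul,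
    mlieBracket_smul_right ((smooth_fn f y).mdifferentiableAt (by simp)) (smooth_fld Y y).diffAt]
  rfl

/-- The covariant derivative of smooth fields on `W`. -/
def connect [T2Space M] {D : Connection n M} (hD : D.ContMDiffCovariantDerivative ∞)
    (X Y : Fields n W) : Fields n W :=
  mkFld (fun y => D (fld Y) y (fld X y)) fun y =>
    smoothAt_connection hD (smooth_fld X y) (eventually_smooth_fld Y y)

lemma fld_connect [T2Space M] {D : Connection n M} (hD : D.ContMDiffCovariantDerivative ∞)
    (X Y : Fields n W) (y : W) :
    fld (connect hD X Y) =ᶠ[nhds (y : M)] fun y => D (fld Y) y (fld X y) :=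
  fld_mkFld _ _ y

lemma connect_apply [T2Space M] {D : Connection n M} (hD : D.ContMDiffCovariantDerivative ∞)
    (X Y : Fields n W) (y : W) : fld (connect hD X Y) y = D (fld Y) y (fld X y) :=
  (fld_connect hD X Y y).eq_of_nhds

lemma connection_congr {D : Connection n M} {X Y : Π y : M, Tan n y} {x : M} (hX : SmoothAt X x)
    (h : Y =ᶠ[nhds x] X) : D Y x = D X x :=
  D.isCovariantDerivativeOnUniv.congr_of_eventuallyEq (hX.congr (h.mono fun _ h => h)).diffAt
    hX.diffAt Filter.univ_mem h

end Rings

end PQC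

end

noncomputable section

namespace PQC

open TopologicalSpace (Opens)

/-- A family with a dual family is linearly independent; with as many members as the dimension it is
a basis, whose coordinates are read off by the dual family. -/
lemma sum_dual_smul {E : Type*} [AddCommGroup E] [Module ℝ E] [FiniteDimensional ℝ E]
    {g : LinearMap.BilinForm ℝ E} {ι : Type*} [Fintype ι] [DecidableEq ι] {e e' : ι → E}
    (h : ∀ a b, g (e a) (e' b) = if a = b then 1 else 0)
    (hc : Fintype.card ι = Module.finrank ℝ E) (v : E) : ∑ a, g v (e' a) • e a = v := by
  have hli : LinearIndependent ℝ e := by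
    rw [Fintype.linearIndependent_iff]
    intro c hc b
    have h' := congrArg (fun u => g u (e' b)) hc
    simpa [h] using h'
  let B := basisOfLinearIndependentOfCardEqFinrank' e hli hc
  have hB : ∀ a, B a = e a := fun a => by simp [B]
  have h' : ∀ a, g v (e' a) = B.repr v a := by
    intro a
    conv_lhs => rw [← B.sum_repr v]
    simp [hB, h]
  conv_rhs => rw [← B.sum_repr v]
  simp only [h', hB]

/-! ## Local frames of a paraquaternionic contact manifold -/

section Patch

variable {n : ℕ} {M : Type*} [TopologicalSpace M] [ChartedSpace (Model n) M]
  [IsManifold (𝓡 (4 * n + 3)) ∞ M]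

lemma projH_coe {S : PQCStructure n M} {V : Π x : M, Submodule ℝ (Tan n x)}
    (hV : IsVertical S V) (x : M) (v : S.H x) : projH S hV x (v : Tan n x) = v :=
  Submodule.projectionOnto_apply_left _ v

lemma projH_eq_zero {S : PQCStructure n M} {V : Π x : M, Submodule ℝ (Tan n x)}
    (hV : IsVertical S V) {x : M} {v : Tan n x} : projH S hV x v = 0 ↔ v ∈ V x :=
  Submodule.projectionOnto_apply_eq_zero_iff _

/-- The projection along V is only given pointwise; this formula in terms of the forms and their
dual vertical fields is what makes it smooth. -/
lemma coe_projH {S : PQCStructure n M} {V : Π x : M, Submodule ℝ (Tan n x)} (hV : IsVertical S V)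
    {x : M} {θ : Fin 3 → Tan n x →L[ℝ] ℝ} {ζ : Fin 3 → Tan n x}
    (hθ : ∀ v, v ∈ S.H x ↔ ∀ s, θ s v = 0) (hζ : ∀ s, ζ s ∈ V x)
    (hθζ : ∀ s t, θ s (ζ t) = if s = t then 1 else 0) (v : Tan n x) :
    (projH S hV x v : Tan n x) = v - ∑ s, θ s v • ζ s := by
  have h1 : v - ∑ s, θ s v • ζ s ∈ S.H x := by
    rw [hθ]
    intro s
    simp [hθζ]
  have h2 : ∑ s, θ s v • ζ s ∈ V x :=
    Submodule.sum_mem _ fun s _ => Submodule.smul_mem _ _ (hζ s)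
  have h3 : projH S hV x v = projH S hV x (v - ∑ s, θ s v • ζ s) := by
    rw [map_sub, (projH_eq_zero hV).2 h2, sub_zero]
  rw [h3]
  exact congrArg Subtype.val (projH_coe hV x ⟨_, h1⟩)

lemma SmoothAt.projH {S : PQCStructure n M} {V : Π x : M, Submodule ℝ (Tan n x)}
    (hV : IsVertical S V) {U : Set M} {η : Fin 3 → Π x : M, Tan n x →L[ℝ] ℝ}
    {I : Fin 3 → Π x : M, Module.End ℝ (S.H x)} {ξ : Fin 3 → Π x : M, Tan n x}
    (h : IsLocalFrame S.toHorizontalData U η I) (hξ : ∀ x ∈ U, ∀ s, ξ s x ∈ V x)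
    (hηξ : ∀ x ∈ U, ∀ s t, η s x (ξ t x) = if s = t then 1 else 0) {y : M} (hy : U ∈ nhds y)
    (hs : ∀ s, SmoothAt (ξ s) y) {X : Π y : M, Tan n y} (hX : SmoothAt X y) :
    SmoothAt (toField fun z => projH S hV z (X z)) y := by
  have h1 : ∀ s, SmoothAt ((fun z => η s z (X z)) • ξ s) y := fun s =>
    SmoothAt.smul ((h.η_smooth s).apply hy hX) (hs s)
  have h2 : SmoothAt (X + (fun _ : M => (-1 : ℝ)) • ((fun z => η 0 z (X z)) • ξ 0 +
      (fun z => η 1 z (X z)) • ξ 1 + (fun z => η 2 z (X z)) • ξ 2)) y :=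
    hX.add (SmoothAt.smul contMDiffAt_const (((h1 0).add (h1 1)).add (h1 2)))
  refine h2.congr ?_
  filter_upwards [hy] with z hz
  rw [toField, coe_projH hV (h.mem_H_iff z hz) (hξ z hz) (hηξ z hz), Fin.sum_univ_three]
  simp only [Pi.add_apply, Pi.smul_apply', neg_smul, one_smul, sub_eq_add_neg]

/-- Local data `η`, `I` on `W`, with the dual vertical fields `ξ`, and a smooth frame `e` of `H`
with `g`-dual frame `e'`. -/
structure Patch (S : PQCStructure n M) (V : Π x : M, Submodule ℝ (Tan n x)) where
  W : Opens M
  η : Fin 3 → Π x : M, Tan n x →L[ℝ] ℝ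
  I : Fin 3 → Π x : M, Module.End ℝ (S.H x)
  ξ : Fin 3 → Π x : M, Tan n x
  frame : IsLocalFrame S.toHorizontalData W η I
  ξ_mem : ∀ x ∈ W, ∀ s, ξ s x ∈ V x
  η_ξ : ∀ x ∈ W, ∀ s t, η s x (ξ t x) = if s = t then 1 else 0
  ξ_smooth : ∀ s, ∀ x ∈ W, SmoothAt (ξ s) x
  e : Fin (4 * n) → Π x, S.H x
  e' : Fin (4 * n) → Π x, S.H x
  e_smooth : ∀ a, ∀ x ∈ W, SmoothAt (toField (e a)) x
  e'_smooth : ∀ a, ∀ x ∈ W, SmoothAt (toField (e' a)) x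
  g_e_e' : ∀ x ∈ W, ∀ a b, S.g x (e a x) (e' b x) = if a = b then 1 else 0

namespace Patch

variable {S : PQCStructure n M} {V : Π x : M, Submodule ℝ (Tan n x)} (P : Patch S V)
  (hV : IsVertical S V)

lemma expand {x : M} (hx : x ∈ P.W) (v : S.H x) : ∑ a, S.g x v (P.e' a x) • P.e a x = v :=
  sum_dual_smul (P.g_e_e' x hx) (by rw [S.finrank_H, Fintype.card_fin]) v

lemma coe_projH {x : M} (hx : x ∈ P.W) (v : Tan n x) :
    (projH S hV x v : Tan n x) = v - ∑ s, P.η s x v • P.ξ s x :=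
  PQC.coe_projH hV (P.frame.mem_H_iff x hx) (P.ξ_mem x hx) (P.η_ξ x hx) v

end Patch

end Patch

/-! ### The module of smooth horizontal fields -/

section Horizontal

variable {n : ℕ} {M : Type*} [TopologicalSpace M] [ChartedSpace (Model n) M]
  [IsManifold (𝓡 (4 * n + 3)) ∞ M] (S : PQCStructure n M) (W : Opens M)

/-- The horizontal fields that are smooth on `W`, as a subgroup of the group of all of them. -/
def horizontalSubgroup : AddSubgroup (Π y : W, S.H y) where
  carrier := {X | ∀ y : W, SmoothAt (toField (ext0 X)) y}
  add_mem' {X Y} hX hY y := by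
    rw [ext0_add]
    exact (hX y).add (hY y)
  zero_mem' y := (smoothAt_zero _).congr
    ((ext0_restrict (E := fun y => S.H y) (fun _ => 0) y).mono fun z hz => by
      simp only [toField]
      exact congrArg Subtype.val hz)
  neg_mem' {X} hX y := by
    refine ((hX y).smul (contMDiffAt_const (c := (-1 : ℝ)))).congr
      (Filter.Eventually.of_forall fun z => ?_)
    by_cases h : z ∈ W <;> simp [ext0, h, toField]

/-- The module of smooth horizontal fields on `W`. -/
def HFields : Type _ := horizontalSubgroup S W

variable {S W}

instance : AddCommGroup (HFields S W) := inferInstanceAs (AddCommGroup (horizontalSubgroup S W))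

instance : Module (SmoothFun n W) (HFields S W) where
  smul f X := ⟨fun y => f.1 y • X.1 y, fun y =>
    (SmoothAt.smul (smooth_fn f y) (X.2 y)).congr (Filter.Eventually.of_forall fun z =>
      congrArg Subtype.val (ext0_smul (E := fun y => S.H y) f.1 X.1 z))⟩
  one_smul X := Subtype.ext (funext fun y => one_smul ℝ (X.1 y))
  mul_smul f f' X := Subtype.ext (funext fun y => mul_smul (f.1 y) (f'.1 y) (X.1 y))
  smul_zero f := Subtype.ext (funext fun y => smul_zero (f.1 y))
  smul_add f X Y := Subtype.ext (funext fun y => smul_add (f.1 y) (X.1 y) (Y.1 y))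
  add_smul f f' X := Subtype.ext (funext fun y => add_smul (f.1 y) (f'.1 y) (X.1 y))
  zero_smul X := Subtype.ext (funext fun y => zero_smul ℝ (X.1 y))

/-- A smooth horizontal field on `W` as a horizontal field on `M`. -/
def hfld (X : HFields S W) : Π y : M, S.H y := ext0 X.1

lemma smooth_hfld (X : HFields S W) (y : W) : SmoothAt (toField (hfld X)) y := X.2 y

lemma hfld_add (X Y : HFields S W) : hfld (X + Y) = hfld X + hfld Y :=
  ext0_add (E := fun y => S.H y) X.1 Y.1

lemma hfld_smul (f : SmoothFun n W) (X : HFields S W) : hfld (f • X) = fn f • hfld X :=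
  funext fun y => ext0_smul (E := fun y => S.H y) f.1 X.1 y

lemma hfld_zero : hfld (0 : HFields S W) = 0 := by
  have h : hfld (0 : HFields S W) + hfld (0 : HFields S W) = hfld (0 : HFields S W) := by
    rw [← hfld_add, add_zero]
  exact left_eq_add.1 h.symm

lemma hfld_neg (X : HFields S W) : hfld (-X) = -hfld X :=
  eq_neg_of_add_eq_zero_left (by rw [← hfld_add, neg_add_cancel, hfld_zero])

lemma hfld_sub (X Y : HFields S W) : hfld (X - Y) = hfld X - hfld Y := by
  rw [sub_eq_add_neg, hfld_add, hfld_neg, sub_eq_add_neg]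

/-- The restriction to `W` of a horizontal field that is smooth on `W`. -/
def mkHFld (F : Π y : M, S.H y) (hF : ∀ y : W, SmoothAt (toField F) y) : HFields S W :=
  ⟨fun y => F y, fun y => (hF y).congr ((ext0_restrict F y).mono fun z hz => by
    simp only [toField]
    exact congrArg Subtype.val hz)⟩

lemma hfld_mkHFld (F : Π y : M, S.H y) (hF : ∀ y : W, SmoothAt (toField F) y) (y : W) :
    ∀ᶠ z in nhds (y : M), hfld (mkHFld F hF) z = F z := ext0_restrict F y

lemma ext_hfld {X Y : HFields S W} (h : ∀ y : W, hfld X y = hfld Y y) : X = Y :=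
  Subtype.ext (funext fun y => by simpa [hfld, ext0_apply] using h y)

/-- The inclusion of the horizontal fields. -/
def incl : HFields S W →ₗ[SmoothFun n W] Fields n W where
  toFun X := ⟨fun y => X.1 y, fun y => (smooth_hfld X y).congr (Filter.Eventually.of_forall
    fun z => by by_cases h : z ∈ W <;> simp [hfld, toField, ext0, h])⟩
  map_add' _ _ := Subtype.ext rfl
  map_smul' _ _ := Subtype.ext rfl

lemma fld_incl (X : HFields S W) : fld (incl X) = toField (hfld X) :=
  funext fun z => by
    by_cases h : z ∈ W
    · simp only [fld, hfld, toField, ext0, h, dif_pos]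
      rfl
    · simp [fld, hfld, toField, ext0, h]

end Horizontal

end PQC

end

noncomputable section

namespace PQC

open TopologicalSpace (Opens)

namespace Patch

variable {n : ℕ} {M : Type*} [TopologicalSpace M] [ChartedSpace (Model n) M]
  [IsManifold (𝓡 (4 * n + 3)) ∞ M] {S : PQCStructure n M} {V : Π x : M, Submodule ℝ (Tan n x)}
  (P : Patch S V) (hV : IsVertical S V)

/-! ### Smooth tensor fields on a patch as module homomorphisms -/

lemma W_mem_nhds (y : P.W) : (P.W : Set M) ∈ nhds (y : M) := P.W.isOpen.mem_nhds y.2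

/-- The contact forms. -/
def etaL (s : Fin 3) : Fields n P.W →ₗ[SmoothFun n P.W] SmoothFun n P.W where
  toFun X := mkFn (fun y => P.η s y (fld X y)) fun y =>
    (P.frame.η_smooth s).apply (P.W_mem_nhds y) (smooth_fld X y)
  map_add' X Y := ext_fn fun y => by
    rw [fn_add, Pi.add_apply, (fn_mkFn _ _ y).eq_of_nhds, (fn_mkFn _ _ y).eq_of_nhds,
      (fn_mkFn _ _ y).eq_of_nhds, fld_add, Pi.add_apply, map_add]
  map_smul' f X := ext_fn fun y => by
    rw [RingHom.id_apply, smul_eq_mul, fn_mul, Pi.mul_apply, (fn_mkFn _ _ y).eq_of_nhds,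
      (fn_mkFn _ _ y).eq_of_nhds, fld_smul, Pi.smul_apply', map_smul, smul_eq_mul]

lemma fn_etaL (s : Fin 3) (X : Fields n P.W) (y : P.W) :
    fn (P.etaL s X) y = P.η s y (fld X y) :=
  (fn_mkFn _ _ y).eq_of_nhds

/-- The vertical frame. -/
def xiL (s : Fin 3) : Fields n P.W := mkFld (P.ξ s) fun y => P.ξ_smooth s y y.2

lemma fld_xiL (s : Fin 3) (y : P.W) : fld (P.xiL s) y = P.ξ s y := (fld_mkFld _ _ y).eq_of_nhds

lemma smooth_projH {X : Π y : M, Tan n y} {y : P.W} (hX : SmoothAt X y) :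
    SmoothAt (toField fun z => projH S hV z (X z)) y :=
  SmoothAt.projH hV P.frame P.ξ_mem P.η_ξ (P.W_mem_nhds y) (fun s => P.ξ_smooth s y y.2) hX

/-- The projection to the horizontal fields. -/
def prL : Fields n P.W →ₗ[SmoothFun n P.W] HFields S P.W where
  toFun X := mkHFld (fun y => projH S hV y (fld X y)) fun y => P.smooth_projH hV (smooth_fld X y)
  map_add' X Y := ext_hfld fun y => by
    rw [hfld_add, Pi.add_apply, (hfld_mkHFld _ _ y).self_of_nhds, (hfld_mkHFld _ _ y).self_of_nhds,
      (hfld_mkHFld _ _ y).self_of_nhds, fld_add, Pi.add_apply, map_add]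
  map_smul' f X := ext_hfld fun y => by
    rw [RingHom.id_apply, hfld_smul, Pi.smul_apply', (hfld_mkHFld _ _ y).self_of_nhds,
      (hfld_mkHFld _ _ y).self_of_nhds, fld_smul, Pi.smul_apply', map_smul]

lemma hfld_prL (X : Fields n P.W) (y : P.W) : hfld (P.prL hV X) y = projH S hV y (fld X y) :=
  (hfld_mkHFld _ _ y).self_of_nhds

/-- The horizontal metric. -/
def gL : LinearMap.BilinForm (SmoothFun n P.W) (HFields S P.W) :=
  LinearMap.mk₂ _ (fun X Y => mkFn (fun y => S.g y (hfld X y) (hfld Y y)) fun y =>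
      S.g_smooth _ _ y (smooth_hfld X y) (smooth_hfld Y y))
    (fun X X' Y => ext_fn fun y => by
      rw [fn_add, Pi.add_apply, (fn_mkFn _ _ y).eq_of_nhds, (fn_mkFn _ _ y).eq_of_nhds,
        (fn_mkFn _ _ y).eq_of_nhds, hfld_add, Pi.add_apply, map_add, LinearMap.add_apply])
    (fun f X Y => ext_fn fun y => by
      rw [smul_eq_mul, fn_mul, Pi.mul_apply, (fn_mkFn _ _ y).eq_of_nhds,
        (fn_mkFn _ _ y).eq_of_nhds, hfld_smul, Pi.smul_apply', map_smul, LinearMap.smul_apply,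
        smul_eq_mul])
    (fun X Y Y' => ext_fn fun y => by
      rw [fn_add, Pi.add_apply, (fn_mkFn _ _ y).eq_of_nhds, (fn_mkFn _ _ y).eq_of_nhds,
        (fn_mkFn _ _ y).eq_of_nhds, hfld_add, Pi.add_apply, map_add])
    (fun f X Y => ext_fn fun y => by
      rw [smul_eq_mul, fn_mul, Pi.mul_apply, (fn_mkFn _ _ y).eq_of_nhds,
        (fn_mkFn _ _ y).eq_of_nhds, hfld_smul, Pi.smul_apply', map_smul, smul_eq_mul])

lemma fn_gL_eventually (X Y : HFields S P.W) (y : P.W) :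
    fn (P.gL X Y) =ᶠ[nhds (y : M)] fun z => S.g z (hfld X z) (hfld Y z) :=
  fn_mkFn _ _ y

lemma fn_gL (X Y : HFields S P.W) (y : P.W) :
    fn (P.gL X Y) y = S.g y (hfld X y) (hfld Y y) :=
  (P.fn_gL_eventually X Y y).eq_of_nhds

lemma smooth_I (s : Fin 3) (X : HFields S P.W) (y : P.W) :
    SmoothAt (toField fun z => P.I s z (hfld X z)) y :=
  P.frame.I_smooth s y y.2 _ (smooth_hfld X y)

/-- The paraquaternionic structure. -/
def IL (s : Fin 3) : Module.End (SmoothFun n P.W) (HFields S P.W) where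
  toFun X := mkHFld (fun y => P.I s y (hfld X y)) (P.smooth_I s X)
  map_add' X Y := ext_hfld fun y => by
    rw [(hfld_mkHFld _ _ y).self_of_nhds, hfld_add, Pi.add_apply, hfld_add, Pi.add_apply,
      (hfld_mkHFld _ _ y).self_of_nhds, (hfld_mkHFld _ _ y).self_of_nhds, map_add]
  map_smul' f X := ext_hfld fun y => by
    rw [RingHom.id_apply, (hfld_mkHFld _ _ y).self_of_nhds, hfld_smul, Pi.smul_apply', hfld_smul,
      Pi.smul_apply', (hfld_mkHFld _ _ y).self_of_nhds, map_smul]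

lemma hfld_IL_eventually (s : Fin 3) (X : HFields S P.W) (y : P.W) :
    ∀ᶠ z in nhds (y : M), hfld (P.IL s X) z = P.I s z (hfld X z) :=
  hfld_mkHFld _ _ y

lemma hfld_IL (s : Fin 3) (X : HFields S P.W) (y : P.W) :
    hfld (P.IL s X) y = P.I s y (hfld X y) :=
  (P.hfld_IL_eventually s X y).self_of_nhds

/-- The frame of `H`. -/
def eL (a : Fin (4 * n)) : HFields S P.W := mkHFld (P.e a) fun y => P.e_smooth a y y.2

/-- The dual frame of `H`. -/
def eL' (a : Fin (4 * n)) : HFields S P.W := mkHFld (P.e' a) fun y => P.e'_smooth a y y.2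

lemma hfld_eL (a : Fin (4 * n)) (y : P.W) : hfld (P.eL a) y = P.e a y :=
  (hfld_mkHFld _ _ y).self_of_nhds

lemma hfld_eL' (a : Fin (4 * n)) (y : P.W) : hfld (P.eL' a) y = P.e' a y :=
  (hfld_mkHFld _ _ y).self_of_nhds

/-! ### Derivations -/

/-- The derivative of a function along a field. -/
def deriv (X : Fields n P.W) (f : SmoothFun n P.W) : SmoothFun n P.W :=
  -- By the Leibniz rule [X, f ξ] = (Xf) ξ + f [X, ξ], the form η dual to ξ extracts Xf. Smoothness
  -- of Xf is thus inherited from the bracket.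
  P.etaL 0 (bracket X (f • P.xiL 0)) - f * P.etaL 0 (bracket X (P.xiL 0))

lemma fn_deriv (X : Fields n P.W) (f : SmoothFun n P.W) (y : P.W) :
    fn (P.deriv X f) y = dFun (fn f) y (fld X y) := by
  rw [deriv, fn_sub, Pi.sub_apply, fn_mul, Pi.mul_apply, fn_etaL, fn_etaL, bracket_smul_apply,
    map_add, map_smul, map_smul, fld_xiL, P.η_ξ y y.2, if_pos rfl]
  simp

lemma deriv_add (X : Fields n P.W) (f f' : SmoothFun n P.W) :
    P.deriv X (f + f') = P.deriv X f + P.deriv X f' :=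
  ext_fn fun y => by
    rw [fn_add, Pi.add_apply, fn_deriv, fn_deriv, fn_deriv, fn_add,
      dFun_add (smooth_fn f y) (smooth_fn f' y)]

lemma deriv_mul (X : Fields n P.W) (f f' : SmoothFun n P.W) :
    P.deriv X (f * f') = f * P.deriv X f' + f' * P.deriv X f :=
  ext_fn fun y => by
    rw [fn_add, Pi.add_apply, fn_mul, fn_mul, Pi.mul_apply, Pi.mul_apply, fn_deriv, fn_deriv,
      fn_deriv, fn_mul, dFun_mul (smooth_fn f y) (smooth_fn f' y)]

lemma deriv_algebraMap (X : Fields n P.W) (r : ℝ) : P.deriv X (algebraMap ℝ _ r) = 0 :=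
  ext_fn fun y => by
    rw [fn_deriv, fn_zero, Pi.zero_apply, dFun_congr (f' := fun _ => r), dFun_const]
    filter_upwards [P.W_mem_nhds y] with z hz
    exact fn_algebraMap r ⟨z, hz⟩

/-- The action of fields on functions. -/
def derivL : Fields n P.W →ₗ[SmoothFun n P.W] Derivation ℝ (SmoothFun n P.W) (SmoothFun n P.W) where
  toFun X := Derivation.mk'
    { toFun := P.deriv X
      map_add' := P.deriv_add X
      map_smul' := fun r f => by
        rw [Algebra.smul_def, deriv_mul, deriv_algebraMap, mul_zero, add_zero, RingHom.id_apply,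
          Algebra.smul_def] }
    fun f f' => P.deriv_mul X f f'
  map_add' X Y := by
    ext f
    refine ext_fn fun y => ?_
    change fn (P.deriv (X + Y) f) y = fn (P.deriv X f + P.deriv Y f) y
    rw [fn_add, Pi.add_apply, fn_deriv, fn_deriv, fn_deriv, fld_add]
    exact dFun_add_right _ _ _ _
  map_smul' c X := by
    ext f
    refine ext_fn fun y => ?_
    change fn (P.deriv (c • X) f) y = fn (c * P.deriv X f) y
    rw [fn_mul, Pi.mul_apply, fn_deriv, fn_deriv, fld_smul]
    exact dFun_smul_right _ _ _ _

lemma derivL_apply (X : Fields n P.W) (f : SmoothFun n P.W) : P.derivL X f = P.deriv X f := rfl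

lemma bracket_smul (X : Fields n P.W) (f : SmoothFun n P.W) (Y : Fields n P.W) :
    bracket X (f • Y) = P.derivL X f • Y + f • bracket X Y :=
  ext_fld fun y => by
    rw [bracket_smul_apply, fld_add, Pi.add_apply, fld_smul, fld_smul, Pi.smul_apply',
      Pi.smul_apply', derivL_apply, fn_deriv]

/-- Jacobi for X, Y and f ξ, with the forms η applied, differs from f times Jacobi for X, Y, ξ
exactly by this identity. -/
lemma derivL_bracket (X Y : Fields n P.W) (f : SmoothFun n P.W) :
    P.derivL (bracket X Y) f = P.derivL X (P.derivL Y f) - P.derivL Y (P.derivL X f) := by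
  have h := congrArg (P.etaL 0) (bracket_jacobi X Y (f • P.xiL 0))
  have h1 := congrArg (P.etaL 0) (bracket_jacobi X Y (P.xiL 0))
  have h0 : P.etaL 0 (P.xiL 0) = 1 := ext_fn fun y => by
    rw [fn_etaL, fld_xiL, P.η_ξ y y.2, if_pos rfl, fn_apply]
    rfl
  simp only [bracket_smul, bracket_add_right, map_add, map_smul, h0, smul_eq_mul] at h h1
  rw [h1] at h
  linear_combination -h

end Patch

end PQC

end

noncomputable section

namespace PQC

/-! ## Pointwise linear algebra -/

lemma eps_mul_self (s : Fin 3) : eps s * eps s = 1 := by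
  fin_cases s <;> simp [eps]

section LinearAlgebra

variable {E : Type*} [AddCommGroup E] [Module ℝ E]

/-- The metric contraction may be computed in any pair of dual families, not only in the basis
chosen in `metricTrace`. -/
lemma metricTrace_frame [FiniteDimensional ℝ E] {g : LinearMap.BilinForm ℝ E}
    (hg : g.Nondegenerate) (hs : g.IsSymm) {ι : Type*} [Fintype ι] {e e' : ι → E}
    (he : ∀ v, ∑ a, g v (e' a) • e a = v) (B : LinearMap.BilinForm ℝ E) :
    metricTrace g hg (fun u v => B u v) = ∑ a, B (e a) (e' a) := by
  classical
  set b := Module.finBasis ℝ E with hb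
  set b' := g.dualBasis hg b with hb'
  have hexp : ∀ v, v = ∑ i, g (b i) v • b' i := by
    intro v
    conv_lhs => rw [← b'.sum_repr v]
    refine Finset.sum_congr rfl fun i _ => ?_
    congr 1
    conv_rhs => rw [← b'.sum_repr v]
    rw [map_sum, Finset.sum_eq_single i]
    · simp [hb', LinearMap.BilinForm.apply_dualBasis_right, hs]
    · intro c _ hc
      simp [hb', LinearMap.BilinForm.apply_dualBasis_right, hs, hc.symm]
    · simp
  unfold metricTrace
  simp only [← hb, ← hb']
  have h1 : ∀ i, B (b i) (b' i) = ∑ a, g (b i) (e' a) * B (e a) (b' i) := by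
    intro i
    conv_lhs => rw [← he (b i)]
    simp
  have h2 : ∀ a, B (e a) (e' a) = ∑ i, g (b i) (e' a) * B (e a) (b' i) := by
    intro a
    conv_lhs => rw [hexp (e' a)]
    simp
  simp only [h1, h2]
  exact Finset.sum_comm

lemma endInner_frame [FiniteDimensional ℝ E] {g : LinearMap.BilinForm ℝ E}
    (hg : g.Nondegenerate) (hs : g.IsSymm) {ι : Type*} [Fintype ι] {e e' : ι → E}
    (he : ∀ v, ∑ a, g v (e' a) • e a = v) (T T' : Module.End ℝ E) :
    endInner g hg T T' = ∑ a, g (T (e a)) (T' (e' a)) :=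
  metricTrace_frame hg hs he (g.comp T T')

/-- The endomorphisms `J s` satisfy the relations of the generators of a paraquaternionic
structure. -/
structure IsParaquaternionic (g : LinearMap.BilinForm ℝ E) (J : Fin 3 → Module.End ℝ E) :
    Prop where
  sq : ∀ s, J s * J s = eps s • 1
  mul : ∀ s, J s * J (s + 1) = -eps (s + 2) • J (s + 2)
  mul' : ∀ s, J (s + 1) * J s = eps (s + 2) • J (s + 2)
  skew : ∀ s u v, g (J s u) v = -g u (J s v)

variable {g : LinearMap.BilinForm ℝ E} {J : Fin 3 → Module.End ℝ E}

/-- Multiplication by J_t from either side only permutes the four summands C and ε_s J_s C J_s among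
each other, up to matching factors. -/
lemma IsParaquaternionic.sum_conj_commute (hJ : IsParaquaternionic g J) (C : Module.End ℝ E)
    (t : Fin 3) :
    (C + ∑ s, eps s • (J s * C * J s)) * J t = J t * (C + ∑ s, eps s • (J s * C * J s)) := by
  have h1 : J t * (J (t + 1) * C * J (t + 1)) = -eps (t + 2) • (J (t + 2) * C * J (t + 1)) := by
    rw [← mul_assoc, ← mul_assoc, hJ.mul, smul_mul_assoc, smul_mul_assoc]
  have h2 : J t * (J (t + 2) * C * J (t + 2)) = eps (t + 1) • (J (t + 1) * C * J (t + 2)) := by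
    have := hJ.mul' (t + 2)
    rw [show t + 2 + 1 = t by omega, show t + 2 + 2 = t + 1 by omega] at this
    rw [← mul_assoc, ← mul_assoc, this, smul_mul_assoc, smul_mul_assoc]
  have h3 : J (t + 1) * C * J (t + 1) * J t = eps (t + 2) • (J (t + 1) * C * J (t + 2)) := by
    rw [mul_assoc, hJ.mul', mul_smul_comm]
  have h4 : J (t + 2) * C * J (t + 2) * J t = -eps (t + 1) • (J (t + 2) * C * J (t + 1)) := by
    have := hJ.mul (t + 2)
    rw [show t + 2 + 1 = t by omega, show t + 2 + 2 = t + 1 by omega] at this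
    rw [mul_assoc, this, mul_smul_comm]
  have h5 : J t * C * J t * J t = eps t • (J t * C) := by
    rw [mul_assoc, hJ.sq, mul_smul_comm, mul_one]
  have h6 : J t * (J t * C * J t) = eps t • (C * J t) := by
    rw [← mul_assoc, ← mul_assoc, hJ.sq, smul_mul_assoc, smul_mul_assoc, one_mul]
  rw [sum_cyclic _ t]
  simp only [add_mul, mul_add, smul_mul_assoc, mul_smul_comm, h1, h2, h3, h4, h5, h6, smul_smul,
    eps_mul_self, one_smul, mul_neg, mul_comm (eps (t + 2)) (eps (t + 1))]
  abel

/-- The test element is the average over the J_s of the rank-two skew endomorphism c(u, v) = g(u,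
·)v - g(v, ·)u. It is skew and commutes with Q, so it lies in sp(n,ℝ). The inner product of T with
c(u, v) is g(Tu, v) - g(Tv, u), and J_s c(u, v) J_s = -c(J_s u, J_s v). -/
lemma MemSpPerp.sum_conj_skew [FiniteDimensional ℝ E] {hg : g.Nondegenerate} (hs : g.IsSymm)
    (hJ : IsParaquaternionic g J) {T : Module.End ℝ E} {Q : Submodule ℝ (Module.End ℝ E)}
    (hT : MemSpPerp g hg Q T) (hQ : Q = Submodule.span ℝ (Set.range J))
    {ι : Type*} [Fintype ι] {e e' : ι → E} (he : ∀ v, ∑ a, g v (e' a) • e a = v) (u v : E) :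
    g (T u) v - g (T v) u - ∑ s, eps s * (g (T (J s u)) (J s v) - g (T (J s v)) (J s u)) = 0 := by
  let c : E → E → Module.End ℝ E := fun u v =>
    (g u).smulRight v - (g v).smulRight u
  have hc : ∀ u v w, c u v w = g u w • v - g v w • u := fun u v w => rfl
  have hJc : ∀ s, J s * c u v * J s = -c (J s u) (J s v) := by
    intro s
    ext w
    simp only [Module.End.mul_apply, hc, map_sub, map_smul, LinearMap.neg_apply, hJ.skew]
    module
  have hcs : ∀ u v w z, g (c u v w) z = -g w (c u v z) := by
    intro u v w z
    simp only [hc, map_sub, map_smul, LinearMap.sub_apply, LinearMap.smul_apply, smul_eq_mul]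
    rw [hs.eq w u, hs.eq w v]
    ring
  have hB : c u v + ∑ s, eps s • (J s * c u v * J s) =
      c u v - ∑ s, eps s • c (J s u) (J s v) := by
    simp only [hJc, smul_neg, Finset.sum_neg_distrib, sub_eq_add_neg]
  have hcomm : ∀ L ∈ Q, (c u v + ∑ s, eps s • (J s * c u v * J s)) * L =
      L * (c u v + ∑ s, eps s • (J s * c u v * J s)) := by
    intro L hL
    rw [hQ] at hL
    induction hL using Submodule.span_induction with
    | mem x hx =>
      obtain ⟨t, rfl⟩ := hx
      exact hJ.sum_conj_commute _ t
    | zero => simp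
    | add x y _ _ h1 h2 => rw [mul_add, h1, h2, ← add_mul]
    | smul a x _ h => rw [mul_smul_comm, smul_mul_assoc, h]
  rw [hB] at hcomm
  have h := hT.1 _ (fun w z => ?_) hcomm
  · have htr : ∀ u v, ∑ a, g (T (e a)) (c u v (e' a)) = g (T u) v - g (T v) u := by
      intro u v
      have h1 : ∀ u v, g (T u) v = ∑ a, g u (e' a) * g (T (e a)) v := fun u v => by
        conv_lhs => rw [← he u]
        simp
      rw [h1 u v, h1 v u, ← Finset.sum_sub_distrib]
      exact Finset.sum_congr rfl fun a _ => by simp [hc]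
    rw [endInner_frame hg hs he] at h
    simp only [LinearMap.sub_apply, LinearMap.sum_apply, LinearMap.smul_apply, map_sub, map_sum,
      map_smul, Finset.sum_sub_distrib, smul_eq_mul] at h
    rw [Finset.sum_comm] at h
    simp only [← Finset.mul_sum, htr] at h
    exact h
  · simp only [LinearMap.sub_apply, LinearMap.sum_apply, LinearMap.smul_apply, map_sub, map_sum,
      map_smul, hcs, smul_eq_mul, mul_neg, Finset.sum_neg_distrib]
    ring

end LinearAlgebra

end PQC

end

noncomputable section

namespace PQC

open TopologicalSpace (Opens)

/-! ### The full multiplication table of local data. -/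

section Frame

variable {n : ℕ} {M : Type*} [TopologicalSpace M] [ChartedSpace (Model n) M]
  [IsManifold (𝓡 (4 * n + 3)) ∞ M]

lemma IsLocalFrame.isParaquaternionic {S : PQCStructure n M} {U : Set M}
    {η : Fin 3 → Π x : M, Tan n x →L[ℝ] ℝ} {I : Fin 3 → Π x : M, Module.End ℝ (S.H x)}
    (h : IsLocalFrame S.toHorizontalData U η I) {x : M} (hx : x ∈ U) :
    IsParaquaternionic (S.g x) fun s => I s x := by
  have h0 := h.I₁_sq x hx
  have h1 := h.I₂_sq x hx
  have h2 := h.I₃_sq x hx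
  have h01 := h.I₁_mul_I₂ x hx
  have h10 := h.I₂_mul_I₁ x hx
  have h12 : I 1 x * I 2 x = -I 0 x := by
    rw [← neg_neg (I 2 x), ← h10, mul_neg, ← mul_assoc, h1, one_mul]
  have h21 : I 2 x * I 1 x = I 0 x := by rw [← h01, mul_assoc, h1, mul_one]
  have h20 : I 2 x * I 0 x = -I 1 x := by
    rw [← neg_neg (I 2 x), ← h10, neg_mul, mul_assoc, h0, mul_one]
  have h02 : I 0 x * I 2 x = I 1 x := by rw [← h01, ← mul_assoc, h0, one_mul]
  have e0 : eps 0 = 1 := rfl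
  have e1 : eps 1 = 1 := rfl
  have e2 : eps 2 = -1 := rfl
  have hn : ∀ T : Module.End ℝ (S.H x), (-1 : ℝ) • T = -T := fun T => neg_one_smul ℝ T
  have hsq : ∀ s, I s x * I s x = eps s • 1 := by
    rw [Fin.forall_fin_succ, Fin.forall_fin_succ, Fin.forall_fin_succ]
    exact ⟨by rw [h0, e0, one_smul], h1.trans (one_smul ℝ _).symm, h2.trans (hn 1).symm,
      fun i => i.elim0⟩
  refine ⟨hsq, fun s => ?_, fun s => ?_, fun s u v => ?_⟩
  · fin_cases s
    · exact h01.trans (by rw [← one_smul ℝ (I 2 x), ← neg_neg (1 : ℝ)]; rfl)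
    · exact h12.trans (hn (I 0 x)).symm
    · exact h20.trans (hn (I 1 x)).symm
  · fin_cases s
    · exact h10.trans (hn (I 2 x)).symm
    · exact h21.trans (one_smul ℝ (I 0 x)).symm
    · exact h02.trans (one_smul ℝ (I 1 x)).symm
  · have hc := h.compatible s x hx u (I s x v)
    have hv : I s x (I s x v) = eps s • v := LinearMap.congr_fun (hsq s) v
    rw [hv, map_smul, smul_eq_mul] at hc
    linear_combination eps s * hc - (S.g x (I s x u) v + S.g x u (I s x v)) * eps_mul_self s

end Frame

/-! ### Evaluation of sums and signs. -/

section Sums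

variable {n : ℕ} {M : Type*} [TopologicalSpace M] [ChartedSpace (Model n) M] {W : Opens M}

lemma fn_sum {ι : Type*} (s : Finset ι) (f : ι → SmoothFun n W) :
    fn (∑ i ∈ s, f i) = ∑ i ∈ s, fn (f i) :=
  map_sum (AddMonoidHom.mk' fn fn_add) f s

lemma fn_sg (s : Fin 3) (y : W) : fn (sg (SmoothFun n W) s) y = eps s := by
  have h : sg (SmoothFun n W) s = algebraMap ℝ _ (eps s) := by
    fin_cases s <;> simp [sg, eps]
  rw [h, fn_algebraMap]

lemma fn_neg (f : SmoothFun n W) : fn (-f) = -fn f :=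
  eq_neg_of_add_eq_zero_left (by rw [← fn_add, neg_add_cancel, fn_zero])

variable [IsManifold (𝓡 (4 * n + 3)) ∞ M] {S : PQCStructure n M}

lemma fld_sum {ι : Type*} (s : Finset ι) (X : ι → Fields n W) :
    fld (∑ i ∈ s, X i) = ∑ i ∈ s, fld (X i) :=
  map_sum (AddMonoidHom.mk' fld fld_add) X s

lemma hfld_sum {ι : Type*} (s : Finset ι) (X : ι → HFields S W) :
    hfld (∑ i ∈ s, X i) = ∑ i ∈ s, hfld (X i) :=
  map_sum (AddMonoidHom.mk' hfld hfld_add) X s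

end Sums

namespace Patch

variable {n : ℕ} {M : Type*} [TopologicalSpace M] [ChartedSpace (Model n) M]
  [IsManifold (𝓡 (4 * n + 3)) ∞ M] {S : PQCStructure n M} {V : Π x : M, Submodule ℝ (Tan n x)}
  (P : Patch S V) (hV : IsVertical S V) {D : Connection n M}

/-! ### The contact algebra of a patch -/

lemma D_add {X Y : Π y : M, Tan n y} {x : M} (hX : SmoothAt X x) (hY : SmoothAt Y x) :
    D (X + Y) x = D X x + D Y x :=
  D.isCovariantDerivativeOnUniv.add hX.diffAt hY.diffAt

lemma D_smul_apply {f : M → ℝ} {X : Π y : M, Tan n y} {x : M} (hf : SmoothFunAt n f x)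
    (hX : SmoothAt X x) (v : Tan n x) : D (f • X) x v = f x • D X x v + dFun f x v • X x := by
  rw [D.isCovariantDerivativeOnUniv.leibniz hX.diffAt (hf.mdifferentiableAt (by simp))]
  rfl

/-- The connection as a module homomorphism. -/
def nabL [T2Space M] (hDs : D.ContMDiffCovariantDerivative ∞) :
    Fields n P.W →ₗ[SmoothFun n P.W] (Fields n P.W →+ Fields n P.W) where
  toFun X :=
    { toFun := connect hDs X
      map_zero' := ext_fld fun y => by
        have h1 : D (0 + 0 : Π y : M, Tan n y) (y : M) = D 0 y + D 0 y :=
          D_add (smoothAt_zero _) (smoothAt_zero _)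
        rw [add_zero] at h1
        rw [connect_apply, fld_zero, left_eq_add.1 h1]
        rfl
      map_add' := fun Y Z => ext_fld fun y => by
        rw [fld_add, Pi.add_apply, connect_apply, connect_apply, connect_apply, fld_add,
          D_add (smooth_fld Y y) (smooth_fld Z y)]
        rfl }
  map_add' X Y := by
    ext Z
    refine ext_fld fun y => ?_
    change fld (connect hDs (X + Y) Z) y = fld (connect hDs X Z + connect hDs Y Z) y
    rw [fld_add, Pi.add_apply, connect_apply, connect_apply, connect_apply, fld_add, Pi.add_apply,
      map_add]
  map_smul' f X := by
    ext Z
    refine ext_fld fun y => ?_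
    change fld (connect hDs (f • X) Z) y = fld (f • connect hDs X Z) y
    rw [fld_smul, Pi.smul_apply', connect_apply, connect_apply, fld_smul, Pi.smul_apply', map_smul]

lemma fld_nabL [T2Space M] (hDs : D.ContMDiffCovariantDerivative ∞) (X Y : Fields n P.W) (y : P.W) :
    fld (P.nabL hDs X Y) y = D (fld Y) y (fld X y) :=
  connect_apply hDs X Y y

lemma eta_hfld (s : Fin 3) (X : HFields S P.W) (y : P.W) : P.η s y (hfld X y : Tan n (y : M)) = 0 :=
  (P.frame.mem_H_iff y y.2 _).1 (hfld X y).2 s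

lemma etaL_incl (s : Fin 3) (X : HFields S P.W) : P.etaL s (incl X) = 0 :=
  ext_fn fun y => by
    rw [fn_etaL, fld_incl, fn_zero]
    exact P.eta_hfld s X y

lemma prL_incl (X : HFields S P.W) : P.prL hV (incl X) = X :=
  ext_hfld fun y => by
    rw [hfld_prL, fld_incl]
    exact projH_coe hV _ _

lemma decompL (X : Fields n P.W) :
    X = incl (P.prL hV X) + ∑ s, P.etaL s X • P.xiL s :=
  ext_fld fun y => by
    rw [fld_add, fld_sum, Pi.add_apply, Finset.sum_apply, fld_incl]
    simp only [fld_smul, Pi.smul_apply', fn_etaL, fld_xiL, toField, hfld_prL, P.coe_projH hV y.2]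
    abel

lemma prL_eq_zero {Z : Fields n P.W} (hZ : P.prL hV Z = 0) (y : M) : fld Z y ∈ V y := by
  by_cases hy : y ∈ P.W
  · have h := P.hfld_prL hV Z ⟨y, hy⟩
    rw [hZ, hfld_zero] at h
    exact (projH_eq_zero hV).1 h.symm
  · have : fld Z y = 0 := by simp [fld, ext0, hy]
    rw [this]
    exact Submodule.zero_mem _

lemma expandL (X : HFields S P.W) : ∑ a, P.gL X (P.eL' a) • P.eL a = X :=
  ext_hfld fun y => by
    rw [hfld_sum, Finset.sum_apply]
    simp only [hfld_smul, Pi.smul_apply', fn_gL, hfld_eL, hfld_eL']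
    exact P.expand y.2 _

lemma IL_relation {s t u : Fin 3} {c : ℝ} (h : ∀ y : P.W, P.I s y * P.I t y = c • P.I u y)
    {c' : SmoothFun n P.W} (hc : ∀ y : P.W, fn c' y = c) : P.IL s * P.IL t = c' • P.IL u := by
  ext X
  refine ext_hfld fun y => ?_
  rw [Module.End.mul_apply, LinearMap.smul_apply, hfld_smul, Pi.smul_apply', hfld_IL, hfld_IL,
    hfld_IL, hc]
  exact LinearMap.congr_fun (h y) _

end Patch

end PQC

end

noncomputable section

namespace PQC

open TopologicalSpace (Opens)

namespace Patch

variable {n : ℕ} {M : Type*} [TopologicalSpace M] [ChartedSpace (Model n) M]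
  [IsManifold (𝓡 (4 * n + 3)) ∞ M] {S : PQCStructure n M} {V : Π x : M, Submodule ℝ (Tan n x)}
  (P : Patch S V) (hV : IsVertical S V) {D : Connection n M} (hD : IsCanonicalConnection S hV D)

lemma xi_mem (s : Fin 3) (y : P.W) : fld (P.xiL s) y ∈ V y := by
  rw [fld_xiL]
  exact P.ξ_mem y y.2 s

lemma sum_etaL_smul_IL (Z : Fields n P.W) (Y : HFields S P.W) (y : P.W) :
    hfld (∑ s, P.etaL s Z • P.IL s Y) y = identification S P.η P.I y (fld Z y) (hfld Y y) := by
  rw [hfld_sum, Finset.sum_apply, identification, LinearMap.sum_apply]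
  simp only [hfld_smul, Pi.smul_apply', fn_etaL, hfld_IL, LinearMap.smul_apply]

/-- For horizontal fields η_s(X) and η_s(Y) vanish identically near the point, so dη_s(X, Y) =
-η_s([X, Y]) and the contact condition determines the bracket's vertical components. -/
lemma eta_bracket (s : Fin 3) (X Y : HFields S P.W) :
    P.etaL s (bracket (incl X) (incl Y)) = 2 * sg _ s * P.gL (P.IL s X) Y := by
  refine ext_fn fun y => ?_
  have h0 : ∀ (X : HFields S P.W) (v : Tan n (y : M)), dFun (fun z => P.η s z (toField (hfld X) z)) y v = 0 := by
    intro X v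
    rw [dFun_congr (f' := fun _ => 0), dFun_const]
    filter_upwards [P.W_mem_nhds y] with z hz
    exact P.eta_hfld s X ⟨z, hz⟩
  have h := P.frame.contact s y y.2 _ _ (smooth_hfld X y).diffAt (smooth_hfld Y y).diffAt
  rw [dForm, h0, h0] at h
  have h2 : fn (2 : SmoothFun n P.W) y = 2 := by
    rw [show (2 : SmoothFun n P.W) = algebraMap ℝ _ 2 from (map_ofNat _ 2).symm, fn_algebraMap]
  rw [fn_etaL, bracket_apply, fld_incl, fld_incl, fn_mul, fn_mul, Pi.mul_apply, Pi.mul_apply, h2,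
    fn_sg, fn_gL, hfld_IL]
  linear_combination -h

lemma vertical_field {Z : Fields n P.W} (hZ : P.prL hV Z = 0) :
    ∃ Z' : Π y, V y, fld Z = toField Z' :=
  ⟨fun y => ⟨fld Z y, P.prL_eq_zero hV hZ y⟩, rfl⟩

variable [T2Space M]

lemma fld_torsion (hDs : D.ContMDiffCovariantDerivative ∞) (X Y : Fields n P.W) (y : P.W) :
    fld (P.nabL hDs X Y - P.nabL hDs Y X - bracket X Y) y
      = D.torsion (y : M) (fld X y) (fld Y y) := by
  have : IsManifold (𝓡 (4 * n + 3)) 2 M := IsManifold.of_le (n := ∞) ENat.LEInfty.out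
  rw [D.torsion_apply (smooth_fld X y).diffAt (smooth_fld Y y).diffAt, fld_sub, fld_sub,
    Pi.sub_apply, Pi.sub_apply, fld_nabL, fld_nabL, bracket_apply]

lemma hfld_torsion (hDs : D.ContMDiffCovariantDerivative ∞) (X : Fields n P.W) (Y : HFields S P.W)
    (y : P.W) :
    hfld (P.prL hV (P.nabL hDs X (incl Y) - P.nabL hDs (incl Y) X - bracket X (incl Y))) y
      = torsionEnd S hV D y (fld X y) (hfld Y y) := by
  rw [hfld_prL, fld_torsion, fld_incl]
  rfl

lemma hfld_cov (hDs : D.ContMDiffCovariantDerivative ∞) (X : Fields n P.W) (Y : HFields S P.W)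
    (y : P.W) :
    hfld (P.prL hV (P.nabL hDs X (incl Y))) y = covH S hV D (hfld Y) y (fld X y) := by
  rw [hfld_prL, fld_nabL, fld_incl]
  rfl

lemma pr_bracket (hD : IsCanonicalConnection S hV D) (X Y : HFields S P.W) :
    P.prL hV (bracket (incl X) (incl Y))
      = P.prL hV (P.nabL hD.smooth (incl X) (incl Y))
        - P.prL hV (P.nabL hD.smooth (incl Y) (incl X)) := by
  have h : P.prL hV (P.nabL hD.smooth (incl X) (incl Y) - P.nabL hD.smooth (incl Y) (incl X)
      - bracket (incl X) (incl Y)) = 0 := by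
    refine ext_hfld fun y => ?_
    rw [hfld_torsion, torsionEnd, fld_incl, hfld_zero]
    refine (projH_eq_zero hV).2 ?_
    have := hD.torsion_H _ _ y (smooth_hfld X y).diffAt (smooth_hfld Y y).diffAt
    change D.torsion (y : M) (hfld X y : Tan n (y : M)) (hfld Y y : Tan n (y : M)) ∈ _
    rw [this]
    exact Submodule.neg_mem _ (Submodule.coe_mem _)
  rw [map_sub, map_sub] at h
  exact (sub_eq_zero.1 h).symm

lemma d_metric (hD : IsCanonicalConnection S hV D) (X : Fields n P.W) (Y Z : HFields S P.W) :
    P.derivL X (P.gL Y Z) = P.gL (P.prL hV (P.nabL hD.smooth X (incl Y))) Z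
      + P.gL Y (P.prL hV (P.nabL hD.smooth X (incl Z))) :=
  ext_fn fun y => by
    rw [derivL_apply, fn_deriv, dFun_congr (P.fn_gL_eventually Y Z y), fn_add, Pi.add_apply, fn_gL,
      fn_gL, hfld_cov, hfld_cov]
    exact hD.metric _ _ y (smooth_hfld Y y).diffAt (smooth_hfld Z y).diffAt _

lemma parallel_I (hD : IsCanonicalConnection S hV D) (X Z : Fields n P.W) (Y : HFields S P.W)
    (hZ : P.prL hV Z = 0) :
    P.prL hV (P.nabL hD.smooth X (incl (∑ s, P.etaL s Z • P.IL s Y)))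
        - ∑ s, P.etaL s Z • P.IL s (P.prL hV (P.nabL hD.smooth X (incl Y)))
      = ∑ s, P.etaL s (P.nabL hD.smooth X Z) • P.IL s Y := by
  refine ext_hfld fun y => ?_
  obtain ⟨Z', hZ'⟩ := P.vertical_field hV hZ
  have h := hD.parallel_identification P.W P.η P.I P.W.isOpen P.frame y y.2 Z' (hfld Y)
    (hZ' ▸ (smooth_fld Z y).diffAt) (smooth_hfld Y y).diffAt (fld X y)
  have hZy : ∀ z, (Z' z : Tan n z) = fld Z z := fun z => (congrFun hZ' z).symm
  rw [hfld_sub, Pi.sub_apply, hfld_cov, sum_etaL_smul_IL, sum_etaL_smul_IL, hfld_cov, fld_nabL, hZ',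
    ← h]
  simp only [toField, covH]
  congr 2
  -- The field ∑ η_s(Z) I_s Y of the module and the field φ(Z)Y of the axiom agree only near y,
  -- which suffices for the connection.
  refine congrArg (fun T => T (fld X y)) (connection_congr (smooth_hfld _ y) ?_).symm
  filter_upwards [P.W_mem_nhds y] with z hz
  have := P.sum_etaL_smul_IL Z Y ⟨z, hz⟩
  simp only [toField, hZy]
  exact (congrArg Subtype.val this).symm

/-- The contact algebra of the smooth functions and fields on a patch. -/
def contactAlgebra :
    ContactAlgebra (4 * n) (SmoothFun n P.W) (Fields n P.W) (HFields S P.W) where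
  d := P.derivL
  br := bracket
  br_skew := bracket_skew
  br_add_right := bracket_add_right
  br_smul_right := P.bracket_smul
  jacobi := bracket_jacobi
  d_br := P.derivL_bracket
  nab := P.nabL hD.smooth
  nab_smul X f Y := ext_fld fun y => by
    rw [fld_nabL, fld_smul, D_smul_apply (smooth_fn f y) (smooth_fld Y y), fld_add, fld_smul,
      fld_smul, Pi.add_apply, Pi.smul_apply', Pi.smul_apply', derivL_apply, fn_deriv, fld_nabL,
      add_comm]
  inc := incl
  pr := P.prL hV
  eta := P.etaL
  xi := P.xiL
  pr_inc := P.prL_incl hV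
  eta_inc := P.etaL_incl
  eta_xi s t := ext_fn fun y => by
    rw [fn_etaL, fld_xiL, P.η_ξ y y.2]
    split_ifs
    · rw [fn_apply]
      rfl
    · rw [fn_zero]
      rfl
  pr_xi s := ext_hfld fun y => by
    rw [hfld_prL, hfld_zero]
    exact (projH_eq_zero hV).2 (P.xi_mem s y)
  decomp := P.decompL hV
  g := P.gL
  g_symm X Y := ext_fn fun y => by
    rw [fn_gL, fn_gL]
    exact (S.g_symm y).eq _ _
  e := P.eL
  e' := P.eL'
  g_e_e' a b := ext_fn fun y => by
    rw [fn_gL, hfld_eL, hfld_eL', P.g_e_e' y y.2]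
    split_ifs
    · rw [fn_apply]
      rfl
    · rw [fn_zero]
      rfl
  expand := P.expandL
  I := P.IL
  I_sq s := by
    ext X
    refine ext_hfld fun y => ?_
    rw [Module.End.mul_apply, LinearMap.smul_apply, Module.End.one_apply, hfld_smul,
      Pi.smul_apply', hfld_IL, hfld_IL, fn_sg]
    exact LinearMap.congr_fun ((P.frame.isParaquaternionic y.2).sq s) _
  I_mul s := P.IL_relation (fun y => (P.frame.isParaquaternionic y.2).mul s) fun y => by
    rw [fn_neg, Pi.neg_apply, fn_sg]
  I_mul' s := P.IL_relation (fun y => (P.frame.isParaquaternionic y.2).mul' s) fun y => fn_sg _ y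
  I_skew s X Y := ext_fn fun y => by
    rw [fn_neg, Pi.neg_apply, fn_gL, fn_gL, hfld_IL, hfld_IL]
    exact (P.frame.isParaquaternionic y.2).skew s _ _
  eta_nab_inc s X Y := ext_fn fun y => by
    rw [fn_etaL, fld_nabL, fld_incl, fn_zero]
    exact (P.frame.mem_H_iff y y.2 _).1
      (hD.preserves_H _ _ (smooth_hfld Y y).diffAt _) s
  pr_nab X Z hZ := ext_hfld fun y => by
    obtain ⟨Z', hZ'⟩ := P.vertical_field hV hZ
    rw [hfld_prL, fld_nabL, hfld_zero, hZ']
    exact (projH_eq_zero hV).2 (hD.preserves_V Z' y (hZ' ▸ (smooth_fld Z y).diffAt) _)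
  d_g := P.d_metric hV hD
  parallel := P.parallel_I hV hD
  pr_br := P.pr_bracket hV hD
  eta_br := P.eta_bracket
  perp_I i s := ext_fn fun y => by
    have h := (hD.torsion_V y _ (P.xi_mem i y)).2 (P.I s y) (by
      rw [P.frame.PQ_eq y y.2]
      exact Submodule.subset_span ⟨s, rfl⟩)
    rw [endInner_frame (S.g_nondegenerate y) (S.g_symm y) (P.expand y.2)] at h
    rw [fn_sum, Finset.sum_apply, fn_zero]
    simp only [fn_gL, hfld_torsion, hfld_IL, hfld_eL, hfld_eL']
    exact h
  perp_sp i X Y K hK := ext_fn fun y => by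
    have h := (hD.torsion_V y _ (P.xi_mem i y)).sum_conj_skew (S.g_symm y)
      (P.frame.isParaquaternionic y.2) (P.frame.PQ_eq y y.2) (P.expand y.2) (hfld X y) (hfld Y y)
    simp only [hK, fn_sub, fn_sum, fn_mul, Pi.sub_apply, Finset.sum_apply, Pi.mul_apply, fn_sg,
      fn_gL, hfld_torsion, hfld_IL, fn_zero, Pi.zero_apply]
    exact h

end Patch

end PQC

end

noncomputable section

namespace PQC

open TopologicalSpace (Opens)

/-! ## Existence of patches -/

section SmoothMatrix

variable {n : ℕ} {M : Type*} [TopologicalSpace M] [ChartedSpace (Model n) M] {ι : Type*} [Fintype ι]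
  [DecidableEq ι]

lemma smoothFunAt_det {A : M → Matrix ι ι ℝ} {x : M}
    (hA : ∀ i j, SmoothFunAt n (fun y => A y i j) x) : SmoothFunAt n (fun y => (A y).det) x := by
  simp only [Matrix.det_apply']
  exact contMDiffAt_finsetSum fun σ _ =>
    contMDiffAt_const.mul (contMDiffAt_finsetProd fun i _ => hA _ _)

lemma smoothFunAt_inv {A : M → Matrix ι ι ℝ} {x : M}
    (hA : ∀ i j, SmoothFunAt n (fun y => A y i j) x) (h : (A x).det ≠ 0) (i j : ι) :
    SmoothFunAt n (fun y => (A y)⁻¹ i j) x := by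
  have h1 : SmoothFunAt n (fun y => (A y).adjugate i j) x := by
    simp only [Matrix.adjugate_apply]
    refine smoothFunAt_det fun k l => ?_
    by_cases hk : k = j
    · subst hk
      simp only [Matrix.updateRow_self]
      exact contMDiffAt_const
    · simp only [Matrix.updateRow_ne hk]
      exact hA k l
  have h2 : SmoothFunAt n (fun y => ((A y).det)⁻¹) x :=
    ContMDiffAt.inv₀ (smoothFunAt_det hA) h
  have h3 : (fun y => (A y)⁻¹ i j) = fun y => ((A y).det)⁻¹ * (A y).adjugate i j := by
    ext y
    rw [Matrix.inv_def, Matrix.smul_apply, smul_eq_mul, Ring.inverse_eq_inv']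
  rw [h3]
  exact h2.mul h1

end SmoothMatrix

section Existence

variable {n : ℕ} {M : Type*} [TopologicalSpace M] [ChartedSpace (Model n) M]
  [IsManifold (𝓡 (4 * n + 3)) ∞ M] {S : PQCStructure n M} {V : Π x : M, Submodule ℝ (Tan n x)}

lemma eventually_smooth_extend {x : M} (v : Tan n x) :
    ∀ᶠ y in nhds x, SmoothAt (FiberBundle.extend (Model n) v : Π y : M, Tan n y) y := by
  obtain ⟨s, hs, h⟩ := FiberBundle.exists_contMDiffOn_extend (k := ∞) (𝓡 (4 * n + 3)) (Model n)
    (V := fun y : M => TangentSpace (𝓡 (4 * n + 3)) y) v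
  filter_upwards [eventually_mem_nhds_iff.2 hs] with y hy
  exact h.contMDiffAt hy

lemma SmoothAt.sum {ι : Type*} {s : Finset ι} {X : ι → Π y : M, Tan n y} {x : M}
    (h : ∀ i ∈ s, SmoothAt (X i) x) : SmoothAt (∑ i ∈ s, X i) x := by
  classical
  induction s using Finset.induction_on with
  | empty => exact smoothAt_zero x
  | insert a s ha ih =>
    rw [Finset.sum_insert ha]
    exact (h a (Finset.mem_insert_self a s)).add
      (ih fun i hi => h i (Finset.mem_insert_of_mem hi))

variable {U : Set M} {η : Fin 3 → Π x : M, Tan n x →L[ℝ] ℝ}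
  {I : Fin 3 → Π x : M, Module.End ℝ (S.H x)} {ξ : Fin 3 → Π x : M, Tan n x}

lemma IsLocalFrame.mono {W : Set M} (h : IsLocalFrame S.toHorizontalData U η I) (hW : W ⊆ U) :
    IsLocalFrame S.toHorizontalData W η I where
  η_smooth s := (h.η_smooth s).mono hW
  I_smooth s x hx := h.I_smooth s x (hW hx)
  mem_H_iff x hx := h.mem_H_iff x (hW hx)
  PQ_eq x hx := h.PQ_eq x (hW hx)
  I₁_sq x hx := h.I₁_sq x (hW hx)
  I₂_sq x hx := h.I₂_sq x (hW hx)
  I₃_sq x hx := h.I₃_sq x (hW hx)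
  I₁_mul_I₂ x hx := h.I₁_mul_I₂ x (hW hx)
  I₂_mul_I₁ x hx := h.I₂_mul_I₁ x (hW hx)
  compatible s x hx := h.compatible s x (hW hx)
  contact s x hx := h.contact s x (hW hx)

/-- The vertical fields dual to local data are smooth. -/
lemma IsVertical.smoothAt_dual (hV : IsVertical S V) (hU : IsOpen U) (h : IsLocalFrame S.toHorizontalData U η I)
    (hξ : ∀ x ∈ U, ∀ s, ξ s x ∈ V x)
    (hηξ : ∀ x ∈ U, ∀ s t, η s x (ξ t x) = if s = t then 1 else 0) {x : M} (hx : x ∈ U)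
    (t : Fin 3) : SmoothAt (ξ t) x := by
  obtain ⟨U', hU', hxU', η', I', ξ', h', hR, hspan⟩ := hV.exists_reeb x
  -- The given vertical fields are expressed through the smooth Reeb fields ξ' spanning V. The
  -- coefficient matrix B is inverse to the smooth matrix A = η(ξ'), hence smooth by Cramer's rule.
  let A : M → Matrix (Fin 3) (Fin 3) ℝ := fun y => Matrix.of fun s r => η s y (ξ' r y)
  let B : M → Matrix (Fin 3) (Fin 3) ℝ := fun y => Matrix.of fun r t => η' r y (ξ t y)
  have hexp : ∀ y ∈ U, y ∈ U' → ∀ t, ξ t y = ∑ r, B y r t • ξ' r y := by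
    intro y hy hy' t
    have hm := hξ y hy t
    rw [hspan y hy'] at hm
    obtain ⟨c, hc⟩ := (Submodule.mem_span_range_iff_exists_fun ℝ).1 hm
    have : ∀ r, B y r t = c r := by
      intro r
      simp only [B, Matrix.of_apply, ← hc]
      simp [hR.dual y hy']
    simp only [this, hc]
  have hAB : ∀ y ∈ U, y ∈ U' → A y * B y = 1 := by
    intro y hy hy'
    ext s t
    rw [Matrix.one_apply, ← hηξ y hy s t]
    conv_rhs => rw [hexp y hy hy' t]
    rw [Matrix.mul_apply, map_sum]
    refine Finset.sum_congr rfl fun r _ => ?_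
    rw [map_smul, smul_eq_mul, mul_comm]
    rfl
  have hA : ∀ s r, SmoothFunAt n (fun y => A y s r) x := fun s r =>
    (h.η_smooth s).apply (hU.mem_nhds hx) (hR.smooth r x hxU')
  have hdet : (A x).det ≠ 0 := fun h0 => by
    have := congrArg Matrix.det (hAB x hx hxU')
    rw [Matrix.det_mul, h0, zero_mul, Matrix.det_one] at this
    exact zero_ne_one this
  have hs : SmoothAt (∑ r, (fun y => (A y)⁻¹ r t) • ξ' r) x := SmoothAt.sum fun r _ =>
    SmoothAt.smul (smoothFunAt_inv hA hdet r t) (hR.smooth r x hxU')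
  refine hs.congr ?_
  filter_upwards [hU.mem_nhds hx, hU'.mem_nhds hxU'] with y hy hy'
  rw [Finset.sum_apply, hexp y hy hy' t]
  simp only [Pi.smul_apply', Matrix.inv_eq_right_inv (hAB y hy hy')]

/-- Local data extend to a patch near every point. -/
lemma exists_patch (hV : IsVertical S V) (hU : IsOpen U) (h : IsLocalFrame S.toHorizontalData U η I)
    (hξ : ∀ x ∈ U, ∀ s, ξ s x ∈ V x)
    (hηξ : ∀ x ∈ U, ∀ s t, η s x (ξ t x) = if s = t then 1 else 0) {x : M} (hx : x ∈ U) :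
    ∃ P : Patch S V, x ∈ P.W ∧ P.η = η ∧ P.I = I ∧ P.ξ = ξ := by
  let b := Module.finBasisOfFinrankEq ℝ (S.H x) (S.finrank_H x)
  let e : Fin (4 * n) → Π y, S.H y := fun a => extendH S hV (b a)
  -- Gram matrix of the projected extensions of a basis at x. It is invertible at x by
  -- nondegeneracy, hence near x, and its inverse produces the dual frame.
  let G : M → Matrix (Fin (4 * n)) (Fin (4 * n)) ℝ := fun y =>
    Matrix.of fun a c => S.g y (e a y) (e c y)
  have he : ∀ᶠ y in nhds x, ∀ a, SmoothAt (toField (e a)) y := by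
    rw [Filter.eventually_all]
    intro a
    filter_upwards [eventually_smooth_extend (b a : Tan n x), hU.mem_nhds hx] with y hy hyU
    exact SmoothAt.projH hV h hξ hηξ (hU.mem_nhds hyU)
      (fun s => hV.smoothAt_dual hU h hξ hηξ hyU s) hy
  have hG : ∀ y, (∀ a, SmoothAt (toField (e a)) y) → ∀ a c, SmoothFunAt n (fun z => G z a c) y :=
    fun y hy a c => S.g_smooth _ _ y (hy a) (hy c)
  have hdet : (G x).det ≠ 0 := by
    have : G x = LinearMap.BilinForm.toMatrix b (S.g x) := by
      ext a c
      rw [LinearMap.BilinForm.toMatrix_apply]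
      simp only [G, e, Matrix.of_apply, extendH, FiberBundle.extend_apply_self, projH_coe]
    rw [this]
    exact (LinearMap.BilinForm.nondegenerate_iff_det_ne_zero b).1 (S.g_nondegenerate x)
  have hdet' : ∀ᶠ y in nhds x, (G y).det ≠ 0 :=
    (smoothFunAt_det (hG x he.self_of_nhds)).continuousAt.eventually_ne hdet
  obtain ⟨W, hW, hWo, hxW⟩ := eventually_nhds_iff.1 (he.and (hdet'.and (hU.mem_nhds hx)))
  have hWU : W ⊆ U := fun y hy => (hW y hy).2.2
  refine ⟨{ W := ⟨W, hWo⟩, η := η, I := I, ξ := ξ, e := e,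
            e' := fun c => ∑ d, (fun y => (G y)⁻¹ d c) • e d
            frame := h.mono hWU
            ξ_mem := fun y hy => hξ y (hWU hy)
            η_ξ := fun y hy => hηξ y (hWU hy)
            ξ_smooth := fun s y hy => hV.smoothAt_dual hU h hξ hηξ (hWU hy) s
            e_smooth := fun a y hy => (hW y hy).1 a
            e'_smooth := fun c y hy => ?_
            g_e_e' := fun y hy a c => ?_ }, hxW, rfl, rfl, rfl⟩
  · have hs : SmoothAt (∑ d, (fun y => (G y)⁻¹ d c) • toField (e d)) y := SmoothAt.sum fun d _ =>
      SmoothAt.smul (smoothFunAt_inv (hG y (hW y hy).1) (hW y hy).2.1 d c) ((hW y hy).1 d)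
    refine hs.congr (.of_forall fun z => ?_)
    simp [toField]
  · have := congrFun (congrFun (Matrix.mul_nonsing_inv (G y) (hW y hy).2.1.isUnit) a) c
    rw [Matrix.mul_apply, Matrix.one_apply] at this
    rw [← this, Finset.sum_apply, map_sum]
    refine Finset.sum_congr rfl fun d _ => ?_
    rw [Pi.smul_apply', map_smul, smul_eq_mul, mul_comm]
    rfl

end Existence

end PQC

end

noncomputable section

namespace PQC

open TopologicalSpace (Opens)

/-! ### Curvature and covariant derivatives as bilinear forms. -/

namespace ContactAlgebra

variable {N : ℕ} {A L H : Type*} [CommRing A] [Algebra ℝ A] [AddCommGroup L]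
    [Module A L] [AddCommGroup H] [Module A H] (C : ContactAlgebra N A L H)

lemma div_algebraMap_smul (r : ℝ) (P : Module.End A H) (X : H) :
    C.div (algebraMap ℝ A r • P) X = algebraMap ℝ A r * C.div P X := by
  simp only [div, covEnd_smul, Derivation.map_algebraMap, zero_smul, zero_add, LinearMap.smul_apply,
    map_smul, smul_eq_mul, Finset.mul_sum]

/-- The covariant derivative of an endomorphism as a bilinear form. -/
def covForm (P : Module.End A H) (X : H) : LinearMap.BilinForm A H :=
  LinearMap.mk₂ A (fun V Y => C.g (C.covEnd (C.inc V) P Y) X)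
    (fun V V' Y => by rw [map_add, covEnd_add_left]; simp)
    (fun f V Y => by rw [map_smul, covEnd_smul_left]; simp)
    (fun V Y Y' => by simp) (fun f V Y => by simp)

/-- The curvature `g(R(X, Y)Z, W)` as a bilinear form in `X` and `W`. -/
def curForm (Y Z : H) : LinearMap.BilinForm A H :=
  LinearMap.mk₂ A (fun X W => C.g (C.curH (C.inc X) (C.inc Y) Z) W)
    (fun V V' Y => by simp) (fun f V Y => by simp)
    (fun V Y Y' => by simp) (fun f V Y => by simp)

/-- The Ricci form. -/
def ricForm : LinearMap.BilinForm A H :=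
  LinearMap.mk₂ A (fun Y Z => ∑ a, C.curForm Y Z (C.e a) (C.e' a))
    (fun V V' Y => by simp [curForm, Finset.sum_add_distrib])
    (fun f V Y => by simp [curForm, Finset.mul_sum])
    (fun V Y Y' => by simp [curForm, Finset.sum_add_distrib])
    (fun f V Y => by simp [curForm, Finset.mul_sum])

end ContactAlgebra

/-- The extension of a tangent vector to a vector field. -/
abbrev extendTan {n : ℕ} {M : Type*} [TopologicalSpace M] [ChartedSpace (Model n) M]
    [IsManifold (𝓡 (4 * n + 3)) ∞ M] {x : M} (u : Tan n x) : Π z : M, Tan n z :=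
  FiberBundle.extend (Model n) (E := fun z : M => TangentSpace (𝓡 (4 * n + 3)) z) u

lemma extendTan_self {n : ℕ} {M : Type*} [TopologicalSpace M] [ChartedSpace (Model n) M]
    [IsManifold (𝓡 (4 * n + 3)) ∞ M] {x : M} (u : Tan n x) : extendTan u x = u := FiberBundle.extend_apply_self _ _

namespace Patch

variable {n : ℕ} {M : Type*} [TopologicalSpace M] [ChartedSpace (Model n) M]
  [IsManifold (𝓡 (4 * n + 3)) ∞ M] {S : PQCStructure n M} {V : Π x : M, Submodule ℝ (Tan n x)}
  (P : Patch S V) (hV : IsVertical S V)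

/-! ### Pointwise evaluation of tensors -/

/-- Tensoriality: expanding in the frame e_a, ξ_s and pulling out the coefficients shows that the
value at y depends on the field only through its value at y. -/
lemma fn_linear_congr (Φ : Fields n P.W →ₗ[SmoothFun n P.W] SmoothFun n P.W) {X X' : Fields n P.W}
    {y : P.W} (hV : IsVertical S V) (h : fld X y = fld X' y) : fn (Φ X) y = fn (Φ X') y := by
  have key : ∀ X, fn (Φ X) y =
      ∑ a, S.g y (projH S hV y (fld X y)) (P.e' a y) * fn (Φ (incl (P.eL a))) y
        + ∑ s, P.η s y (fld X y) * fn (Φ (P.xiL s)) y := by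
    intro X
    conv_lhs => rw [P.decompL hV X, ← P.expandL (P.prL hV X)]
    simp only [map_add, map_sum, map_smul, fn_add, fn_sum, Pi.add_apply, Finset.sum_apply,
      smul_eq_mul, fn_mul, Pi.mul_apply, fn_gL, hfld_prL, hfld_eL', fn_etaL]
  rw [key X, key X', h]

lemma fn_linear_congr' (Φ : HFields S P.W →ₗ[SmoothFun n P.W] SmoothFun n P.W)
    {X X' : HFields S P.W} {y : P.W} (hV : IsVertical S V) (h : hfld X y = hfld X' y) :
    fn (Φ X) y = fn (Φ X') y := by
  have := P.fn_linear_congr (Φ ∘ₗ P.prL hV) hV (X := incl X) (X' := incl X') (y := y) (by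
    rw [fld_incl, fld_incl, toField, toField, h])
  simpa only [LinearMap.comp_apply, prL_incl] using this

/-- A field with prescribed value at a point and constant coefficients. -/
def constH (y : P.W) (u : S.H (y : M)) : HFields S P.W :=
  ∑ a, algebraMap ℝ (SmoothFun n P.W) (S.g y u (P.e' a y)) • P.eL a

lemma hfld_constH (y : P.W) (u : S.H (y : M)) : hfld (P.constH y u) y = u := by
  rw [constH, hfld_sum, Finset.sum_apply]
  simp only [hfld_smul, Pi.smul_apply', fn_algebraMap, hfld_eL]
  exact P.expand y.2 u

lemma constH_add (y : P.W) (u v : S.H (y : M)) :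
    P.constH y (u + v) = P.constH y u + P.constH y v := by
  simp only [constH, map_add, LinearMap.add_apply, add_smul, Finset.sum_add_distrib]

lemma constH_smul (y : P.W) (c : ℝ) (u : S.H (y : M)) :
    P.constH y (c • u) = algebraMap ℝ (SmoothFun n P.W) c • P.constH y u := by
  simp only [constH, map_smul, LinearMap.smul_apply, smul_eq_mul, map_mul, mul_smul,
    Finset.smul_sum]

/-- T is merely a function of pairs of vectors; its bilinearity is recovered by evaluating B on
fields that depend linearly on their prescribed value. -/
lemma metricTrace_eq_sum (B : LinearMap.BilinForm (SmoothFun n P.W) (HFields S P.W)) (y : P.W)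
    {T : S.H (y : M) → S.H (y : M) → ℝ}
    (hT : ∀ X Y : HFields S P.W, T (hfld X y) (hfld Y y) = fn (B X Y) y) :
    metricTrace (S.g y) (S.g_nondegenerate y) T = fn (∑ a, B (P.eL a) (P.eL' a)) y := by
  have hT' : ∀ u v, T u v = fn (B (P.constH y u) (P.constH y v)) y := fun u v => by
    rw [← hT, hfld_constH, hfld_constH]
  let T' : LinearMap.BilinForm ℝ (S.H (y : M)) := LinearMap.mk₂ ℝ T
    (fun u u' v => by
      rw [hT', hT', hT', constH_add, map_add, LinearMap.add_apply, fn_add, Pi.add_apply])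
    (fun c u v => by
      rw [hT', hT', constH_smul, map_smul, LinearMap.smul_apply, smul_eq_mul, fn_mul, Pi.mul_apply,
        fn_algebraMap, smul_eq_mul])
    (fun u v v' => by rw [hT', hT', hT', constH_add, map_add, fn_add, Pi.add_apply])
    (fun c u v => by
      rw [hT', hT', constH_smul, map_smul, smul_eq_mul, fn_mul, Pi.mul_apply, fn_algebraMap,
        smul_eq_mul])
  have h := metricTrace_frame (S.g_nondegenerate y) (S.g_symm y) (P.expand y.2) T'
  refine h.trans ?_
  rw [fn_sum, Finset.sum_apply]
  refine Finset.sum_congr rfl fun a _ => ?_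
  rw [← hT, hfld_eL, hfld_eL']
  rfl

variable [T2Space M]

lemma exists_fld_eventuallyEq {y : P.W} {F : Π z : M, Tan n z}
    (hF : ∀ᶠ z in nhds (y : M), SmoothAt F z) :
    ∃ X : Fields n P.W, fld X =ᶠ[nhds (y : M)] F := by
  obtain ⟨f, hf, hs⟩ := exists_cutoff hF
  refine ⟨mkFld (f • F) fun z => hs z, (fld_mkFld _ _ y).trans ?_⟩
  exact hf.mono fun z hz => by rw [Pi.smul_apply', hz, one_smul]

lemma exists_hfld_eventuallyEq {y : P.W} {F : Π z : M, S.H z}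
    (hF : ∀ᶠ z in nhds (y : M), SmoothAt (toField F) z) :
    ∃ X : HFields S P.W, ∀ᶠ z in nhds (y : M), hfld X z = F z := by
  obtain ⟨f, hf, hs⟩ := exists_cutoff hF
  refine ⟨mkHFld (f • F) fun z => hs z, ?_⟩
  filter_upwards [hf, hfld_mkHFld (f • F) (fun z => hs z) y] with z hz hz'
  rw [hz', Pi.smul_apply', hz, one_smul]

lemma exists_hfld_extendH (y : P.W) (u : S.H (y : M)) :
    ∃ X : HFields S P.W, ∀ᶠ z in nhds (y : M), hfld X z = extendH S hV u z := by
  refine P.exists_hfld_eventuallyEq ?_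
  filter_upwards [eventually_smooth_extend (u : Tan n (y : M)), P.W_mem_nhds y] with z hz hzW
  exact P.smooth_projH hV (y := ⟨z, hzW⟩) hz

variable {D : Connection n M} (hD : IsCanonicalConnection S hV D)

lemma fld_cur (X Y Z : Fields n P.W) (y : P.W) :
    fld ((P.contactAlgebra hV hD).cur X Y Z) y =
      D (fun z => D (fld Z) z (fld Y z)) y (fld X y) - D (fun z => D (fld Z) z (fld X z)) y (fld Y y)
        - D (fld Z) y (mlieBracket (𝓡 (4 * n + 3)) (fld X) (fld Y) y) := by
  change fld (connect hD.smooth X (connect hD.smooth Y Z)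
    - connect hD.smooth Y (connect hD.smooth X Z) - connect hD.smooth (bracket X Y) Z) y = _
  rw [fld_sub, fld_sub, Pi.sub_apply, Pi.sub_apply, connect_apply, connect_apply, connect_apply,
    bracket_apply, connection_congr (smooth_fld _ y) (fld_connect hD.smooth Y Z y).symm,
    connection_congr (smooth_fld _ y) (fld_connect hD.smooth X Z y).symm]

/-- The pointwise curvature uses particular extensions of the vectors. Fields on the patch with the
same germs give the same value, as each operator in the formula is local. -/
lemma fld_cur_of_eventuallyEq {X Y Z : Fields n P.W} {y : P.W} {u v w : Tan n (y : M)}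
    (hX : fld X =ᶠ[nhds (y : M)] extendTan u)
    (hY : fld Y =ᶠ[nhds (y : M)] extendTan v)
    (hZ : fld Z =ᶠ[nhds (y : M)] extendTan w) :
    fld ((P.contactAlgebra hV hD).cur X Y Z) y = curvature D y u v w := by
  have hXy : fld X y = u := hX.eq_of_nhds.trans (extendTan_self _)
  have hYy : fld Y y = v := hY.eq_of_nhds.trans (extendTan_self _)
  have hZs : ∀ᶠ z in nhds (y : M),
      D (extendTan w) z = D (fld Z) z := by
    filter_upwards [hZ.eventually_nhds, P.W_mem_nhds y] with z hz hzW
    exact connection_congr (smooth_fld Z ⟨z, hzW⟩) (Filter.EventuallyEq.symm hz)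
  have h : ∀ {X : Fields n P.W} {u : Tan n (y : M)},
      fld X =ᶠ[nhds (y : M)] extendTan u →
      D (fun z => D (extendTan w) z
        (extendTan u z)) y
      = D (fun z => D (fld Z) z (fld X z)) y := by
    intro X u hX
    refine connection_congr (smoothAt_connection hD.smooth (smooth_fld X y)
      (eventually_smooth_fld Z y)) ?_
    filter_upwards [hZs, hX] with z h1 h2
    rw [h1, h2]
  rw [fld_cur]
  simp only [curvature]
  rw [h hX, h hY, hZs.self_of_nhds, hXy, hYy, mlieBracket_congr hX hY]

/-- Choose fields on the patch with the germs of the extensions, then exchange them one at a time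
for X, Y, Z by tensoriality. -/
lemma g_curvature (X Y Z W : HFields S P.W) (y : P.W) :
    S.g y (projH S hV y (curvature D y (hfld X y : Tan n (y : M)) (hfld Y y : Tan n (y : M))
      (hfld Z y : Tan n (y : M)))) (hfld W y)
      = fn ((P.contactAlgebra hV hD).curForm Y Z X W) y := by
  set C := P.contactAlgebra hV hD with hC
  obtain ⟨X', hX'⟩ := P.exists_fld_eventuallyEq
    (eventually_smooth_extend (hfld X y : Tan n (y : M)))
  obtain ⟨Y', hY'⟩ := P.exists_fld_eventuallyEq
    (eventually_smooth_extend (hfld Y y : Tan n (y : M)))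
  obtain ⟨Z', hZ'⟩ := P.exists_fld_eventuallyEq
    (eventually_smooth_extend (hfld Z y : Tan n (y : M)))
  have hv : ∀ {X' : Fields n P.W} {X : HFields S P.W},
      fld X' =ᶠ[nhds (y : M)] extendTan (hfld X y : Tan n (y : M)) →
      fld (incl X) y = fld X' y := by
    intro X' X h
    rw [h.eq_of_nhds, fld_incl]
    exact (extendTan_self _).symm
  rw [← P.fld_cur_of_eventuallyEq hV hD hX' hY' hZ', ← hfld_prL, ← fn_gL]
  let φ : Fields n P.W →ₗ[SmoothFun n P.W] SmoothFun n P.W := P.gL.flip W ∘ₗ P.prL hV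
  have h1 := P.fn_linear_congr (φ ∘ₗ (C.cur.flip (incl Y)).flip (incl Z)) hV (hv hX')
  have h2 := P.fn_linear_congr (φ ∘ₗ (C.cur X').flip (incl Z)) hV (hv hY')
  have h3 := P.fn_linear_congr (φ ∘ₗ C.cur X' Y') hV (hv hZ')
  exact (h1.trans (h2.trans h3)).symm

lemma pqcRic_eq (Y Z : HFields S P.W) (y : P.W) :
    pqcRic S hV D y (hfld Y y) (hfld Z y) = fn ((P.contactAlgebra hV hD).ricForm Y Z) y :=
  P.metricTrace_eq_sum ((P.contactAlgebra hV hD).curForm Y Z) y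
    fun X W => P.g_curvature hV hD X Y Z W y

lemma pqcScal_eq (y : P.W) : pqcScal S hV D y = fn (P.contactAlgebra hV hD).scal y :=
  P.metricTrace_eq_sum (P.contactAlgebra hV hD).ricForm y fun Y Z => P.pqcRic_eq hV hD Y Z y

lemma dFun_pqcScal (X : HFields S P.W) (y : P.W) :
    dFun (pqcScal S hV D) y (hfld X y : Tan n (y : M)) = fn ((P.contactAlgebra hV hD).d (incl X)
      (P.contactAlgebra hV hD).scal) y := by
  rw [dFun_congr (f' := fn (P.contactAlgebra hV hD).scal)]
  · change _ = fn (P.deriv _ _) y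
    rw [fn_deriv, fld_incl]
    rfl
  · filter_upwards [P.W_mem_nhds y] with z hz
    exact P.pqcScal_eq hV hD ⟨z, hz⟩

/-- For fields with the germs of the extensions, ∇g = 0 turns the Leibniz formula into g((∇Φ)X, Y).
Tensoriality then replaces them by the given X and Y. -/
lemma covTensor_eq {T : Π x, S.H x → S.H x → ℝ}
    {Φ : Module.End (SmoothFun n P.W) (HFields S P.W)}
    (hT : ∀ (X Y : HFields S P.W) (y : P.W), T y (hfld X y) (hfld Y y) = fn (P.gL (Φ X) Y) y)
    (Z X Y : HFields S P.W) (y : P.W) :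
    covTensor S hV D T y (hfld Z y : Tan n (y : M)) (hfld X y) (hfld Y y)
      = fn ((P.contactAlgebra hV hD).covForm Φ Y Z X) y := by
  set C := P.contactAlgebra hV hD with hC
  obtain ⟨X', hX'⟩ := P.exists_hfld_extendH hV y (hfld X y)
  obtain ⟨Y', hY'⟩ := P.exists_hfld_extendH hV y (hfld Y y)
  have hv : ∀ {X' X : HFields S P.W}, (∀ᶠ z in nhds (y : M), hfld X' z
      = extendH S hV (hfld X y) z) → hfld X y = hfld X' y := by
    intro X' X h
    rw [h.self_of_nhds, extendH, FiberBundle.extend_apply_self, projH_coe]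
  have hc : ∀ {X' X : HFields S P.W}, (∀ᶠ z in nhds (y : M), hfld X' z
      = extendH S hV (hfld X y) z) → covH S hV D (extendH S hV (hfld X y)) y
        (hfld Z y : Tan n (y : M)) = hfld (C.cov (incl Z) X') y := by
    intro X' X h
    refine Eq.trans ?_ (P.hfld_cov hV hD.smooth (incl Z) X' y).symm
    rw [covH, covH, fld_incl,
      connection_congr (Y := toField (extendH S hV (hfld X y))) (smooth_hfld X' y)
        (h.mono fun z hz => (congrArg Subtype.val hz).symm)]
    rfl
  have h1 : fn (C.covForm Φ Y Z X) y = fn (C.covForm Φ Y' Z X') y := by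
    have h2 := P.fn_linear_congr' (C.covForm Φ Y Z) hV (hv hX')
    rw [h2]
    change fn (P.gL _ Y) y = fn (P.gL _ Y') y
    rw [fn_gL, fn_gL, hv hY']
  have h2 : C.covForm Φ Y' Z X' = C.d (incl Z) (P.gL (Φ X') Y')
      - P.gL (Φ (C.cov (incl Z) X')) Y' - P.gL (Φ X') (C.cov (incl Z) Y') := by
    have h3 : C.d (incl Z) (P.gL (Φ X') Y') = P.gL (C.cov (incl Z) (Φ X')) Y'
      + P.gL (Φ X') (C.cov (incl Z) Y') := C.d_g (incl Z) (Φ X') Y'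
    rw [h3]
    change P.gL (C.cov (incl Z) (Φ X') - Φ (C.cov (incl Z) X')) Y' = _
    rw [map_sub, LinearMap.sub_apply]
    ring
  rw [h1, h2, fn_sub, fn_sub, Pi.sub_apply, Pi.sub_apply, ← hT, ← hT, covTensor, hc hX', hc hY',
    ← hv hX', ← hv hY']
  congr 2
  change _ = fn (P.deriv (incl Z) (P.gL (Φ X') Y')) y
  rw [fn_deriv, fld_incl]
  refine dFun_congr ?_ _
  filter_upwards [P.W_mem_nhds y, hX', hY'] with z hz h1 h2
  rw [← h1, ← h2]
  exact hT X' Y' ⟨z, hz⟩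

lemma divergence_eq {T : Π x, S.H x → S.H x → ℝ}
    {Φ : Module.End (SmoothFun n P.W) (HFields S P.W)}
    (hT : ∀ (X Y : HFields S P.W) (y : P.W), T y (hfld X y) (hfld Y y) = fn (P.gL (Φ X) Y) y)
    (X : HFields S P.W) (y : P.W) :
    divergence S hV D T y (hfld X y) = fn ((P.contactAlgebra hV hD).div Φ X) y :=
  P.metricTrace_eq_sum ((P.contactAlgebra hV hD).covForm Φ X) y
    fun Z Y => P.covTensor_eq hV hD hT Z Y X y

end Patch

end PQC

end

noncomputable section

namespace PQC

open TopologicalSpace (Opens)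

/-! ## The torsion in dimension seven -/

section DimensionSeven

variable {E : Type*} [AddCommGroup E] [Module ℝ E]

lemma IsNeutral.exists_ne_zero {g : LinearMap.BilinForm ℝ E} {m : ℕ} (hg : IsNeutral g m)
    (hm : 0 < m) : ∃ v, g v v ≠ 0 := by
  obtain ⟨P, -, hP, -, -, hpos, -⟩ := hg
  have : Nontrivial P := Module.nontrivial_of_finrank_pos (R := ℝ) (by omega)
  obtain ⟨v, hv⟩ := exists_ne (0 : P)
  exact ⟨v, (hpos v v.2 (by simpa using hv)).ne'⟩

variable {g : LinearMap.BilinForm ℝ E} {J : Fin 3 → Module.End ℝ E}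

namespace IsParaquaternionic

lemma apply_apply (hJ : IsParaquaternionic g J) (s : Fin 3) (v : E) : J s (J s v) = eps s • v :=
  LinearMap.congr_fun (hJ.sq s) v

lemma apply_succ (hJ : IsParaquaternionic g J) (s : Fin 3) (v : E) :
    J s (J (s + 1) v) = -eps (s + 2) • J (s + 2) v :=
  LinearMap.congr_fun (hJ.mul s) v

lemma succ_apply (hJ : IsParaquaternionic g J) (s : Fin 3) (v : E) :
    J (s + 1) (J s v) = eps (s + 2) • J (s + 2) v :=
  LinearMap.congr_fun (hJ.mul' s) v

lemma apply_succ_succ (hJ : IsParaquaternionic g J) (s : Fin 3) (v : E) :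
    J s (J (s + 2) v) = eps (s + 1) • J (s + 1) v := by
  have h := hJ.succ_apply (s + 2) v
  rwa [show s + 2 + 1 = s by omega, show s + 2 + 2 = s + 1 by omega] at h

lemma succ_succ_apply (hJ : IsParaquaternionic g J) (s : Fin 3) (v : E) :
    J (s + 2) (J s v) = -eps (s + 1) • J (s + 1) v := by
  have h := hJ.apply_succ (s + 2) v
  rwa [show s + 2 + 1 = s by omega, show s + 2 + 2 = s + 1 by omega] at h

lemma g_self_apply (hJ : IsParaquaternionic g J) (hs : g.IsSymm) (s : Fin 3) (v : E) :
    g v (J s v) = 0 := by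
  have h := hJ.skew s v v
  rw [hs.eq (J s v) v] at h
  linarith

lemma g_apply_apply (hJ : IsParaquaternionic g J) (hs : g.IsSymm) (s t : Fin 3) (v : E) :
    g (J s v) (J t v) = if s = t then -eps s * g v v else 0 := by
  obtain rfl | rfl | rfl : t = s ∨ t = s + 1 ∨ t = s + 2 := by omega
  · rw [if_pos rfl, hJ.skew, hJ.apply_apply, map_smul, smul_eq_mul, neg_mul]
  · rw [if_neg (by omega), hJ.skew, hJ.apply_succ, map_smul, hJ.g_self_apply hs, smul_zero,
      neg_zero]
  · rw [if_neg (by omega), hJ.skew, hJ.apply_succ_succ, map_smul, hJ.g_self_apply hs, smul_zero,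
      neg_zero]

end IsParaquaternionic

/-- In dimension four v, J_1 v, J_2 v, J_3 v is an orthogonal basis. Let K be the skew form of T.
Orthogonality to sp(1,ℝ) equates K(v, J_s v) with a signed K(J_{s+1} v, J_{s+2} v), and
orthogonality to Q gives the same equation with the opposite sign. So every component vanishes: the
two summands exhaust the skew endomorphisms. -/
lemma MemSpPerp.skew_eq_zero [FiniteDimensional ℝ E] {hg : g.Nondegenerate} (hs : g.IsSymm)
    (hJ : IsParaquaternionic g J) {T : Module.End ℝ E} {Q : Submodule ℝ (Module.End ℝ E)}
    (hT : MemSpPerp g hg Q T) (hQ : Q = Submodule.span ℝ (Set.range J))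
    (hE : Module.finrank ℝ E = 4) {v : E} (hv : g v v ≠ 0) (u w : E) :
    g (T u) w - g (T w) u = 0 := by
  let e : Option (Fin 3) → E := fun a => a.elim v fun s => J s v
  -- The factors are the inverses of g(v, v) and of g(J_s v, J_s v) = -ε_s g(v, v).
  let e' : Option (Fin 3) → E := fun a =>
    a.elim ((g v v)⁻¹ • v) fun s => (-eps s * (g v v)⁻¹) • J s v
  have hd : ∀ a b, g (e a) (e' b) = if a = b then 1 else 0 := by
    rintro (_ | s) (_ | t)
    · simp [e, e', hv]
    · simp [e, e', hJ.g_self_apply hs]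
    · simp [e, e', hs.eq _ v, hJ.g_self_apply hs]
    · simp only [e, e', Option.elim_some, map_smul, smul_eq_mul, hJ.g_apply_apply hs,
        Option.some.injEq]
      split_ifs with h
      · subst h
        field_simp
        linear_combination eps_mul_self s
      · rw [mul_zero]
  have hexp := sum_dual_smul hd (by simp [hE])
  let K : LinearMap.BilinForm ℝ E := g ∘ₗ T - (g ∘ₗ T).flip
  have hK : ∀ u w, K u w = g (T u) w - g (T w) u := fun _ _ => rfl
  have hKs : ∀ u w, K u w = -K w u := fun u w => by rw [hK, hK]; ring
  have h1 : ∀ s, K v (J s v) = eps (s + 1) * eps (s + 2) * K (J (s + 1) v) (J (s + 2) v) := by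
    intro s
    have h := hT.sum_conj_skew hs hJ hQ hexp v (J s v)
    simp only [← hK] at h
    rw [sum_cyclic _ s, hJ.apply_apply, hJ.succ_apply, hJ.succ_succ_apply, map_smul, map_smul,
      map_smul, hKs (J s v) v, hKs (J (s + 2) v)] at h
    simp only [smul_eq_mul] at h
    linear_combination h / 2 - K v (J s v) / 2 * eps_mul_self s
  have h2 : ∀ s, K v (J s v) = -(eps (s + 1) * eps (s + 2) * K (J (s + 1) v) (J (s + 2) v)) := by
    intro s
    have h := hT.2 (J s) (by rw [hQ]; exact Submodule.subset_span ⟨s, rfl⟩)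
    rw [endInner_frame hg hs hexp, Fintype.sum_option, sum_cyclic _ s] at h
    simp only [e, e', Option.elim_some, Option.elim_none, map_smul, smul_eq_mul, hJ.apply_apply,
      hJ.apply_succ, hJ.apply_succ_succ] at h
    rw [hK, hK]
    have h3 := eps_mul_self s
    field_simp at h
    linear_combination h + g (T (J s v)) v * h3
  have h3 : ∀ s, K v (J s v) = 0 := fun s => by linarith [h1 s, h2 s]
  have h4 : ∀ s, K (J (s + 1) v) (J (s + 2) v) = 0 := by
    intro s
    have h := h1 s
    rw [h3] at h
    linear_combination -eps (s + 1) * eps (s + 2) * h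
      - K (J (s + 1) v) (J (s + 2) v) * (eps_mul_self (s + 1) * eps (s + 2) ^ 2
        + eps_mul_self (s + 2))
  have h5 : ∀ s t, K (J s v) (J t v) = 0 := by
    intro s t
    obtain rfl | rfl | rfl : t = s ∨ t = s + 1 ∨ t = s + 2 := by omega
    · rw [hK, sub_self]
    · have h := h4 (s + 2)
      rwa [show s + 2 + 1 = s by omega, show s + 2 + 2 = s + 1 by omega] at h
    · have h := h4 (s + 1)
      rw [show s + 1 + 1 = s + 2 by omega, show s + 1 + 2 = s by omega] at h
      rw [hKs, h, neg_zero]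
  have h6 : ∀ a b, K (e a) (e b) = 0 := by
    rintro (_ | s) (_ | t)
    · change K v v = 0
      rw [hK, sub_self]
    · exact h3 t
    · change K (J s v) v = 0
      rw [hKs, h3, neg_zero]
    · exact h5 s t
  rw [← hK, ← hexp u, ← hexp w]
  simp [h6]

end DimensionSeven

end PQC

end

noncomputable section

namespace PQC

open TopologicalSpace (Opens)

/-! ### From the algebraic identity to τ, μ and Scal. -/

namespace ContactAlgebra

variable {N : ℕ} {A L H : Type*} [CommRing A] [Algebra ℝ A] [AddCommGroup L]
    [Module A L] [AddCommGroup H] [Module A H] (C : ContactAlgebra N A L H)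

lemma g_tau2 (X Y : H) : C.g (C.tau2 X) Y =
    -∑ s, sg A s * (C.g (C.T s (C.I s X)) Y + C.g (C.T s Y) (C.I s X)) := by
  simp only [tau2, LinearMap.neg_apply, LinearMap.sum_apply, LinearMap.smul_apply, map_neg, map_sum,
    map_smul, smul_eq_mul, Module.End.mul_apply, P, LinearMap.add_apply, map_add, g_adj,
    C.g_symm (C.T _ Y)]

/-- U is defined with I_i on the left of the skew torsion, μ with I_i on its argument; they agree
because I_i commutes with Q_i. -/
lemma g_U (hN : 4 < N) (i : Fin 3) (X Y : H) : C.g (C.U i X) Y =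
    sg A i * (C.g (C.T i (C.I i X)) Y - C.g (C.T i Y) (C.I i X)) := by
  rw [U, I_mul_Q C hN, C.g_symm (C.T _ Y)]
  simp only [LinearMap.smul_apply, map_smul, smul_eq_mul, Module.End.mul_apply, Q,
    LinearMap.sub_apply, map_sub, g_adj]

/-- The factor 8n(n+2) relating Scal and Λ is multiplied out, so that no division is needed in the
ring of functions. -/
theorem contracted_bianchi_scal (hN : 4 < N) {n : ℕ} (hn : N = 4 * n) (i : Fin 3) (X : H) :
    8 * n * (n + 2) * ((n - 1) * C.div C.tau2 X + 2 * (n + 2) * C.div (C.U i) X) =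
      2 * (n - 1) * (2 * n + 1) * C.d (C.inc X) C.scal := by
  have h : C.d (C.inc X) C.scal = 8 * n * (n + 2) * C.d (C.inc X) C.Lam := by
    have hc : (8 * n * (n + 2) : A) = ((8 * n * (n + 2) : ℕ) : A) := by push_cast; rfl
    rw [C.scal_eq hN hn, hc, Derivation.leibniz, Derivation.map_natCast, smul_zero, add_zero,
      smul_eq_mul]
  rw [h, C.contracted_bianchi hN hn]
  ring

end ContactAlgebra

namespace Patch

variable {n : ℕ} {M : Type*} [TopologicalSpace M] [ChartedSpace (Model n) M]
  [IsManifold (𝓡 (4 * n + 3)) ∞ M] {S : PQCStructure n M} {V : Π x : M, Submodule ℝ (Tan n x)}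
  (P : Patch S V) (hV : IsVertical S V) {D : Connection n M}

lemma mu_eq_zero (hD : IsCanonicalConnection S hV D) (hn : n = 1) (s : Fin 3)
    (y : P.W) (u v : S.H (y : M)) :
    mu S hV D P.I P.ξ s y u v = 0 := by
  obtain ⟨w, hw⟩ := (S.g_neutral y).exists_ne_zero (by omega)
  have h := (hD.torsion_V y _ (P.ξ_mem y y.2 s)).skew_eq_zero (S.g_symm y)
    (P.frame.isParaquaternionic y.2) (P.frame.PQ_eq y y.2) (by rw [S.finrank_H, hn]) hw
    (P.I s y u) v
  rw [mu, torsionSkew, h, zero_div, mul_zero]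

variable [T2Space M] (hD : IsCanonicalConnection S hV D)

lemma fn_g_T (s : Fin 3) (X Y : HFields S P.W) (y : P.W) :
    fn ((P.contactAlgebra hV hD).g ((P.contactAlgebra hV hD).T s X) Y) y
      = S.g y (torsionEnd S hV D y (P.ξ s y) (hfld X y)) (hfld Y y) := by
  have h := P.hfld_torsion hV hD.smooth (P.xiL s) X y
  rw [fld_xiL] at h
  rw [← h]
  exact P.fn_gL _ _ y

lemma hfld_I (s : Fin 3) (X : HFields S P.W) (y : P.W) :
    hfld ((P.contactAlgebra hV hD).I s X) y = P.I s y (hfld X y) := P.hfld_IL s X y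

lemma tau_eq (X Y : HFields S P.W) (y : P.W) :
    tau S hV D P.I P.ξ y (hfld X y) (hfld Y y) = fn (P.gL ((algebraMap ℝ (SmoothFun n P.W) (1 / 2) •
      (P.contactAlgebra hV hD).tau2) X) Y) y := by
  have h := congrFun (congrArg fn ((P.contactAlgebra hV hD).g_tau2 X Y)) (y : M)
  simp only [fn_neg, fn_sum, fn_mul, fn_add, Pi.neg_apply, Finset.sum_apply, Pi.mul_apply,
    Pi.add_apply, fn_sg, fn_g_T, hfld_I] at h
  rw [LinearMap.smul_apply, map_smul, LinearMap.smul_apply, smul_eq_mul, fn_mul, Pi.mul_apply,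
    fn_algebraMap]
  refine Eq.trans ?_ (congrArg (fun r => 1 / 2 * r) h).symm
  rw [tau, mul_neg, Finset.mul_sum]
  congr 1
  refine Finset.sum_congr rfl fun s _ => ?_
  rw [torsionSym]
  ring

lemma mu_eq (hN : 4 < 4 * n) (s : Fin 3) (X Y : HFields S P.W) (y : P.W) :
    mu S hV D P.I P.ξ s y (hfld X y) (hfld Y y) = fn (P.gL ((algebraMap ℝ (SmoothFun n P.W) (1 / 2) •
      (P.contactAlgebra hV hD).U s) X) Y) y := by
  have h := congrFun (congrArg fn ((P.contactAlgebra hV hD).g_U hN s X Y)) (y : M)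
  simp only [fn_mul, fn_sub, Pi.mul_apply, Pi.sub_apply, fn_sg, fn_g_T, hfld_I] at h
  rw [LinearMap.smul_apply, map_smul, LinearMap.smul_apply, smul_eq_mul, fn_mul, Pi.mul_apply,
    fn_algebraMap]
  refine Eq.trans ?_ (congrArg (fun r => 1 / 2 * r) h).symm
  rw [mu, torsionSkew]
  ring

lemma divergence_mu_eq_zero (hD : IsCanonicalConnection S hV D) (hn : n = 1)
    (s : Fin 3) (X : HFields S P.W) (y : P.W) :
    divergence S hV D (mu S hV D P.I P.ξ s) y (hfld X y) = 0 := by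
  have h := P.divergence_eq hV hD (T := mu S hV D P.I P.ξ s) (Φ := 0) (fun X Y y => by
    rw [P.mu_eq_zero hV hD hn, LinearMap.zero_apply, map_zero, LinearMap.zero_apply, fn_zero]
    rfl) X y
  rw [h]
  simp only [ContactAlgebra.div, ContactAlgebra.covEnd_zero, LinearMap.zero_apply, map_zero,
    Finset.sum_const_zero, fn_zero]
  rfl

lemma contracted_bianchi (hD : IsCanonicalConnection S hV D) (hN : 4 < 4 * n)
    (s : Fin 3) (X : HFields S P.W) (y : P.W) :
    8 * n * (n + 2) * (((n : ℝ) - 1) * divergence S hV D (tau S hV D P.I P.ξ) y (hfld X y)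
      + 2 * ((n : ℝ) + 2) * divergence S hV D (mu S hV D P.I P.ξ s) y (hfld X y))
      = (n - 1) * (2 * n + 1) * dFun (pqcScal S hV D) y (hfld X y : Tan n (y : M)) := by
  have hc : ∀ k : ℕ, fn (k : SmoothFun n P.W) y = k := fun k => by
    rw [← map_natCast (algebraMap ℝ (SmoothFun n P.W)) k, fn_algebraMap]
  have h1 : fn (1 : SmoothFun n P.W) y = 1 := by simpa using hc 1
  have h2 : fn (2 : SmoothFun n P.W) y = 2 := by simpa using hc 2
  have h8 : fn (8 : SmoothFun n P.W) y = 8 := by simpa using hc 8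
  have h := congrFun (congrArg fn ((P.contactAlgebra hV hD).contracted_bianchi_scal hN rfl s X))
    (y : M)
  simp only [fn_mul, fn_add, fn_sub, Pi.mul_apply, Pi.add_apply, Pi.sub_apply, hc, h1, h2, h8] at h
  rw [P.divergence_eq hV hD (P.tau_eq hV hD), P.divergence_eq hV hD (P.mu_eq hV hD hN s),
    ContactAlgebra.div_algebraMap_smul, ContactAlgebra.div_algebraMap_smul, fn_mul, fn_mul,
    Pi.mul_apply, Pi.mul_apply, fn_algebraMap, P.dFun_pqcScal hV hD]
  have hd : fn ((P.contactAlgebra hV hD).d ((P.contactAlgebra hV hD).inc X)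
      (P.contactAlgebra hV hD).scal) y = fn ((P.contactAlgebra hV hD).d (incl X)
      (P.contactAlgebra hV hD).scal) y := rfl
  rw [hd] at h
  -- `tau2` and `U` are twice the endomorphisms of τ and μ, whence the division by two.
  linear_combination h / 2

end Patch

end PQC

end

theorem mainTheorem4 {n : ℕ} (hn : 1 ≤ n) {M : Type*} [TopologicalSpace M] [T2Space M]
    [SecondCountableTopology M] [ChartedSpace (PQC.Model n) M]
    [IsManifold (𝓡 (4 * n + 3)) ∞ M]
    (S : PQC.PQCStructure n M)
    {V : Π x : M, Submodule ℝ (PQC.Tan n x)} (hV : PQC.IsVertical S V)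
    (D : PQC.Connection n M) (hD : PQC.IsCanonicalConnection S hV D)
    {U : Set M} (hU : IsOpen U)
    (η : Fin 3 → Π x : M, PQC.Tan n x →L[ℝ] ℝ)
    (I : Fin 3 → Π x : M, Module.End ℝ (S.H x))
    (hηI : PQC.IsLocalFrame S.toHorizontalData U η I)
    (ξ : Fin 3 → Π x : M, PQC.Tan n x)
    (hξV : ∀ x ∈ U, ∀ s, ξ s x ∈ V x)
    (hξη : ∀ x ∈ U, ∀ s t, η s x (ξ t x) = if s = t then 1 else 0)
    (s : Fin 3) (x : M) (hx : x ∈ U) (X : S.H x) :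
    ((n : ℝ) - 1) * PQC.divergence S hV D (PQC.tau S hV D I ξ) x X
      + 2 * ((n : ℝ) + 2) * PQC.divergence S hV D (PQC.mu S hV D I ξ s) x X
      - ((n : ℝ) - 1) * (2 * n + 1) / (8 * n * (n + 2))
          * PQC.dFun (PQC.pqcScal S hV D) x (X : PQC.Tan n x) = 0 := by
  obtain ⟨P, hxP, rfl, rfl, rfl⟩ := PQC.exists_patch hV hU hηI hξV hξη hx
  have hX := P.hfld_constH ⟨x, hxP⟩ X
  -- For n = 1 the coefficients of τ and Scal contain the factor n - 1 = 0, and the divergence of μ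
  -- vanishes with μ. For n ≥ 2 the algebraic identity applies, as then N = 4n > 4.
  rcases hn.eq_or_lt with h1 | h1
  · have h := P.divergence_mu_eq_zero hV hD h1.symm s (P.constH ⟨x, hxP⟩ X) ⟨x, hxP⟩
    rw [hX] at h
    have hn1 : (n : ℝ) = 1 := by rw [← h1, Nat.cast_one]
    change PQC.divergence S hV D (PQC.mu S hV D P.I P.ξ s) x X = 0 at h
    rw [h, hn1]
    ring
  · have h := P.contracted_bianchi hV hD (by omega) s (P.constH ⟨x, hxP⟩ X) ⟨x, hxP⟩
    rw [hX] at h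
    have hn0 : (n : ℝ) ≠ 0 := by
      rw [Nat.cast_ne_zero]
      omega
    have hn2 : (n : ℝ) + 2 ≠ 0 := by positivity
    rw [sub_eq_zero, div_mul_eq_mul_div, eq_div_iff (by positivity), ← h]
    ring
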